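/- Let $V$ be a finite-dimensional real vector space with a lattice $\Lambda$, and let $V^*$ be its dual. Let $\mathfrak c\subset V$ be a pointed rational polyhedral cone with vertex $0$ (a finite intersection of closed half-spaces $\{x:\langle f,x\rangle\ge 0\}$ with $f\in V^*$ integral on $\Lambda$, containing no line), and let $\ell=\dim\mathfrak c$. Let $s\in V$, and let $\lambda\in V^*$ be such that $-\lambda$ lies in the interior of the dual cone of $\mathfrak c$, i.e. $\langle\lambda,x\rangle<0$ for every nonzero $x\in\mathfrak c$. Notation. For $\mathfrak p=a+\mathfrak c$ with $a\in V$, let $S(\mathfrak p)$ be the meromorphic continuation to $V^*_{\mathbb C}$ of $\xi\mapsto\sum_{x\in\mathfrak p\cap\Lambda}e^{\langle\xi,x\rangle}$, and let $M(a,\mathfrak c)(\xi)=e^{-\langle\xi,a\rangle}S(a+\mathfrak c)(\xi)$. Let $M(a,\mathfrak c)_{[m]}(\xi)$ be its homogeneous component of degree $m$: the coefficient of $z^m$ in the Laurent series of $z\mapsto M(a,\mathfrak c)(z\xi)$ at $z=0$. For a function $F$ on (part of) $V^*_{\mathbb C}$, $\lim_\lambda F(\xi)$ denotes the tempered generalized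 function $\lim_{\epsilon\to0,\,\epsilon>0}F(\xi+i\epsilon\lambda)$ on $V^*$ (limit after integration against Schwartz test densities on $V^*$). The Fourier transform is normalized by $\mathcal F(\phi\,dx)(\xi)=\int_V e^{-i\langle\xi,x\rangle}\phi(x)\,dx$. A step-polynomial function of $t\in\mathbb R$ is an element of the (complex) algebra generated by the functions $t\mapsto\{\gamma t\}$, $\gamma\in\mathbb R$, where $\{\cdot\}$ is the fractional part. We write $\phi(t)\sim\sum_{k\ge0}t^{-k}F_k(t)$, an asymptotic expansion with step-polynomial coefficients, if every $F_k$ is a step-polynomial function and $\phi(t)=\sum_{k=0}^n t^{-k}F_k(t)+O(t^{-n-1})$ as $t\to+\infty$, $t\in\mathbb R$, for every $n\ge 0$. For tempered distributions or generalized functions depending on $t$, this means that the expansion holds after pairing with each Schwartz test function or density. Theorem. For real $t>0$ consider the tempered distribution on $V$ $$\langle R_t(s+\mathfrak c),h\rangle=\frac1{t^\ell}\sum_{x\in(ts+\mathfrak c)\cap\Lambda}h\Big(\frac xt\Big).$$ All the boundary values below exist, and for every $t>0$ $$\mathcal F(R_t(s+\mathfrak c))(\xi)=\frac1{t^\ell}\lim\nolimits_\lambda\Big(S(ts+\mathfrak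 c)\big(-i\tfrac{\xi}{t}\big)\Big)=\frac1{t^\ell}e^{-i\langle\xi,s\rangle}\lim\nolimits_\lambda\Big(M(ts,\mathfrak c)\big(-i\tfrac{\xi}{t}\big)\Big).$$ When $t\to+\infty$, $t$ real, $R_t(s+\mathfrak c)$ has an asymptotic expansion with step-polynomial coefficients $R_t(s+\mathfrak c)\sim\sum_{k\ge0}t^{-k}A_k(t)$, where each $A_k(t)$ is a tempered distribution on $V$ with $$\mathcal F(A_k(t))(\xi)=e^{-i\langle\xi,s\rangle}\lim\nolimits_\lambda\Big(M(ts,\mathfrak c)_{[k-\ell]}(-i\xi)\Big).$$ Accordingly, as an asymptotic expansion with step-polynomial coefficients, $$\mathcal F(R_t(s+\mathfrak c))(\xi)\sim e^{-i\langle\xi,s\rangle}\sum_{k=0}^\infty\frac1{t^k}\lim\nolimits_\lambda\Big(M(ts,\mathfrak c)_{[k-\ell]}(-i\xi)\Big).$$ -/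

import Mathlib

open scoped SchwartzMap Topology Pointwise
open MeasureTheory Filter Asymptotics

noncomputable section

namespace RiemannSumCone

variable {V : Type*} [NormedAddCommGroup V] [NormedSpace ℝ V]

/-! ### Cones -/

/-- A rational polyhedral cone with vertex `0`: a finite intersection of closed half-spaces
`{x | 0 ≤ f x}` whose bounding hyperplanes are rational, i.e. given by linear forms `f` that are
integral on the lattice `Λ`. -/
def IsRationalCone (Λ : Submodule ℤ V) (c : Set V) : Prop :=
  ∃ F : Finset (StrongDual ℝ V),
    (∀ f ∈ F, ∀ x ∈ Λ, ∃ n : ℤ, f x = n) ∧ c = {x | ∀ f ∈ F, 0 ≤ f x}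

/-- The lineality space of a polyhedron: the directions `y` with `x + ℝ y ⊆ p` for all `x ∈ p`. -/
def linealitySpace (p : Set V) : Set V := {y | ∀ x ∈ p, ∀ r : ℝ, x + r • y ∈ p}

/-- A polyhedron is pointed when its lineality space is `{0}`. -/
def IsPointed (p : Set V) : Prop := linealitySpace p = {0}

/-- The dimension of a cone with vertex `0`, i.e. the dimension of its linear span. -/
def coneDim (c : Set V) : ℕ := Module.finrank ℝ (Submodule.span ℝ c)

/-! ### Generating functions

The complexified dual space `V*_ℂ` is `V →L[ℝ] ℂ`. -/

/-- The series `∑_{x ∈ p ∩ Λ} e^{⟨ζ, x⟩}`. -/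
def latticeSeries (Λ : Submodule ℤ V) (p : Set V) (ζ : V →L[ℝ] ℂ) : ℂ :=
  ∑' x : {x : Λ // (x : V) ∈ p}, Complex.exp (ζ x)

/-- The domain of absolute convergence of `∑_{x ∈ p ∩ Λ} e^{⟨ζ, x⟩}`. -/
def latticeSeriesDomain (Λ : Submodule ℤ V) (p : Set V) : Set (V →L[ℝ] ℂ) :=
  {ζ | Summable fun x : {x : Λ // (x : V) ∈ p} => Complex.exp (ζ x)}

/-- `w` is the value at `ζ` of a meromorphic continuation to `V*_ℂ` of the function
`ζ ↦ ∑_{x ∈ p ∩ Λ} e^{⟨ζ, x⟩}`: there are entire functions `g, q` such that `g / q` continues this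
function, `q ζ ≠ 0` and `w = g ζ / q ζ`.  (Meromorphic functions on a finite-dimensional complex
vector space are quotients of entire functions.) -/
def IsContinuationValue (Λ : Submodule ℤ V) (p : Set V) (ζ : V →L[ℝ] ℂ) (w : ℂ) : Prop :=
  ∃ g q : (V →L[ℝ] ℂ) → ℂ, AnalyticOnNhd ℂ g Set.univ ∧ AnalyticOnNhd ℂ q Set.univ ∧
    (∀ η ∈ latticeSeriesDomain Λ p, q η * latticeSeries Λ p η = g η) ∧
    q ζ ≠ 0 ∧ w = g ζ / q ζ

open Classical in
/-- The generating function `S(p)(ζ)` of the lattice points of `p`, as a meromorphic function on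
`V*_ℂ`.  The value at points where the function is not regular is `0` by convention. -/
def S (Λ : Submodule ℤ V) (p : Set V) (ζ : V →L[ℝ] ℂ) : ℂ :=
  if h : ∃ w, IsContinuationValue Λ p ζ w then h.choose else 0

/-- The shifted generating function `M(s, c)(ζ) = e^{-⟨ζ, s⟩} S(s + c)(ζ)`. -/
def M (Λ : Submodule ℤ V) (s : V) (c : Set V) (ζ : V →L[ℝ] ℂ) : ℂ :=
  Complex.exp (-ζ s) * S Λ (s +ᵥ c) ζ

/-- `f z = ∑_{n ∈ ℤ} a n z ^ n` for all small `z ≠ 0`, with only finitely many nonzero `a n`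
for `n < 0`. -/
def IsLaurentSeriesAtZero (f : ℂ → ℂ) (a : ℤ → ℂ) : Prop :=
  (∃ N : ℤ, ∀ n < N, a n = 0) ∧ ∀ᶠ z in 𝓝[≠] (0 : ℂ), HasSum (fun n : ℤ => a n * z ^ n) (f z)

open Classical in
/-- The coefficient of `z ^ m` in the Laurent series at `z = 0` of a function which is meromorphic
at `0` (with value `0` if there is no such series). -/
def laurentCoeff (f : ℂ → ℂ) (m : ℤ) : ℂ :=
  if h : ∃ a, IsLaurentSeriesAtZero f a then h.choose m else 0

/-- The homogeneous component `Φ_{[m]}(ζ)` of degree `m` at `0` of a meromorphic function `Φ` on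
`V*_ℂ`: the coefficient of `z ^ m` in the Laurent series of `z ↦ Φ (z ζ)` at `z = 0`. -/
def homComponent (Φ : (V →L[ℝ] ℂ) → ℂ) (m : ℤ) (ζ : V →L[ℝ] ℂ) : ℂ :=
  laurentCoeff (fun z => Φ (z • ζ)) m

/-! ### Step-polynomials and asymptotic expansions -/

/-- The (complex) algebra of step-polynomial functions on `ℝ`, generated by the functions
`t ↦ {γ t}`, `γ ∈ ℝ`. -/
def stepPolynomials : Subalgebra ℂ (ℝ → ℂ) :=
  Algebra.adjoin ℂ (Set.range fun γ : ℝ => fun t : ℝ => ((Int.fract (γ * t) : ℝ) : ℂ))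

/-- `φ(t) ∼ ∑_{k ≥ 0} t^{-k} F_k(t)` as `t → +∞`, `t` real, where the `F_k` are step-polynomials. -/
def HasStepPolynomialExpansion (φ : ℝ → ℂ) (F : ℕ → ℝ → ℂ) : Prop :=
  (∀ k, F k ∈ stepPolynomials) ∧
  ∀ n : ℕ, (fun t : ℝ => φ t - ∑ k ∈ Finset.range (n + 1), ((t : ℂ) ^ k)⁻¹ * F k t)
    =O[atTop] fun t : ℝ => (t ^ (n + 1))⁻¹

/-! ### Riemann sums as tempered distributions -/

theorem exists_latticeSum [FiniteDimensional ℝ V] (Λ : Submodule ℤ V) [DiscreteTopology Λ]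
    (p : Set V) {t : ℝ} (ht : 0 < t) :
    ∃ T : 𝓢(V, ℂ) →L[ℂ] ℂ, ∀ h : 𝓢(V, ℂ),
      HasSum (fun x : {x : Λ // (x : V) ∈ p} => h (t⁻¹ • (x : V))) (T h) := by
  obtain ⟨n, hn⟩ : ∃ n : ℕ, Module.finrank ℤ Λ < n := ⟨_, Nat.lt_succ_self _⟩
  have hw : Summable fun x : {x : Λ // (x : V) ∈ p} => ((1 + ‖t⁻¹ • (x : V)‖) ^ n)⁻¹ := by
    suffices h : Summable fun x : Λ => ((1 + ‖t⁻¹ • (x : V)‖) ^ n)⁻¹ from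
      h.comp_injective Subtype.val_injective
    have h0 := (ZLattice.summable_norm_sub_inv_pow (L := Λ) n hn 0).mul_left (t ^ n)
    refine h0.of_norm_bounded_eventually ?_
    refine (Set.finite_singleton (0 : Λ)).subset fun x hx => ?_
    by_contra hx0
    refine hx ?_
    change ‖((1 + ‖t⁻¹ • (x : V)‖) ^ n)⁻¹‖ ≤ t ^ n * ‖(x : V) - 0‖⁻¹ ^ n
    have hpos : 0 < ‖(x : V)‖ := by simpa using hx0
    rw [Real.norm_of_nonneg (by positivity), norm_smul, Real.norm_of_nonneg (by positivity),
      sub_zero, inv_pow, ← div_eq_mul_inv, ← inv_div, ← div_pow]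
    gcongr
    rw [div_eq_inv_mul]
    linarith
  have hb : ∀ (h : 𝓢(V, ℂ)) (x : V), ‖h x‖ ≤
      (2 ^ n * (Finset.Iic (n, 0)).sup (schwartzSeminormFamily ℂ V ℂ) h) *
        ((1 + ‖x‖) ^ n)⁻¹ := by
    intro h x
    have := SchwartzMap.one_add_le_sup_seminorm_apply (𝕜 := ℂ) (m := (n, 0)) (k := n) (n := 0)
      le_rfl le_rfl h x
    rw [norm_iteratedFDeriv_zero] at this
    rw [← div_eq_mul_inv, le_div_iff₀ (by positivity), mul_comm]
    exact this
  have hs : ∀ h : 𝓢(V, ℂ),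
      Summable fun x : {x : Λ // (x : V) ∈ p} => h (t⁻¹ • (x : V)) := fun h =>
    Summable.of_norm_bounded (hw.mul_left _) fun x => hb h _
  refine ⟨SchwartzMap.mkCLMtoNormedSpace (σ := RingHom.id ℂ)
    (fun h => ∑' x : {x : Λ // (x : V) ∈ p}, h (t⁻¹ • (x : V))) (fun f g => ?_) (fun a f => ?_)
    ⟨Finset.Iic (n, 0), 2 ^ n * ∑' x : {x : Λ // (x : V) ∈ p}, ((1 + ‖t⁻¹ • (x : V)‖) ^ n)⁻¹,
      mul_nonneg (by positivity) (tsum_nonneg fun x => by positivity), fun f => ?_⟩,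
    fun h => (hs h).hasSum⟩
  · simpa using (hs f).tsum_add (hs g)
  · simpa using tsum_mul_left
  · refine (tsum_of_norm_bounded (hw.hasSum.mul_left _) fun x => hb f _).trans (le_of_eq ?_)
    ring

open Classical in
/-- The tempered distribution `h ↦ ∑_{x ∈ p ∩ Λ} h (x / t)`, for `t > 0`. -/
def latticeSum [FiniteDimensional ℝ V] (Λ : Submodule ℤ V) [DiscreteTopology Λ]
    (p : Set V) (t : ℝ) : 𝓢'(V, ℂ) :=
  if ht : 0 < t then
    ContinuousLinearMap.toPointwiseConvergenceCLM _ _ _ _ (exists_latticeSum Λ p ht).choose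
  else 0

theorem hasSum_latticeSum [FiniteDimensional ℝ V] (Λ : Submodule ℤ V) [DiscreteTopology Λ]
    (p : Set V) {t : ℝ} (ht : 0 < t) (h : 𝓢(V, ℂ)) :
    HasSum (fun x : {x : Λ // (x : V) ∈ p} => h (t⁻¹ • (x : V))) (latticeSum Λ p t h) := by
  have := (exists_latticeSum Λ p ht).choose_spec h
  rw [latticeSum, dif_pos ht]
  exact this

/-- The distribution `⟨R_t(s + c), h⟩ = t^{-ℓ} ∑_{x ∈ (t s + c) ∩ Λ} h (x / t)`, `ℓ = dim c`,
for `t > 0`. -/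
def riemannSum [FiniteDimensional ℝ V] (Λ : Submodule ℤ V) [DiscreteTopology Λ]
    (s : V) (c : Set V) (t : ℝ) : 𝓢'(V, ℂ) :=
  ((t : ℂ) ^ coneDim c)⁻¹ • latticeSum Λ ((t • s) +ᵥ c) t

/-! ### Fourier transform and boundary values

`ν` is a Haar measure on the dual space `V*`; a generalized function on `V*` is a distribution `G`
whose value on the test density `ψ ν` is `G ψ`, and a function `F` on `V*` is identified with
`ψ ↦ ∫ F ψ dν`. -/

theorem exists_fourierDensity [FiniteDimensional ℝ V] (ν : Measure (StrongDual ℝ V))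
    [ν.IsAddHaarMeasure] :
    ∃ Φ : 𝓢(StrongDual ℝ V, ℂ) →L[ℂ] 𝓢(V, ℂ), ∀ (ψ : 𝓢(StrongDual ℝ V, ℂ)) (x : V),
      Φ ψ x = ∫ ξ, Complex.exp (-Complex.I * (ξ x : ℝ)) * ψ ξ ∂ν := by
  let W := EuclideanSpace ℝ (Fin (Module.finrank ℝ V))
  let e : V ≃L[ℝ] W := toEuclidean
  let a : W ≃L[ℝ] StrongDual ℝ V :=
    (InnerProductSpace.toDual ℝ W).toContinuousLinearEquiv.trans
      (e.symm.arrowCongr (ContinuousLinearEquiv.refl ℝ ℝ))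
  have ha : ∀ (y : W) (x : V), a y x = inner ℝ y (e x) := fun y x => by
    simp [a]
  let μ : Measure (StrongDual ℝ V) := (volume : Measure W).map a
  have : μ.IsAddHaarMeasure := a.isAddHaarMeasure_map volume
  let r : NNReal := Measure.addHaarScalarFactor ν μ
  have hν : ν = r • μ := Measure.isAddLeftInvariant_eq_smul ν μ
  let b : V ≃L[ℝ] W := e.trans (ContinuousLinearEquiv.smulLeft
    (Units.mk0 (2 * Real.pi)⁻¹ (by positivity)))
  have hbx : ∀ x, b x = (2 * Real.pi)⁻¹ • e x := fun x => rfl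
  refine ⟨(r : ℂ) • ((SchwartzMap.compCLMOfContinuousLinearEquiv ℂ b) ∘L
    (SchwartzMap.fourierTransformCLM ℂ) ∘L (SchwartzMap.compCLMOfContinuousLinearEquiv ℂ a)),
    fun ψ x => ?_⟩
  have hF : ∀ (φ : 𝓢(W, ℂ)) (w : W), SchwartzMap.fourierTransformCLM ℂ φ w =
      ∫ y, Complex.exp (↑(-2 * Real.pi * inner ℝ y w) * Complex.I) • φ y := fun φ w =>
    Real.fourier_eq' (φ : W → ℂ) w
  rw [hν, integral_smul_nnreal_measure]
  have : (∫ ξ, Complex.exp (-Complex.I * (ξ x : ℝ)) * ψ ξ ∂μ) =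
      ∫ y, Complex.exp (-Complex.I * (a y x : ℝ)) * ψ (a y) :=
    a.toHomeomorph.measurableEmbedding.integral_map _
  rw [this]
  simp only [_root_.smul_apply, ContinuousLinearMap.comp_apply,
    SchwartzMap.compCLMOfContinuousLinearEquiv_apply, Function.comp, hF]
  rw [NNReal.smul_def, Complex.real_smul, smul_eq_mul]
  congr 1
  refine integral_congr_ae (Eventually.of_forall fun y => ?_)
  simp only [smul_eq_mul, hbx, ha, inner_smul_right]
  congr 2
  push_cast
  have : (Real.pi : ℂ) ≠ 0 := by exact_mod_cast Real.pi_ne_zero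
  field_simp

/-- The Fourier transform `x ↦ ∫_{V*} e^{-i⟨ξ, x⟩} ψ(ξ) dν(ξ)` of a test density `ψ ν` on `V*`, as
a Schwartz function on `V`. -/
def fourierDensity [FiniteDimensional ℝ V] (ν : Measure (StrongDual ℝ V)) [ν.IsAddHaarMeasure] :
    𝓢(StrongDual ℝ V, ℂ) →L[ℂ] 𝓢(V, ℂ) :=
  (exists_fourierDensity ν).choose

theorem fourierDensity_apply [FiniteDimensional ℝ V] (ν : Measure (StrongDual ℝ V))
    [ν.IsAddHaarMeasure] (ψ : 𝓢(StrongDual ℝ V, ℂ)) (x : V) :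
    fourierDensity ν ψ x = ∫ ξ, Complex.exp (-Complex.I * (ξ x : ℝ)) * ψ ξ ∂ν :=
  (exists_fourierDensity ν).choose_spec ψ x

/-- The Fourier transform of a tempered distribution on `V`, a generalized function on `V*`:
`⟨𝓕 T, ψ ν⟩ = ⟨T, 𝓕 (ψ ν)⟩`.  It extends `𝓕(φ dx)(ξ) = ∫_V e^{-i⟨ξ, x⟩} φ(x) dx`. -/
def fourierDistribution [FiniteDimensional ℝ V] (ν : Measure (StrongDual ℝ V))
    [ν.IsAddHaarMeasure] (T : 𝓢'(V, ℂ)) : 𝓢'(StrongDual ℝ V, ℂ) :=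
  PointwiseConvergenceCLM.precomp _ (fourierDensity ν) T

/-- The multiplication of a generalized function on `V*` by the function `ξ ↦ e^{-i⟨ξ, s⟩}`. -/
def expMul (s : V) : 𝓢'(StrongDual ℝ V, ℂ) →L[ℂ] 𝓢'(StrongDual ℝ V, ℂ) :=
  TemperedDistribution.smulLeftCLM ℂ fun ξ : StrongDual ℝ V =>
    Complex.exp (-Complex.I * (ξ s : ℝ))

/-- The function `ξ ↦ e^{-i⟨ξ, s⟩}` may be used as a multiplier. -/
theorem hasTemperateGrowth_exp (s : V) : Function.HasTemperateGrowth
    fun ξ : StrongDual ℝ V => Complex.exp (-Complex.I * (ξ s : ℝ)) := by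
  have key : ∀ n : ℕ, ∀ u : ℝ, iteratedDeriv n (fun u : ℝ => Complex.exp (-Complex.I * u)) u =
      (-Complex.I) ^ n * Complex.exp (-Complex.I * u) := by
    intro n
    induction n with
    | zero => simp
    | succ n ih =>
      intro u
      rw [iteratedDeriv_succ, funext ih]
      have h : HasDerivAt (fun u : ℝ => Complex.exp (-Complex.I * u))
          (Complex.exp (-Complex.I * u) * (-Complex.I * 1)) u :=
        ((Complex.ofRealCLM.hasDerivAt (x := u)).const_mul (-Complex.I)).cexp
      rw [(h.const_mul _).deriv]
      ring
  have hg : Function.HasTemperateGrowth fun u : ℝ => Complex.exp (-Complex.I * u) := by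
    refine ⟨(contDiff_const.mul Complex.ofRealCLM.contDiff).cexp, fun n => ⟨0, 1, fun u => ?_⟩⟩
    rw [norm_iteratedFDeriv_eq_norm_iteratedDeriv, key]
    simp [Complex.norm_exp]
  exact hg.comp (ContinuousLinearMap.apply ℝ ℝ s).hasTemperateGrowth

/-- The real covector `ξ`, seen in the complexified dual space. -/
def toComplex (ξ : StrongDual ℝ V) : V →L[ℝ] ℂ := Complex.ofRealCLM ∘L ξ

/-- `G = lim_lam F`: the functions `ξ ↦ F (ξ + i ε lam)` on `V*` converge to the generalized
function `G` as `ε → 0`, `ε > 0`, when integrated against test densities. -/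
def IsBoundaryValue [FiniteDimensional ℝ V] (ν : Measure (StrongDual ℝ V))
    (lam : StrongDual ℝ V) (F : (V →L[ℝ] ℂ) → ℂ) (G : 𝓢'(StrongDual ℝ V, ℂ)) : Prop :=
  ∀ ψ : 𝓢(StrongDual ℝ V, ℂ),
    (∀ᶠ ε : ℝ in 𝓝[>] 0, Integrable
      (fun ξ => F (toComplex ξ + (Complex.I * ε) • toComplex lam) * ψ ξ) ν) ∧
    Tendsto
      (fun ε : ℝ => ∫ ξ, F (toComplex ξ + (Complex.I * ε) • toComplex lam) * ψ ξ ∂ν)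
      (𝓝[>] 0) (𝓝 (G ψ))

end RiemannSumCone

end

/-!
The lattice points of `ts + c` are decomposed into finitely many families with the structure of
`ℕ ^ d`, and the theorem is reduced to statements about one such family.

A rational cone is a disjoint union of relatively open simplicial cones spanned by lattice vectors
(`IsRationalCone.isSimplicialUnion`), and the lattice points of the shifts of such a cone split
into residue classes modulo the lattice spanned by a basis that contains its edges.  Inside
`a + c`, a residue class is either empty or of the form `a + ∑ (κ_j + k_j) b_j`, `k ∈ ℕ ^ J`, with
offsets `κ_j ∈ (0, 1]` given by fractional parts of coordinates of `a`
(`IsRationalCone.exists_cellDecomposition`, `CellDecomposition.tsum_eq`).  The generating function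
of a class is thus a product of geometric series, which gives the meromorphic continuation `S`
together with its uniqueness, and the Laurent coefficients of `M`: the component of degree `m` is
`∏ (-1 / ζ_j)`, `ζ_j = ⟨ζ, b_j⟩`, times the homogeneous component of degree `m + |J|` of
`∏_j B(κ_j, ζ_j)`, where `B(κ, z) = z e^{κ z} / (e^z - 1)` generates the Bernoulli polynomials
(`CellDecomposition.homComponent_M_eq`).

On the analytic side, the same classes turn the Riemann sum of a Schwartz function `h` into
Riemann sums over orthants with mesh `1 / t`.  Taylor expansion around the sampling points on each
cube of the mesh expresses integrals by Riemann sums of derivatives, with coefficients from the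
moment series `(e^{(1 - κ) z} - e^{-κ z}) / z`.  This series is the inverse of `B(κ, z)`
(`momentSeries_mul_bernoulliSeries`), so the relation can be inverted, and the Riemann sum becomes
`∑_m t^{-m} ∫ P_m(∂) h`, where `P_m` is the homogeneous component of degree `m` of
`∏_j B(κ_j, ∂_j)`, uniformly in `κ` (`JetFamily.exists_orthantSum_sub_bound`).

The two sides match through `∏ (-1 / ζ_j) = ∫_{x > 0} e^{∑ x_j ζ_j} dx` for `Re ζ_j < 0`: for
`ζ = -i(ξ + iε lam)` Fubini's theorem and dominated convergence show that the boundary value of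
`∏ (-1 / ζ_j) P(ζ)` is the Fourier transform of `h ↦ ∫_{x > 0} (P(∂) h)(∑ x_j b_j) dx`
(`Cell.tendsto_integral_prod_inv_mul_eval`).  For `S` itself the boundary value is computed
termwise (`CellDecomposition.isBoundaryValue_S`).

The coefficients are step-polynomials because the offsets of `ts` are `1 - {γ t + β}`, where `β`
is rational since the residue classes consist of lattice points; rational shifts and the indicator
functions of `γ t + β ∈ ℤ` stay inside the algebra (`fract_add_mem_stepPolynomials`).
-/

noncomputable section

namespace RiemannSumCone

universe u

/-! ### Generating series -/

section

/-- The generating series `∑ B_m(κ) / m! X ^ m = X e^{κ X} / (e ^ X - 1)` of the Bernoulli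
polynomials at `κ`. -/
def bernoulliSeries (κ : ℂ) : PowerSeries ℂ :=
  PowerSeries.mk fun n => Polynomial.aeval κ ((1 / n.factorial : ℚ) • Polynomial.bernoulli n)

/-- The series `∑ c_m(κ) X ^ m = e^{-κ X} (e ^ X - 1) / X` of the normalized moments
`c_m(κ) = ∫_0^1 (x - κ) ^ m / m! dx` of a unit cell about the point `κ`. -/
def momentSeries (κ : ℂ) : PowerSeries ℂ :=
  PowerSeries.mk fun n => ((1 - κ) ^ (n + 1) - (-κ) ^ (n + 1)) / (n + 1).factorial

theorem bernoulliSeries_mul (κ : ℂ) :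
    bernoulliSeries κ * (PowerSeries.exp ℂ - 1) =
      PowerSeries.X * PowerSeries.rescale κ (PowerSeries.exp ℂ) :=
  Polynomial.bernoulli_generating_function κ

theorem X_mul_momentSeries (κ : ℂ) :
    PowerSeries.X * momentSeries κ =
      PowerSeries.rescale (-κ) (PowerSeries.exp ℂ) * (PowerSeries.exp ℂ - 1) := by
  have h : PowerSeries.rescale (-κ) (PowerSeries.exp ℂ) * (PowerSeries.exp ℂ - 1) =
      PowerSeries.rescale (1 - κ) (PowerSeries.exp ℂ) -
        PowerSeries.rescale (-κ) (PowerSeries.exp ℂ) := by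
    have := PowerSeries.exp_mul_exp_eq_exp_add (A := ℂ) (-κ) 1
    rw [PowerSeries.rescale_one, RingHom.id_apply] at this
    rw [mul_sub, this, mul_one]
    congr 3
    ring
  rw [h]
  ext n
  cases n with
  | zero =>
    rw [map_sub, PowerSeries.coeff_rescale, PowerSeries.coeff_rescale]
    simp
  | succ n =>
    rw [PowerSeries.coeff_succ_X_mul]
    simp only [momentSeries, PowerSeries.coeff_mk, map_sub, PowerSeries.coeff_rescale,
      PowerSeries.coeff_exp]
    simp only [one_div, map_inv₀, map_natCast]
    ring

theorem momentSeries_mul_bernoulliSeries (κ : ℂ) : momentSeries κ * bernoulliSeries κ = 1 := by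
  have hX : (PowerSeries.X : PowerSeries ℂ) ≠ 0 := PowerSeries.X_ne_zero
  refine mul_left_cancel₀ hX ?_
  have := PowerSeries.exp_mul_exp_eq_exp_add (A := ℂ) (-κ) κ
  rw [neg_add_cancel, PowerSeries.rescale_zero_apply] at this
  rw [← mul_assoc, X_mul_momentSeries, mul_assoc, mul_comm (PowerSeries.exp ℂ - 1),
    bernoulliSeries_mul, mul_left_comm, this]
  simp

/-- The coefficients of the Bernoulli series are polynomials in `κ`. -/
theorem exists_coeff_bernoulliSeries (n : ℕ) :
    ∃ q : Polynomial ℂ, ∀ κ, PowerSeries.coeff n (bernoulliSeries κ) = q.eval κ :=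
  ⟨((1 / n.factorial : ℚ) • Polynomial.bernoulli n).map (algebraMap ℚ ℂ), fun κ => by
    rw [bernoulliSeries, PowerSeries.coeff_mk, Polynomial.eval_map_algebraMap]⟩

section Multivariate

variable {σ : Type*} [Fintype σ]

/-- The series `∏_j p_j(z_j X)` with coefficients in the polynomial ring in the variables `z_j`:
its coefficient of `X ^ m` is the homogeneous component of degree `m` of `∏_j p_j(z_j)`. -/
def homSeries (p : σ → PowerSeries ℂ) : PowerSeries (MvPolynomial σ ℂ) :=
  ∏ j, PowerSeries.rescale (MvPolynomial.X j) ((p j).map MvPolynomial.C)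

theorem homSeries_mul (p q : σ → PowerSeries ℂ) :
    homSeries p * homSeries q = homSeries fun j => p j * q j := by
  simp [homSeries, Finset.prod_mul_distrib]

theorem homSeries_one : homSeries (fun _ : σ => 1) = 1 := by
  simp [homSeries]

theorem coeff_homSeries [DecidableEq σ] (p : σ → PowerSeries ℂ) (m : ℕ) :
    PowerSeries.coeff m (homSeries p) =
      ∑ l ∈ Finset.finsuppAntidiag Finset.univ m,
        (∏ j, PowerSeries.coeff (l j) (p j)) •
          ∏ j, (MvPolynomial.X j : MvPolynomial σ ℂ) ^ l j := by
  rw [homSeries, PowerSeries.coeff_prod]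
  refine Finset.sum_congr rfl fun l _ => ?_
  simp only [PowerSeries.coeff_rescale, PowerSeries.coeff_map]
  rw [Finset.prod_mul_distrib, mul_comm, ← map_prod, MvPolynomial.smul_eq_C_mul]

/-- Inverse generating series have convolution-inverse homogeneous components. -/
theorem sum_antidiagonal_homSeries (κ : σ → ℂ) (m : ℕ) :
    ∑ p ∈ Finset.HasAntidiagonal.antidiagonal m,
      PowerSeries.coeff p.1 (homSeries fun j => momentSeries (κ j)) *
        PowerSeries.coeff p.2 (homSeries fun j => bernoulliSeries (κ j)) =
      if m = 0 then 1 else 0 := by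
  rw [← PowerSeries.coeff_mul, homSeries_mul]
  simp only [momentSeries_mul_bernoulliSeries]
  rw [homSeries_one, PowerSeries.coeff_one]

theorem map_eval_homSeries (p : σ → PowerSeries ℂ) (w : σ → ℂ) :
    (homSeries p).map (MvPolynomial.eval w) = ∏ j, PowerSeries.rescale (w j) (p j) := by
  rw [homSeries, map_prod]
  refine Finset.prod_congr rfl fun j _ => ?_
  ext n
  simp

end Multivariate

/-! ### Power series expansions at the origin -/

/-- The power series `p` converges absolutely to `f` near `0`. -/
def HasExpansion (f : ℂ → ℂ) (p : PowerSeries ℂ) : Prop :=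
  ∀ᶠ z in 𝓝 (0 : ℂ), Summable (fun n => ‖PowerSeries.coeff n p * z ^ n‖) ∧
    HasSum (fun n => PowerSeries.coeff n p * z ^ n) (f z)

namespace HasExpansion

variable {f g : ℂ → ℂ} {p q : PowerSeries ℂ}

theorem congr (hf : HasExpansion f p) (h : f =ᶠ[𝓝 0] g) : HasExpansion g p := by
  filter_upwards [hf, h] with z hz h
  rwa [← h]

theorem mul (hf : HasExpansion f p) (hg : HasExpansion g q) :
    HasExpansion (fun z => f z * g z) (p * q) := by
  filter_upwards [hf, hg] with z ⟨hf1, hf2⟩ ⟨hg1, hg2⟩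
  have h : ∀ n, PowerSeries.coeff n (p * q) * z ^ n = ∑ kl ∈ Finset.HasAntidiagonal.antidiagonal n,
      (PowerSeries.coeff kl.1 p * z ^ kl.1) * (PowerSeries.coeff kl.2 q * z ^ kl.2) := by
    intro n
    rw [PowerSeries.coeff_mul, Finset.sum_mul]
    refine Finset.sum_congr rfl fun kl hkl => ?_
    rw [← Finset.HasAntidiagonal.mem_antidiagonal.1 hkl, pow_add]
    ring
  have hs := summable_norm_sum_mul_antidiagonal_of_summable_norm hf1 hg1
  simp only [h]
  refine ⟨hs, ?_⟩
  rw [hs.of_norm.hasSum_iff, ← hf2.tsum_eq, ← hg2.tsum_eq,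
    tsum_mul_tsum_eq_tsum_sum_antidiagonal_of_summable_norm hf1 hg1]

theorem one : HasExpansion (fun _ => 1) 1 := by
  refine Eventually.of_forall fun z => ?_
  have h : ∀ n ∉ ({0} : Finset ℕ), PowerSeries.coeff n (1 : PowerSeries ℂ) * z ^ n = 0 := by
    intro n hn
    simp [PowerSeries.coeff_one, Finset.mem_singleton.not.1 hn]
  refine ⟨summable_of_ne_finset_zero (s := {0}) fun n hn => by rw [h n hn, norm_zero], ?_⟩
  simpa using hasSum_sum_of_ne_finset_zero h

theorem id : HasExpansion (fun z => z) PowerSeries.X := by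
  refine Eventually.of_forall fun z => ?_
  have h : ∀ n ∉ ({1} : Finset ℕ),
      PowerSeries.coeff n (PowerSeries.X : PowerSeries ℂ) * z ^ n = 0 := by
    intro n hn
    simp [PowerSeries.coeff_X, Finset.mem_singleton.not.1 hn]
  refine ⟨summable_of_ne_finset_zero (s := {1}) fun n hn => by rw [h n hn, norm_zero], ?_⟩
  simpa using hasSum_sum_of_ne_finset_zero h

theorem prod {σ : Type*} (s : Finset σ) {F : σ → ℂ → ℂ} {P : σ → PowerSeries ℂ}
    (h : ∀ j ∈ s, HasExpansion (F j) (P j)) :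
    HasExpansion (fun z => ∏ j ∈ s, F j z) (∏ j ∈ s, P j) := by
  classical
  induction s using Finset.induction_on with
  | empty => simpa using one
  | insert j s hj ih =>
    simp only [Finset.prod_insert hj]
    exact (h j (Finset.mem_insert_self _ _)).mul
      (ih fun i hi => h i (Finset.mem_insert_of_mem hi))

theorem sub (hf : HasExpansion f p) (hg : HasExpansion g q) :
    HasExpansion (fun z => f z - g z) (p - q) := by
  filter_upwards [hf, hg] with z ⟨hf1, hf2⟩ ⟨hg1, hg2⟩
  simp only [map_sub, sub_mul]
  exact ⟨(hf1.add hg1).of_nonneg_of_le (fun _ => norm_nonneg _) fun n => norm_sub_le _ _,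
    hf2.sub hg2⟩

theorem comp_mul (hf : HasExpansion f p) (w : ℂ) :
    HasExpansion (fun z => f (w * z)) (PowerSeries.rescale w p) := by
  have h : Tendsto (fun z : ℂ => w * z) (𝓝 0) (𝓝 0) := by
    simpa using (continuous_const_mul w).tendsto (0 : ℂ)
  filter_upwards [h.eventually hf] with z hz
  simpa only [PowerSeries.coeff_rescale, mul_pow, mul_assoc, mul_left_comm] using hz

theorem hasFPowerSeriesAt (hf : HasExpansion f p) :
    HasFPowerSeriesAt f (FormalMultilinearSeries.ofScalars ℂ fun n => PowerSeries.coeff n p) 0 := by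
  rw [hasFPowerSeriesAt_iff]
  filter_upwards [hf] with z hz
  simpa [mul_comm] using hz.2

theorem unique (hf : HasExpansion f p) (hf' : HasExpansion f q) : p = q := by
  ext n
  have := hf.hasFPowerSeriesAt.eq_formalMultilinearSeries hf'.hasFPowerSeriesAt
  simpa using congrArg (fun P => P.coeff n) this

theorem of_hasFPowerSeriesAt {P : FormalMultilinearSeries ℂ ℂ ℂ} (h : HasFPowerSeriesAt f P 0) :
    HasExpansion f (PowerSeries.mk fun n => P.coeff n) := by
  obtain ⟨r, hr⟩ := h
  filter_upwards [Metric.eball_mem_nhds (0 : ℂ) hr.r_pos] with z hz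
  have h1 := hr.hasSum hz
  have h2 := P.summable_norm_apply (x := z) (Metric.eball_subset_eball hr.r_le hz)
  simp only [FormalMultilinearSeries.apply_eq_pow_smul_coeff, zero_add, smul_eq_mul] at h1 h2
  simp only [PowerSeries.coeff_mk, mul_comm _ (z ^ _)]
  exact ⟨h2, h1⟩

theorem exp (w : ℂ) :
    HasExpansion (fun z => Complex.exp (w * z)) (PowerSeries.rescale w (PowerSeries.exp ℂ)) := by
  refine HasExpansion.comp_mul (f := Complex.exp) (Eventually.of_forall fun z => ?_) w
  have h : ∀ n, PowerSeries.coeff n (PowerSeries.exp ℂ) * z ^ n = z ^ n / n.factorial := by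
    intro n
    simp [PowerSeries.coeff_exp, div_eq_mul_inv, mul_comm]
  simp only [h]
  refine ⟨NormedSpace.norm_expSeries_div_summable z, ?_⟩
  rw [Complex.exp_eq_exp_ℂ]
  exact NormedSpace.expSeries_div_hasSum_exp z

end HasExpansion

/-- `z e^{κ z} / (e ^ z - 1)` is given near the origin by the Bernoulli series. -/
theorem exists_hasExpansion_bernoulliSeries (κ : ℂ) :
    ∃ f : ℂ → ℂ, HasExpansion f (bernoulliSeries κ) ∧
      ∀ᶠ z in 𝓝 (0 : ℂ), z ≠ 0 → f z = z * Complex.exp (κ * z) / (Complex.exp z - 1) := by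
  have hd : AnalyticAt ℂ (dslope Complex.exp 0) 0 := by
    obtain ⟨P, hP⟩ := (analyticAt_cexp : AnalyticAt ℂ Complex.exp 0)
    exact ⟨_, hP.has_fpower_series_dslope_fslope⟩
  have hd0 : dslope Complex.exp 0 0 ≠ 0 := by simp
  have hmul : ∀ z, z * dslope Complex.exp 0 z = Complex.exp z - 1 := by
    intro z
    simpa using sub_smul_dslope Complex.exp 0 z
  have hne : ∀ᶠ z in 𝓝 (0 : ℂ), dslope Complex.exp 0 z ≠ 0 := hd.continuousAt.eventually_ne hd0
  have ha : AnalyticAt ℂ (fun z => Complex.exp (κ * z) / dslope Complex.exp 0 z) 0 :=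
    AnalyticAt.div (by fun_prop) hd hd0
  obtain ⟨P, hP⟩ := ha
  refine ⟨fun z => Complex.exp (κ * z) / dslope Complex.exp 0 z, ?_, ?_⟩
  rotate_left
  · filter_upwards [hne] with z hz hz0
    rw [← hmul z, mul_div_mul_left _ _ hz0]
  have hf := HasExpansion.of_hasFPowerSeriesAt hP
  have h1 := hf.mul ((HasExpansion.exp 1).sub HasExpansion.one)
  have h2 := HasExpansion.id.mul (HasExpansion.exp κ)
  rw [PowerSeries.rescale_one, RingHom.id_apply] at h1
  have h3 := (h1.congr (g := fun z => z * Complex.exp (κ * z)) (by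
    filter_upwards [hne] with z hz
    rw [one_mul, ← hmul z]
    field_simp)).unique h2
  have h4 : PowerSeries.exp ℂ - 1 ≠ 0 := by
    intro h
    have := congrArg (PowerSeries.coeff 1) h
    simp [PowerSeries.coeff_exp, PowerSeries.coeff_one] at this
  rw [← bernoulliSeries_mul] at h3
  rwa [mul_right_cancel₀ h4 h3] at hf

/-! ### Laurent series -/

theorem IsLaurentSeriesAtZero.unique {f : ℂ → ℂ} {a a' : ℤ → ℂ} (h : IsLaurentSeriesAtZero f a)
    (h' : IsLaurentSeriesAtZero f a') : a = a' := by
  obtain ⟨⟨N, hN⟩, h⟩ := h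
  obtain ⟨⟨N', hN'⟩, h'⟩ := h'
  -- multiplication by a power of `z` turns both Laurent series into power series
  let K := min N N'
  have key : ∀ {b : ℤ → ℂ} {z w : ℂ}, (∀ n < K, b n = 0) → z ≠ 0 →
      HasSum (fun n : ℤ => b n * z ^ n) w →
      HasSum (fun n : ℕ => b (n + K) * z ^ n) (w * z ^ (-K)) := by
    intro b z w hb hz hs
    have hinj : Function.Injective fun n : ℕ => (n : ℤ) + K := fun m n h => by simpa using h
    have := (hinj.hasSum_iff (f := fun n : ℤ => b n * z ^ n) (a := w) (fun n hn => by
      rw [hb n, zero_mul]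
      by_contra hlt
      exact hn ⟨(n - K).toNat, by simp only; omega⟩)).2 hs
    refine (this.mul_right (z ^ (-K))).congr_fun fun n => ?_
    simp only [Function.comp, mul_assoc]
    rw [← zpow_add₀ hz, add_neg_cancel_right, zpow_natCast]
  have h1 : HasFPowerSeriesAt (fun z : ℂ => if z = 0 then a K - a' K else 0)
      (FormalMultilinearSeries.ofScalars ℂ fun n : ℕ => a (n + K) - a' (n + K)) 0 := by
    rw [hasFPowerSeriesAt_iff]
    filter_upwards [eventually_nhdsWithin_iff.1 h, eventually_nhdsWithin_iff.1 h'] with z hz hz'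
    by_cases hz0 : z = 0
    · subst hz0
      have h0 : ∀ n ∉ ({0} : Finset ℕ), (0 : ℂ) ^ n * (a (n + K) - a' (n + K)) = 0 := by
        intro n hn
        simp [Finset.mem_singleton.not.1 hn]
      simpa using hasSum_sum_of_ne_finset_zero h0
    · have := (key (fun n hn => hN n (by omega)) hz0 (hz hz0)).sub
        (key (fun n hn => hN' n (by omega)) hz0 (hz' hz0))
      simpa [hz0, mul_comm, mul_sub] using this
  have hK : a K - a' K = 0 := by
    have hc : Tendsto (fun z : ℂ => if z = 0 then a K - a' K else 0) (𝓝[≠] 0) (𝓝 (a K - a' K)) := by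
      simpa using h1.continuousAt.tendsto.mono_left nhdsWithin_le_nhds
    refine tendsto_nhds_unique hc ((tendsto_const_nhds (x := (0 : ℂ))).congr' ?_)
    filter_upwards [self_mem_nhdsWithin] with z hz
    exact (if_neg hz).symm
  simp only [hK, ite_self] at h1
  have h2 := h1.eq_zero
  have h3 : ∀ n : ℕ, a (n + K) = a' (n + K) := fun n => by
    have := congrArg (fun P => P.coeff n) h2
    have h0 : (0 : FormalMultilinearSeries ℂ ℂ ℂ).coeff n = 0 := rfl
    simpa [h0, sub_eq_zero] using this
  funext n
  rcases lt_or_ge n K with hn | hn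
  · rw [hN n (by omega), hN' n (by omega)]
  · simpa [hn] using h3 (n - K).toNat

theorem laurentCoeff_eq {f : ℂ → ℂ} {a : ℤ → ℂ} (h : IsLaurentSeriesAtZero f a) (m : ℤ) :
    laurentCoeff f m = a m := by
  have hex : ∃ a, IsLaurentSeriesAtZero f a := ⟨a, h⟩
  rw [laurentCoeff, dif_pos hex, hex.choose_spec.unique h]

end

/-! ### Taylor expansion of rapidly decreasing functions -/

section

/-- Taylor's formula with a crude remainder, for a sequence `G 0, G 1, …` of functions each of which
is the derivative of the preceding one. -/
theorem norm_sub_taylor_le (N : ℕ) {G : ℕ → ℝ → ℂ}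
    (hG : ∀ m θ, HasDerivAt (G m) (G (m + 1) θ) θ) {C : ℝ} (hC0 : 0 ≤ C)
    (hC : ∀ θ ∈ Set.Icc (0 : ℝ) 1, ‖G N θ‖ ≤ C) :
    ∀ θ ∈ Set.Icc (0 : ℝ) 1,
      ‖G 0 θ - ∑ m ∈ Finset.range N, ((θ ^ m / m.factorial : ℝ) : ℂ) * G m 0‖ ≤ C := by
  induction N generalizing G with
  | zero => simpa using hC
  | succ N ih =>
    have ih' := ih (G := fun m => G (m + 1)) (fun m θ => hG (m + 1) θ) hC
    intro θ hθ
    have hder : ∀ x ∈ Set.Icc (0 : ℝ) 1, HasDerivWithinAt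
        (fun θ => G 0 θ - ∑ m ∈ Finset.range (N + 1), ((θ ^ m / m.factorial : ℝ) : ℂ) * G m 0)
        (G 1 x - ∑ m ∈ Finset.range N, ((x ^ m / m.factorial : ℝ) : ℂ) * G (m + 1) 0)
        (Set.Icc 0 1) x := by
      intro x _
      refine ((hG 0 x).sub ?_).hasDerivWithinAt
      simp only [Finset.sum_range_succ' _ N, pow_zero, Nat.factorial_zero, Nat.cast_one, div_one,
        Complex.ofReal_one, one_mul]
      refine (HasDerivAt.fun_sum fun m _ => ?_).add_const _
      refine HasDerivAt.mul_const ?_ _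
      refine HasDerivAt.ofReal_comp ?_
      have := (hasDerivAt_pow (m + 1) x).div_const ((m + 1).factorial : ℝ)
      refine this.congr_deriv ?_
      rw [Nat.factorial_succ]
      push_cast
      field_simp
    have := (convex_Icc (0 : ℝ) 1).norm_image_sub_le_of_norm_hasDerivWithin_le hder
      (fun x hx => ih' x hx) (Set.left_mem_Icc.2 zero_le_one) hθ
    have h0 : G 0 0 - ∑ m ∈ Finset.range (N + 1),
        (((0 : ℝ) ^ m / m.factorial : ℝ) : ℂ) * G m 0 = 0 := by
      rw [Finset.sum_range_succ']
      simp
    rw [h0, sub_zero] at this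
    refine this.trans ?_
    rw [sub_zero, Real.norm_of_nonneg hθ.1]
    exact mul_le_of_le_one_right hC0 hθ.2

variable {σ : Type*} [Fintype σ]

/-- The exponential series of the linear form `∑_j w_j z_j`. -/
theorem homSeries_exp (w : σ → ℂ) :
    homSeries (fun j => PowerSeries.rescale (w j) (PowerSeries.exp ℂ)) =
      PowerSeries.rescale (∑ j, MvPolynomial.C (w j) * MvPolynomial.X j)
        (PowerSeries.exp (MvPolynomial σ ℂ)) := by
  have h : ∀ j, PowerSeries.rescale (MvPolynomial.X j)
      ((PowerSeries.rescale (w j) (PowerSeries.exp ℂ)).map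
        (MvPolynomial.C : ℂ →+* MvPolynomial σ ℂ)) =
      PowerSeries.rescale (MvPolynomial.C (w j) * MvPolynomial.X j)
        (PowerSeries.exp (MvPolynomial σ ℂ)) := by
    intro j
    ext1 n
    have : MvPolynomial.C (algebraMap ℚ ℂ (1 / n.factorial)) =
        algebraMap ℚ (MvPolynomial σ ℂ) (1 / n.factorial) :=
      (IsScalarTower.algebraMap_apply ℚ ℂ (MvPolynomial σ ℂ) _).symm
    simp only [PowerSeries.coeff_rescale, PowerSeries.coeff_map, PowerSeries.coeff_exp, map_mul,
      map_pow, mul_pow, this]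
    ring
  simp only [homSeries, h]
  classical
  refine Finset.induction_on (motive := fun s => ∏ j ∈ s, PowerSeries.rescale
    (MvPolynomial.C (w j) * MvPolynomial.X j) (PowerSeries.exp (MvPolynomial σ ℂ)) =
      PowerSeries.rescale (∑ j ∈ s, MvPolynomial.C (w j) * MvPolynomial.X j)
        (PowerSeries.exp (MvPolynomial σ ℂ))) Finset.univ ?_ fun j s hj ih => ?_
  · simp
  · rw [Finset.prod_insert hj, Finset.sum_insert hj, ih, PowerSeries.exp_mul_exp_eq_exp_add]

/-- The multinomial theorem, read off from the exponential series. -/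
theorem linearForm_pow (w : σ → ℂ) [DecidableEq σ] (m : ℕ) :
    ((m.factorial : ℂ)⁻¹) • (∑ j, MvPolynomial.C (w j) * MvPolynomial.X j) ^ m =
      ∑ l ∈ Finset.finsuppAntidiag Finset.univ m,
        (∏ j, w j ^ l j / (l j).factorial) •
          ∏ j, (MvPolynomial.X j : MvPolynomial σ ℂ) ^ l j := by
  have h := congrArg (PowerSeries.coeff m) (homSeries_exp w)
  rw [coeff_homSeries, PowerSeries.coeff_rescale, PowerSeries.coeff_exp] at h
  have h1 : algebraMap ℚ (MvPolynomial σ ℂ) (1 / m.factorial) =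
      MvPolynomial.C ((m.factorial : ℂ)⁻¹) := by
    rw [IsScalarTower.algebraMap_apply ℚ ℂ (MvPolynomial σ ℂ)]
    simp
  rw [MvPolynomial.smul_eq_C_mul, ← h1, mul_comm, ← h]
  refine Finset.sum_congr rfl fun l _ => ?_
  congr 1
  refine Finset.prod_congr rfl fun j _ => ?_
  rw [PowerSeries.coeff_rescale, PowerSeries.coeff_exp]
  simp [div_eq_mul_inv]

/-- The weight `(1 + ‖x‖) ^ (-d - 1)` on `ℝ ^ d`. -/
def weight (x : σ → ℝ) : ℝ := ((1 + ‖x‖) ^ (Fintype.card σ + 1))⁻¹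

theorem weight_nonneg (x : σ → ℝ) : 0 ≤ weight x := by
  unfold weight; positivity

theorem integrable_weight : Integrable (weight : (σ → ℝ) → ℝ) := by
  have := integrable_one_add_norm (E := σ → ℝ) (μ := volume) (r := (Fintype.card σ : ℝ) + 1)
    (by simp)
  refine this.congr (Eventually.of_forall fun x => ?_)
  simp only [weight]
  rw [Real.rpow_neg (by positivity), ← Real.rpow_natCast]
  push_cast
  rfl

theorem weight_le {x q : σ → ℝ} (h : ‖x - q‖ ≤ 1) :
    weight q ≤ 2 ^ (Fintype.card σ + 1) * weight x := by
  unfold weight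
  rw [← div_eq_mul_inv, inv_eq_one_div, div_le_div_iff₀ (by positivity) (by positivity), one_mul,
    ← mul_pow]
  gcongr
  have : ‖x‖ ≤ ‖x - q‖ + ‖q‖ := by simpa using norm_add_le (x - q) q
  nlinarith [norm_nonneg q]

/-- The functions `P(∂) h`, for `h` a rapidly decreasing function on `ℝ ^ σ` and `P` a polynomial:
the polynomial variables act as the partial derivatives, and all functions decay. -/
structure JetFamily (σ : Type*) [Fintype σ] where
  /-- The function `P(∂) h`. -/
  toFun : MvPolynomial σ ℂ →ₗ[ℂ] (σ → ℝ) → ℂ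
  continuous : ∀ P, Continuous (toFun P)
  bound : ∀ P, ∃ C, ∀ x, ‖toFun P x‖ ≤ C * weight x
  hasDerivAt : ∀ P x w (θ : ℝ), HasDerivAt (fun θ : ℝ => toFun P (x + θ • w))
    (toFun ((∑ j, MvPolynomial.C (w j : ℂ) * MvPolynomial.X j) * P) (x + θ • w)) θ

namespace JetFamily

variable (H : JetFamily σ)

theorem exists_bound (P : MvPolynomial σ ℂ) : ∃ C, 0 ≤ C ∧ ∀ x, ‖H.toFun P x‖ ≤ C * weight x := by
  obtain ⟨C, hC⟩ := H.bound P
  exact ⟨|C|, abs_nonneg _, fun x =>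
    (hC x).trans (mul_le_mul_of_nonneg_right (le_abs_self C) (weight_nonneg x))⟩

theorem integrable (P : MvPolynomial σ ℂ) : Integrable (H.toFun P) := by
  obtain ⟨C, hC⟩ := H.bound P
  exact (integrable_weight.const_mul C).mono' (H.continuous P).aestronglyMeasurable
    (Eventually.of_forall hC)

/-- Taylor's formula for a jet family, with a remainder controlled at the far end. -/
theorem exists_taylor_bound [DecidableEq σ] (P : MvPolynomial σ ℂ) (N : ℕ) :
    ∃ C, 0 ≤ C ∧ ∀ (τ : ℝ) (x p : σ → ℝ), 0 ≤ τ → τ ≤ 1 → (∀ j, |x j - p j| ≤ τ) →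
      ‖H.toFun P x - ∑ m ∈ Finset.range N, ∑ l ∈ Finset.finsuppAntidiag Finset.univ m,
        (∏ j, (((x j - p j) ^ l j / (l j).factorial : ℝ) : ℂ)) *
          H.toFun ((∏ j, MvPolynomial.X j ^ l j) * P) p‖ ≤ C * τ ^ N * weight x := by
  choose B hB0 hB using H.exists_bound
  refine ⟨N.factorial * ∑ l ∈ Finset.finsuppAntidiag Finset.univ N,
    B ((∏ j, MvPolynomial.X j ^ (l : σ →₀ ℕ) j) * P) * 2 ^ (Fintype.card σ + 1),
    mul_nonneg (by positivity) (Finset.sum_nonneg fun l _ => mul_nonneg (hB0 _) (by positivity)),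
    fun τ x p hτ hτ1 hx => ?_⟩
  let w : σ → ℝ := x - p
  let W : MvPolynomial σ ℂ := ∑ j, MvPolynomial.C (w j : ℂ) * MvPolynomial.X j
  have hmul : ∀ (m : ℕ) (q : σ → ℝ), ((m.factorial : ℂ)⁻¹) * H.toFun (W ^ m * P) q =
      ∑ l ∈ Finset.finsuppAntidiag Finset.univ m,
        (∏ j, (((x j - p j) ^ l j / (l j).factorial : ℝ) : ℂ)) *
          H.toFun ((∏ j, MvPolynomial.X j ^ l j) * P) q := by
    intro m q
    have h1 := linearForm_pow (fun j => (w j : ℂ)) m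
    have h2 := congrArg (fun Q => H.toFun (Q * P) q) h1
    simp only [smul_mul_assoc, Finset.sum_mul, map_smul, map_sum, Pi.smul_apply, smul_eq_mul,
      Finset.sum_apply] at h2
    refine h2.trans (Finset.sum_congr rfl fun l _ => ?_)
    simp [w]
  have hw : ‖w‖ ≤ 1 := (pi_norm_le_iff_of_nonneg zero_le_one).2 fun j => (hx j).trans hτ1
  have hrem : ∀ θ ∈ Set.Icc (0 : ℝ) 1, ‖H.toFun (W ^ N * P) (p + θ • w)‖ ≤
      (N.factorial * ∑ l ∈ Finset.finsuppAntidiag Finset.univ N,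
        B ((∏ j, MvPolynomial.X j ^ (l : σ →₀ ℕ) j) * P) * 2 ^ (Fintype.card σ + 1)) *
        τ ^ N * weight x := by
    intro θ hθ
    have hq : ‖x - (p + θ • w)‖ ≤ 1 := by
      have : x - (p + θ • w) = (1 - θ) • w := by simp only [w]; module
      rw [this, norm_smul, Real.norm_of_nonneg (by linarith [hθ.2])]
      exact mul_le_one₀ (by linarith [hθ.1]) (norm_nonneg _) hw
    have h3 : H.toFun (W ^ N * P) (p + θ • w) = N.factorial * (((N.factorial : ℂ)⁻¹) *
        H.toFun (W ^ N * P) (p + θ • w)) := by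
      rw [mul_inv_cancel_left₀]
      exact_mod_cast N.factorial_ne_zero
    rw [h3, hmul, norm_mul, Complex.norm_natCast, mul_assoc, mul_assoc]
    gcongr
    rw [Finset.sum_mul]
    refine (norm_sum_le _ _).trans (Finset.sum_le_sum fun l hl => ?_)
    rw [norm_mul]
    have h4 : ‖∏ j, (((x j - p j) ^ l j / (l j).factorial : ℝ) : ℂ)‖ ≤ τ ^ N := by
      rw [norm_prod, ← (Finset.mem_finsuppAntidiag.1 hl).1, ← Finset.prod_pow_eq_pow_sum]
      refine Finset.prod_le_prod (fun _ _ => norm_nonneg _) fun j _ => ?_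
      rw [Complex.norm_real, norm_div, norm_pow, Real.norm_eq_abs,
        Real.norm_of_nonneg (by positivity)]
      refine (div_le_self (by positivity) ?_).trans (pow_le_pow_left₀ (abs_nonneg _) (hx j) _)
      exact_mod_cast (l j).factorial_pos
    calc _ ≤ τ ^ N * (B ((∏ j, MvPolynomial.X j ^ l j) * P) *
          (2 ^ (Fintype.card σ + 1) * weight x)) := by
          refine mul_le_mul h4 ((hB _ _).trans ?_) (norm_nonneg _) (by positivity)
          exact mul_le_mul_of_nonneg_left (weight_le hq) (hB0 _)
      _ = _ := by ring
  have := norm_sub_taylor_le N (G := fun m θ => H.toFun (W ^ m * P) (p + θ • w))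
    (fun m θ => by
      have := H.hasDerivAt (W ^ m * P) p w θ
      rwa [← mul_assoc, ← pow_succ'] at this) (by
        refine mul_nonneg (mul_nonneg (mul_nonneg (by positivity) (Finset.sum_nonneg fun l _ =>
          mul_nonneg (hB0 _) (by positivity))) (by positivity)) (weight_nonneg x)) hrem 1 (by simp)
  have hx1 : p + (1 : ℝ) • w = x := by simp [w]
  simp only [hx1, pow_zero, one_mul, zero_smul, add_zero, one_pow] at this
  refine le_of_eq_of_le ?_ this
  congr 2
  refine Finset.sum_congr rfl fun m _ => ?_
  rw [← hmul]
  simp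

end JetFamily

end

/-! ### Riemann sums over an orthant -/

section

variable {σ : Type*}

/-- The open orthant of `ℝ ^ σ`. -/
def orthant (σ : Type*) : Set (σ → ℝ) := Set.univ.pi fun _ => Set.Ioi 0

/-- The cell of the tiling of the orthant by cubes with edges of length `τ`. -/
def box (τ : ℝ) (k : σ → ℕ) : Set (σ → ℝ) :=
  Set.univ.pi fun j => Set.Ioc (τ * k j) (τ * k j + τ)

variable [Fintype σ] in
theorem measurableSet_box (τ : ℝ) (k : σ → ℕ) : MeasurableSet (box τ k) :=
  MeasurableSet.univ_pi fun _ => measurableSet_Ioc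

theorem mem_Ioc_mul_iff {τ x : ℝ} (hτ : 0 < τ) (n : ℕ) :
    x ∈ Set.Ioc (τ * n) (τ * n + τ) ↔ ⌈x / τ⌉ = n + 1 := by
  rw [Int.ceil_eq_iff, Set.mem_Ioc, lt_div_iff₀ hτ, div_le_iff₀ hτ]
  push_cast
  constructor <;> rintro ⟨h1, h2⟩ <;> constructor <;> nlinarith

theorem iUnion_box {τ : ℝ} (hτ : 0 < τ) : ⋃ k : σ → ℕ, box τ k = orthant σ := by
  ext x
  simp only [Set.mem_iUnion, box, orthant, Set.mem_univ_pi, mem_Ioc_mul_iff hτ, Set.mem_Ioi]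
  constructor
  · rintro ⟨k, hk⟩ j
    have : 0 < ⌈x j / τ⌉ := by rw [hk j]; positivity
    rw [Int.ceil_pos] at this
    simpa [hτ] using this
  · intro h
    refine ⟨fun j => (⌈x j / τ⌉ - 1).toNat, fun j => ?_⟩
    have : 0 < ⌈x j / τ⌉ := Int.ceil_pos.2 (div_pos (h j) hτ)
    dsimp only
    omega

theorem pairwise_disjoint_box {τ : ℝ} (hτ : 0 < τ) :
    Pairwise (Function.onFun Disjoint (box τ : (σ → ℕ) → Set (σ → ℝ))) := by
  intro k k' hne
  refine Set.disjoint_left.2 fun x hx hx' => hne (funext fun j => ?_)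
  simp only [box, Set.mem_univ_pi, mem_Ioc_mul_iff hτ] at hx hx'
  have := (hx j).symm.trans (hx' j)
  omega

/-- The point with relative position `κ` in the cell with index `k`. -/
def boxPoint (τ : ℝ) (κ : σ → ℝ) (k : σ → ℕ) : σ → ℝ := fun j => τ * (κ j + k j)

theorem abs_sub_boxPoint_le {τ : ℝ} {κ : σ → ℝ} (hκ : ∀ j, κ j ∈ Set.Icc (0 : ℝ) 1) (hτ : 0 < τ)
    {k : σ → ℕ} {x : σ → ℝ} (hx : x ∈ box τ k) (j : σ) : |x j - boxPoint τ κ k j| ≤ τ := by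
  have h1 := Set.mem_univ_pi.1 hx j
  obtain ⟨h2, h3⟩ := hκ j
  unfold boxPoint
  rw [abs_le]
  constructor <;> nlinarith [h1.1, h1.2, mul_nonneg hτ.le h2, mul_le_mul_of_nonneg_left h3 hτ.le]

variable [Fintype σ]

theorem integrableOn_box {τ : ℝ} {k : σ → ℕ} {f : (σ → ℝ) → ℂ} (hf : Continuous f) :
    IntegrableOn f (box τ k) := by
  refine (hf.continuousOn.integrableOn_compact
    (isCompact_univ_pi fun j => isCompact_Icc (a := τ * k j) (b := τ * k j + τ))).mono_set ?_
  exact Set.pi_mono fun j _ => Set.Ioc_subset_Icc_self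

theorem integral_Ioc_moment {τ : ℝ} (hτ : 0 < τ) (a κ : ℝ) (l : ℕ) :
    ∫ x in Set.Ioc a (a + τ), (((x - (a + τ * κ)) ^ l / l.factorial : ℝ) : ℂ) =
      (τ : ℂ) ^ (l + 1) * PowerSeries.coeff l (momentSeries κ) := by
  rw [← intervalIntegral.integral_of_le (by linarith), intervalIntegral.integral_ofReal,
    intervalIntegral.integral_div, intervalIntegral.integral_comp_sub_right (fun x => x ^ l),
    integral_pow, momentSeries, PowerSeries.coeff_mk, Nat.factorial_succ]
  have h1 : a + τ - (a + τ * κ) = τ * (1 - κ) := by ring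
  have h2 : a - (a + τ * κ) = τ * -κ := by ring
  rw [h1, h2, mul_pow, mul_pow]
  push_cast
  field_simp

theorem integral_box_moment {τ : ℝ} (hτ : 0 < τ) (κ : σ → ℝ) (k l : σ → ℕ) :
    ∫ x in box τ k, ∏ j, (((x j - boxPoint τ κ k j) ^ l j / (l j).factorial : ℝ) : ℂ) =
      (τ : ℂ) ^ (Fintype.card σ) * (τ : ℂ) ^ (∑ j, l j) *
        ∏ j, PowerSeries.coeff (l j) (momentSeries (κ j)) := by
  rw [box, volume_pi, Measure.restrict_pi_pi, integral_fintype_prod_eq_prod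
    (f := fun j x => (((x - boxPoint τ κ k j) ^ l j / (l j).factorial : ℝ) : ℂ))]
  have : ∀ j, ∫ x in Set.Ioc (τ * k j) (τ * k j + τ),
      (((x - boxPoint τ κ k j) ^ l j / (l j).factorial : ℝ) : ℂ) =
      τ * τ ^ l j * PowerSeries.coeff (l j) (momentSeries (κ j)) := by
    intro j
    rw [← pow_succ', ← integral_Ioc_moment hτ (τ * k j)]
    congr! 5
    simp only [boxPoint]
    ring
  simp only [this, Finset.prod_mul_distrib, Finset.prod_const, Finset.prod_pow_eq_pow_sum,
    Finset.card_univ]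

theorem volume_real_box {τ : ℝ} (hτ : 0 < τ) (k : σ → ℕ) :
    volume.real (box τ k) = τ ^ (Fintype.card σ) := by
  rw [Measure.real, box, volume_pi_pi]
  simp [hτ.le, Finset.card_univ]

namespace JetFamily

variable (H : JetFamily σ)

/-- The integral of `P(∂) h` over the orthant. -/
def orthantIntegral : MvPolynomial σ ℂ →ₗ[ℂ] ℂ where
  toFun P := ∫ x in orthant σ, H.toFun P x
  map_add' P Q := by
    simp only [map_add, Pi.add_apply]
    exact integral_add (H.integrable P).integrableOn (H.integrable Q).integrableOn
  map_smul' a P := by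
    simp only [map_smul, Pi.smul_apply, RingHom.id_apply]
    exact integral_smul a _

/-- The Riemann sum of `P(∂) h` over the orthant, with mesh `τ` and sampling points in relative
position `κ` in the cells. -/
def orthantSum (τ : ℝ) (κ : σ → ℝ) (P : MvPolynomial σ ℂ) : ℂ :=
  (τ : ℂ) ^ (Fintype.card σ) * ∑' k, H.toFun P (boxPoint τ κ k)

variable {τ : ℝ} {κ : σ → ℝ}

theorem hasSum_integral_box {E : Type*} [NormedAddCommGroup E] [NormedSpace ℝ E] (hτ : 0 < τ)
    {f : (σ → ℝ) → E} (hf : Integrable f) :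
    HasSum (fun k => ∫ x in box τ k, f x) (∫ x in orthant σ, f x) := by
  rw [← iUnion_box hτ]
  exact hasSum_integral_iUnion (measurableSet_box τ) (pairwise_disjoint_box hτ) hf.integrableOn

theorem norm_mul_apply_boxPoint_le (hκ : ∀ j, κ j ∈ Set.Icc (0 : ℝ) 1) (hτ : 0 < τ) (hτ1 : τ ≤ 1)
    {P : MvPolynomial σ ℂ} {C : ℝ} (hC0 : 0 ≤ C) (hC : ∀ x, ‖H.toFun P x‖ ≤ C * weight x)
    (k : σ → ℕ) :
    ‖(τ : ℂ) ^ (Fintype.card σ) * H.toFun P (boxPoint τ κ k)‖ ≤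
      C * 2 ^ (Fintype.card σ + 1) * ∫ x in box τ k, weight x := by
  have h1 : ∀ x ∈ box τ k, ‖H.toFun P (boxPoint τ κ k)‖ ≤
      C * 2 ^ (Fintype.card σ + 1) * weight x := by
    intro x hx
    refine (hC _).trans ?_
    rw [mul_assoc]
    refine mul_le_mul_of_nonneg_left (weight_le ?_) hC0
    exact (pi_norm_le_iff_of_nonneg zero_le_one).2 fun j =>
      (abs_sub_boxPoint_le hκ hτ hx j).trans hτ1
  have hvol : volume (box τ k) ≠ ⊤ := by
    intro h
    have := volume_real_box hτ k
    rw [Measure.real, h, ENNReal.toReal_top] at this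
    exact absurd this (by positivity)
  rw [norm_mul, norm_pow, Complex.norm_real, Real.norm_of_nonneg hτ.le, ← volume_real_box hτ k,
    ← integral_const_mul, ← smul_eq_mul, ← setIntegral_const]
  exact setIntegral_mono_on (integrableOn_const hvol) (integrable_weight.const_mul _).integrableOn
    (measurableSet_box τ k) h1

theorem summable_apply_boxPoint (hκ : ∀ j, κ j ∈ Set.Icc (0 : ℝ) 1) (hτ : 0 < τ) (hτ1 : τ ≤ 1)
    (P : MvPolynomial σ ℂ) : Summable fun k => H.toFun P (boxPoint τ κ k) := by
  obtain ⟨C, hC0, hC⟩ := H.exists_bound P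
  have h : Summable fun k => (τ : ℂ) ^ (Fintype.card σ) * H.toFun P (boxPoint τ κ k) :=
    Summable.of_norm_bounded ((hasSum_integral_box hτ integrable_weight).summable.mul_left _)
      (H.norm_mul_apply_boxPoint_le hκ hτ hτ1 hC0 hC)
  exact (summable_mul_left_iff (pow_ne_zero _ (by exact_mod_cast hτ.ne'))).1 h

/-- Riemann sums of a given function are bounded, uniformly in the mesh and the sampling points. -/
theorem exists_orthantSum_bound (P : MvPolynomial σ ℂ) :
    ∃ C, 0 ≤ C ∧ ∀ (τ : ℝ) (κ : σ → ℝ), 0 < τ → τ ≤ 1 → (∀ j, κ j ∈ Set.Icc (0 : ℝ) 1) →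
      ‖H.orthantSum τ κ P‖ ≤ C := by
  obtain ⟨C, hC0, hC⟩ := H.exists_bound P
  refine ⟨C * 2 ^ (Fintype.card σ + 1) * ∫ x in orthant σ, weight x,
    mul_nonneg (by positivity) (integral_nonneg weight_nonneg), fun τ κ hτ hτ1 hκ => ?_⟩
  rw [orthantSum, ← tsum_mul_left]
  exact tsum_of_norm_bounded ((hasSum_integral_box hτ integrable_weight).mul_left _)
    (H.norm_mul_apply_boxPoint_le hκ hτ hτ1 hC0 hC)

theorem orthantSum_sum {α : Type*} (s : Finset α) (a : α → ℂ) (P : α → MvPolynomial σ ℂ)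
    (hκ : ∀ j, κ j ∈ Set.Icc (0 : ℝ) 1) (hτ : 0 < τ) (hτ1 : τ ≤ 1) :
    H.orthantSum τ κ (∑ i ∈ s, a i • P i) = ∑ i ∈ s, a i * H.orthantSum τ κ (P i) := by
  simp only [orthantSum, map_sum, map_smul, Finset.sum_apply, Pi.smul_apply, smul_eq_mul]
  rw [Summable.tsum_finsetSum fun i _ => (H.summable_apply_boxPoint hκ hτ hτ1 (P i)).mul_left (a i),
    Finset.mul_sum]
  refine Finset.sum_congr rfl fun i _ => ?_
  rw [tsum_mul_left]
  ring

/-- The integral over the orthant in terms of Riemann sums of derivatives, whose coefficients are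
the moments of a cell about its sampling point. -/
theorem exists_integral_sub_orthantSum_bound [DecidableEq σ] (P : MvPolynomial σ ℂ) (N : ℕ) :
    ∃ C, 0 ≤ C ∧ ∀ (τ : ℝ) (κ : σ → ℝ), 0 < τ → τ ≤ 1 → (∀ j, κ j ∈ Set.Icc (0 : ℝ) 1) →
      ‖H.orthantIntegral P - ∑ m ∈ Finset.range N, (τ : ℂ) ^ m * H.orthantSum τ κ
        (PowerSeries.coeff m (homSeries fun j => momentSeries (κ j)) * P)‖ ≤ C * τ ^ N := by
  obtain ⟨C, hC0, hC⟩ := H.exists_taylor_bound P N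
  refine ⟨C * ∫ x in orthant σ, weight x, mul_nonneg hC0 (integral_nonneg weight_nonneg),
    fun τ κ hτ hτ1 hκ => ?_⟩
  have hsum : HasSum (fun k => ∑ m ∈ Finset.range N, (τ : ℂ) ^ m * ((τ : ℂ) ^ (Fintype.card σ) *
      H.toFun (PowerSeries.coeff m (homSeries fun j => momentSeries (κ j)) * P) (boxPoint τ κ k)))
      (∑ m ∈ Finset.range N, (τ : ℂ) ^ m * H.orthantSum τ κ
        (PowerSeries.coeff m (homSeries fun j => momentSeries (κ j)) * P)) :=
    hasSum_sum fun m _ =>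
      ((H.summable_apply_boxPoint hκ hτ hτ1 _).hasSum.mul_left _).mul_left _
  have hbox : ∀ k, ∑ m ∈ Finset.range N, (τ : ℂ) ^ m * ((τ : ℂ) ^ (Fintype.card σ) *
      H.toFun (PowerSeries.coeff m (homSeries fun j => momentSeries (κ j)) * P) (boxPoint τ κ k)) =
      ∫ x in box τ k, ∑ m ∈ Finset.range N, ∑ l ∈ Finset.finsuppAntidiag Finset.univ m,
        (∏ j, (((x j - boxPoint τ κ k j) ^ l j / (l j).factorial : ℝ) : ℂ)) *
          H.toFun ((∏ j, MvPolynomial.X j ^ l j) * P) (boxPoint τ κ k) := by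
    intro k
    have hint : ∀ l : σ →₀ ℕ, IntegrableOn (fun x =>
        (∏ j, (((x j - boxPoint τ κ k j) ^ l j / (l j).factorial : ℝ) : ℂ)) *
          H.toFun ((∏ j, MvPolynomial.X j ^ l j) * P) (boxPoint τ κ k)) (box τ k) := fun l =>
      integrableOn_box (by fun_prop)
    rw [integral_finsetSum _ fun m _ => integrable_finsetSum _ fun l _ => hint l]
    refine Finset.sum_congr rfl fun m _ => ?_
    rw [integral_finsetSum _ fun l _ => hint l, coeff_homSeries, Finset.sum_mul, map_sum,
      Finset.sum_apply, Finset.mul_sum, Finset.mul_sum]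
    refine Finset.sum_congr rfl fun l hl => ?_
    rw [integral_mul_const, integral_box_moment hτ, smul_mul_assoc, map_smul, Pi.smul_apply,
      smul_eq_mul, (Finset.mem_finsuppAntidiag.1 hl).1]
    ring
  have hdiff := (hasSum_integral_box hτ (H.integrable P)).sub hsum
  rw [orthantIntegral, LinearMap.coe_mk, AddHom.coe_mk, ← hdiff.tsum_eq]
  refine (tsum_of_norm_bounded ((hasSum_integral_box hτ integrable_weight).mul_left (C * τ ^ N))
    fun k => ?_).trans (le_of_eq (by ring))
  rw [hbox, ← integral_sub (H.integrable P).integrableOn (integrableOn_box (by fun_prop)),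
    ← integral_const_mul]
  refine norm_integral_le_of_norm_le (integrable_weight.const_mul _).integrableOn ?_
  filter_upwards [ae_restrict_mem (measurableSet_box τ k)] with x hx
  exact hC τ x _ hτ.le hτ1 (abs_sub_boxPoint_le hκ hτ hx)

end JetFamily

end

/-! ### The Euler–Maclaurin expansion -/

section

theorem exists_norm_le_of_continuous {f : ℝ → ℂ} (hf : Continuous f) :
    ∃ b, 0 ≤ b ∧ ∀ x ∈ Set.Icc (0 : ℝ) 1, ‖f x‖ ≤ b := by
  obtain ⟨b, hb⟩ := isCompact_Icc.exists_bound_of_continuousOn (s := Set.Icc (0 : ℝ) 1)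
    hf.continuousOn
  exact ⟨b, (norm_nonneg _).trans (hb 0 (by simp)), hb⟩

theorem continuous_coeff_bernoulliSeries (n : ℕ) :
    Continuous fun x : ℝ => PowerSeries.coeff n (bernoulliSeries x) := by
  obtain ⟨q, hq⟩ := exists_coeff_bernoulliSeries n
  simp only [hq]
  fun_prop

theorem continuous_coeff_momentSeries (n : ℕ) :
    Continuous fun x : ℝ => PowerSeries.coeff n (momentSeries x) := by
  simp only [momentSeries, PowerSeries.coeff_mk]
  fun_prop

variable {σ : Type*} [Fintype σ]

theorem exists_norm_prod_coeff_le {p : ℝ → PowerSeries ℂ}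
    (hp : ∀ n, Continuous fun x => PowerSeries.coeff n (p x)) (l : σ → ℕ) :
    ∃ b, 0 ≤ b ∧ ∀ κ : σ → ℝ, (∀ j, κ j ∈ Set.Icc (0 : ℝ) 1) →
      ‖∏ j, PowerSeries.coeff (l j) (p (κ j))‖ ≤ b := by
  choose b hb0 hb using fun n => exists_norm_le_of_continuous (hp n)
  refine ⟨∏ j, b (l j), Finset.prod_nonneg fun j _ => hb0 _, fun κ hκ => ?_⟩
  rw [norm_prod]
  exact Finset.prod_le_prod (fun _ _ => norm_nonneg _) fun j _ => hb _ _ (hκ j)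

namespace JetFamily

variable (H : JetFamily σ)

theorem exists_integral_bernoulli_sub_bound [DecidableEq σ] (b N : ℕ) :
    ∃ C, 0 ≤ C ∧ ∀ (τ : ℝ) (κ : σ → ℝ), 0 < τ → τ ≤ 1 → (∀ j, κ j ∈ Set.Icc (0 : ℝ) 1) →
      ‖H.orthantIntegral (PowerSeries.coeff b (homSeries fun j => bernoulliSeries (κ j))) -
        ∑ m ∈ Finset.range N, (τ : ℂ) ^ m * H.orthantSum τ κ
          (PowerSeries.coeff m (homSeries fun j => momentSeries (κ j)) *
            PowerSeries.coeff b (homSeries fun j => bernoulliSeries (κ j)))‖ ≤ C * τ ^ N := by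
  choose C hC0 hC using fun l : σ →₀ ℕ =>
    H.exists_integral_sub_orthantSum_bound (∏ j, MvPolynomial.X j ^ l j) N
  choose B hB0 hB using fun l : σ →₀ ℕ =>
    exists_norm_prod_coeff_le continuous_coeff_bernoulliSeries l
  refine ⟨∑ l ∈ Finset.finsuppAntidiag Finset.univ b, B l * C l,
    Finset.sum_nonneg fun l _ => mul_nonneg (hB0 l) (hC0 l), fun τ κ hτ hτ1 hκ => ?_⟩
  simp only [coeff_homSeries (fun j => bernoulliSeries (κ j)), map_sum, map_smul, smul_eq_mul,
    Finset.mul_sum, mul_smul_comm, H.orthantSum_sum _ _ _ hκ hτ hτ1]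
  rw [Finset.sum_comm, ← Finset.sum_sub_distrib, Finset.sum_mul]
  refine (norm_sum_le _ _).trans (Finset.sum_le_sum fun l _ => ?_)
  simp only [mul_left_comm _ (∏ j, PowerSeries.coeff (l j) (bernoulliSeries (κ j)))]
  rw [← Finset.mul_sum, ← mul_sub, norm_mul, mul_assoc]
  exact mul_le_mul (hB l κ hκ) (hC l τ κ hτ hτ1 hκ) (norm_nonneg _) (hB0 l)

theorem exists_orthantSum_moment_mul_bernoulli_bound [DecidableEq σ] (a b : ℕ) :
    ∃ C, 0 ≤ C ∧ ∀ (τ : ℝ) (κ : σ → ℝ), 0 < τ → τ ≤ 1 → (∀ j, κ j ∈ Set.Icc (0 : ℝ) 1) →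
      ‖H.orthantSum τ κ (PowerSeries.coeff a (homSeries fun j => momentSeries (κ j)) *
        PowerSeries.coeff b (homSeries fun j => bernoulliSeries (κ j)))‖ ≤ C := by
  choose C hC0 hC using fun P => H.exists_orthantSum_bound P
  choose B hB0 hB using fun l : σ →₀ ℕ =>
    exists_norm_prod_coeff_le continuous_coeff_bernoulliSeries l
  choose A hA0 hA using fun l : σ →₀ ℕ =>
    exists_norm_prod_coeff_le continuous_coeff_momentSeries l
  refine ⟨∑ l ∈ Finset.finsuppAntidiag Finset.univ a, ∑ l' ∈ Finset.finsuppAntidiag Finset.univ b,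
    A l * (B l' * C ((∏ j, MvPolynomial.X j ^ l j) * ∏ j, MvPolynomial.X j ^ l' j)),
    Finset.sum_nonneg fun l _ => Finset.sum_nonneg fun l' _ =>
      mul_nonneg (hA0 l) (mul_nonneg (hB0 l') (hC0 _)), fun τ κ hτ hτ1 hκ => ?_⟩
  simp only [coeff_homSeries, Finset.sum_mul, smul_mul_assoc, H.orthantSum_sum _ _ _ hκ hτ hτ1]
  refine (norm_sum_le _ _).trans (Finset.sum_le_sum fun l _ => ?_)
  simp only [Finset.mul_sum, mul_smul_comm, H.orthantSum_sum _ _ _ hκ hτ hτ1]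
  refine (norm_sum_le _ _).trans (Finset.sum_le_sum fun l' _ => ?_)
  rw [norm_mul, norm_mul]
  exact mul_le_mul (hA l κ hκ) (mul_le_mul (hB l' κ hκ) (hC _ τ κ hτ hτ1 hκ) (norm_nonneg _)
    (hB0 l')) (by positivity) (hA0 l)

theorem orthantSum_ite (n : ℕ) (τ : ℝ) (κ : σ → ℝ) :
    H.orthantSum τ κ (if n = 0 then 1 else 0) = if n = 0 then H.orthantSum τ κ 1 else 0 := by
  split_ifs <;> simp [orthantSum]

/-- The Euler–Maclaurin expansion of Riemann sums over an orthant, uniformly in the sampling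
points.  Its coefficients are the integrals of the homogeneous components of the product of the
Bernoulli series, because this product is the inverse of the product of the moment series. -/
theorem exists_orthantSum_sub_bound (N : ℕ) :
    ∃ C, ∀ (τ : ℝ) (κ : σ → ℝ), 0 < τ → τ ≤ 1 → (∀ j, κ j ∈ Set.Icc (0 : ℝ) 1) →
      ‖H.orthantSum τ κ 1 - ∑ m ∈ Finset.range (N + 1), (τ : ℂ) ^ m *
        H.orthantIntegral (PowerSeries.coeff m (homSeries fun j => bernoulliSeries (κ j)))‖ ≤
        C * τ ^ (N + 1) := by
  classical
  choose C hC0 hC using fun b => H.exists_integral_bernoulli_sub_bound b (N + 1)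
  choose B hB0 hB using fun a b => H.exists_orthantSum_moment_mul_bernoulli_bound a b
  let S := Finset.range (N + 1) ×ˢ Finset.range (N + 1)
  refine ⟨∑ b ∈ Finset.range (N + 1), C b + ∑ p ∈ S with ¬ p.2 + p.1 < N + 1, B p.2 p.1,
    fun τ κ hτ hτ1 hκ => ?_⟩
  have hnτ : ‖(τ : ℂ)‖ = τ := by rw [Complex.norm_real, Real.norm_of_nonneg hτ.le]
  let E : ℕ → ℕ → ℂ := fun a b => H.orthantSum τ κ
    (PowerSeries.coeff a (homSeries fun j => momentSeries (κ j)) *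
      PowerSeries.coeff b (homSeries fun j => bernoulliSeries (κ j)))
  let I : ℕ → ℂ := fun b =>
    H.orthantIntegral (PowerSeries.coeff b (homSeries fun j => bernoulliSeries (κ j)))
  -- expand each integral `I b` by Riemann sums of derivatives
  have h1 : ‖∑ b ∈ Finset.range (N + 1), (τ : ℂ) ^ b * I b -
      ∑ p ∈ S, (τ : ℂ) ^ (p.2 + p.1) * E p.2 p.1‖ ≤
      (∑ b ∈ Finset.range (N + 1), C b) * τ ^ (N + 1) := by
    rw [Finset.sum_product, ← Finset.sum_sub_distrib, Finset.sum_mul]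
    refine (norm_sum_le _ _).trans (Finset.sum_le_sum fun b _ => ?_)
    have : ∑ a ∈ Finset.range (N + 1), (τ : ℂ) ^ (a + b) * E a b =
        τ ^ b * ∑ a ∈ Finset.range (N + 1), (τ : ℂ) ^ a * E a b := by
      rw [Finset.mul_sum]
      exact Finset.sum_congr rfl fun a _ => by ring
    rw [this, ← mul_sub, norm_mul, norm_pow, hnτ]
    exact (mul_le_of_le_one_left (norm_nonneg _) (pow_le_one₀ hτ.le hτ1)).trans
      (hC b τ κ hτ hτ1 hκ)
  -- the terms of total order at most `N` collapse to that of order `0`, the others are remainders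
  have h2 : ∑ p ∈ S with p.2 + p.1 < N + 1, (τ : ℂ) ^ (p.2 + p.1) * E p.2 p.1 =
      H.orthantSum τ κ 1 := by
    have hmaps : ∀ p ∈ S.filter fun p => p.2 + p.1 < N + 1, p.2 + p.1 ∈ Finset.range (N + 1) :=
      fun p hp => Finset.mem_range.2 (Finset.mem_filter.1 hp).2
    rw [← Finset.sum_fiberwise_of_maps_to hmaps]
    have h3 : ∀ n ∈ Finset.range (N + 1), ∑ p ∈ {p ∈ S | p.2 + p.1 < N + 1} with p.2 + p.1 = n,
        (τ : ℂ) ^ (p.2 + p.1) * E p.2 p.1 = if n = 0 then H.orthantSum τ κ 1 else 0 := by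
      intro n hn
      have hn' := Finset.mem_range.1 hn
      have hset : {p ∈ {p ∈ S | p.2 + p.1 < N + 1} | p.2 + p.1 = n} =
          Finset.HasAntidiagonal.antidiagonal n := by
        ext p
        simp only [S, Finset.mem_filter, Finset.mem_product, Finset.mem_range,
          Finset.HasAntidiagonal.mem_antidiagonal]
        omega
      have hE : ∑ p ∈ Finset.HasAntidiagonal.antidiagonal n, E p.1 p.2 =
          if n = 0 then H.orthantSum τ κ 1 else 0 := by
        rw [← H.orthantSum_ite, ← sum_antidiagonal_homSeries fun j => (κ j : ℂ)]
        have := H.orthantSum_sum (Finset.HasAntidiagonal.antidiagonal n) (fun _ => 1) (fun p =>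
          PowerSeries.coeff p.1 (homSeries fun j => momentSeries (κ j)) *
            PowerSeries.coeff p.2 (homSeries fun j => bernoulliSeries (κ j))) hκ hτ hτ1
        simpa only [one_smul, one_mul] using this.symm
      rw [hset, ← Finset.Nat.sum_antidiagonal_swap]
      simp only [Prod.fst_swap, Prod.snd_swap]
      rw [Finset.sum_congr rfl fun p hp => by
        rw [Finset.HasAntidiagonal.mem_antidiagonal.1 hp], ← Finset.mul_sum, hE]
      split_ifs with h0
      · rw [h0, pow_zero, one_mul]
      · rw [mul_zero]
    rw [Finset.sum_congr rfl h3]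
    simp
  have h4 : ‖∑ p ∈ S with ¬ p.2 + p.1 < N + 1, (τ : ℂ) ^ (p.2 + p.1) * E p.2 p.1‖ ≤
      (∑ p ∈ S with ¬ p.2 + p.1 < N + 1, B p.2 p.1) * τ ^ (N + 1) := by
    rw [Finset.sum_mul]
    refine (norm_sum_le _ _).trans (Finset.sum_le_sum fun p hp => ?_)
    rw [norm_mul, norm_pow, hnτ, mul_comm]
    exact mul_le_mul (hB _ _ τ κ hτ hτ1 hκ)
      (pow_le_pow_of_le_one hτ.le hτ1 (not_lt.1 (Finset.mem_filter.1 hp).2)) (by positivity)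
      (hB0 _ _)
  rw [← Finset.sum_filter_add_sum_filter_not S (fun p => p.2 + p.1 < N + 1), h2] at h1
  rw [norm_sub_rev, add_mul]
  calc _ = ‖(∑ b ∈ Finset.range (N + 1), (τ : ℂ) ^ b * I b - (H.orthantSum τ κ 1 +
        ∑ p ∈ S with ¬ p.2 + p.1 < N + 1, (τ : ℂ) ^ (p.2 + p.1) * E p.2 p.1)) +
        ∑ p ∈ S with ¬ p.2 + p.1 < N + 1, (τ : ℂ) ^ (p.2 + p.1) * E p.2 p.1‖ := by
        congr 1
        ring
    _ ≤ _ := (norm_add_le _ _).trans (add_le_add h1 h4)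

end JetFamily

end

/-! ### Decomposition of rational cones into open simplicial cones -/

section

variable {V : Type*} [NormedAddCommGroup V] [NormedSpace ℝ V] {ι : Type*}

/-- The relatively open simplicial cone spanned by the vectors `b j`, `j ∈ J`, of a basis. -/
def openCone (b : Module.Basis ι ℝ V) (J : Finset ι) : Set V :=
  {x | (∀ j ∈ J, 0 < b.repr x j) ∧ ∀ j ∉ J, b.repr x j = 0}

/-- The disjoint finite unions of relatively open simplicial cones spanned by lattice vectors. -/
inductive IsSimplicialUnion (Λ : Submodule ℤ V) (ι : Type*) : Set V → Prop
  | empty : IsSimplicialUnion Λ ι ∅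
  | openCone (b : Module.Basis ι ℝ V) (J : Finset ι) (hb : ∀ j, b j ∈ Λ) :
      IsSimplicialUnion Λ ι (openCone b J)
  | union {P Q : Set V} (hPQ : Disjoint P Q) (hP : IsSimplicialUnion Λ ι P)
      (hQ : IsSimplicialUnion Λ ι Q) : IsSimplicialUnion Λ ι (P ∪ Q)

theorem IsSimplicialUnion.biUnion {Λ : Submodule ℤ V} {α : Type*} (s : Finset α) {P : α → Set V}
    (hd : Pairwise (Function.onFun Disjoint P)) (h : ∀ a ∈ s, IsSimplicialUnion Λ ι (P a)) :
    IsSimplicialUnion Λ ι (⋃ a ∈ s, P a) := by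
  classical
  induction s using Finset.induction_on with
  | empty => simpa using IsSimplicialUnion.empty
  | insert a s ha ih =>
    rw [Finset.set_biUnion_insert]
    refine .union (Set.disjoint_iUnion₂_right.2 fun b hb => hd ?_) (h a (by simp))
      (ih fun b hb => h b (by simp [hb]))
    rintro rfl
    exact ha hb

/-- The basis obtained by adding the vector with index `j` to the one with index `i`. -/
def addBasis (b : Module.Basis ι ℝ V) {i j : ι} (hij : i ≠ j) : Module.Basis ι ℝ V :=
  b.map (LinearEquiv.transvection (f := b.coord i) (v := b j)
    (by simp [Finsupp.single_eq_of_ne hij]))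

theorem addBasis_apply_self (b : Module.Basis ι ℝ V) {i j : ι} (hij : i ≠ j) :
    addBasis b hij i = b i + b j := by
  simp [addBasis, LinearMap.transvection.apply]

theorem addBasis_apply_of_ne (b : Module.Basis ι ℝ V) {i j k : ι} (hij : i ≠ j) (hk : k ≠ i) :
    addBasis b hij k = b k := by
  simp [addBasis, LinearMap.transvection.apply, Finsupp.single_eq_of_ne hk.symm]

theorem repr_addBasis (b : Module.Basis ι ℝ V) {i j : ι} (hij : i ≠ j) (x : V) :
    b.repr x = (addBasis b hij).repr x + Finsupp.single j (b.repr x i) := by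
  have h : x = (LinearEquiv.transvection (f := b.coord i) (v := b j)
      (by simp [Finsupp.single_eq_of_ne hij])) (x - b.repr x i • b j) := by
    simp [LinearMap.transvection.apply, Finsupp.single_eq_of_ne hij]
  have h2 : (addBasis b hij).repr x = b.repr (x - b.repr x i • b j) := by
    rw [addBasis, Module.Basis.map_repr, LinearEquiv.trans_apply]
    conv_lhs => rw [h]
    rw [LinearEquiv.symm_apply_apply]
  rw [h2]
  simp

theorem repr_addBasis_self (b : Module.Basis ι ℝ V) {i j : ι} (hij : i ≠ j) (x : V) :
    (addBasis b hij).repr x j = b.repr x j - b.repr x i := by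
  have := DFunLike.congr_fun (repr_addBasis b hij x) j
  simp at this
  linarith

theorem repr_addBasis_of_ne (b : Module.Basis ι ℝ V) {i j k : ι} (hij : i ≠ j) (x : V)
    (hk : k ≠ j) : (addBasis b hij).repr x k = b.repr x k := by
  have := DFunLike.congr_fun (repr_addBasis b hij x) k
  simpa [Finsupp.single_eq_of_ne hk] using this.symm

theorem openCone_unitsSMul (b : Module.Basis ι ℝ V) (J : Finset ι) (w : ι → ℝˣ)
    (hw : ∀ j, 0 < (w j : ℝ)) : openCone (b.unitsSMul w) J = openCone b J := by
  ext x
  simp only [openCone, Set.mem_ofPred_eq, Module.Basis.repr_unitsSMul, Units.smul_def,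
    Units.val_inv_eq_inv_val, smul_eq_mul]
  simp [hw, (hw _).ne', mul_pos_iff_of_pos_left]

theorem eq_sum_repr_of_mem_openCone [Fintype ι] (b : Module.Basis ι ℝ V) {J : Finset ι} {x : V}
    (hx : x ∈ openCone b J) : x = ∑ j ∈ J, b.repr x j • b j := by
  conv_lhs => rw [← b.sum_repr x]
  refine (Finset.sum_subset (Finset.subset_univ J) fun j _ hj => ?_).symm
  rw [hx.2 j hj, zero_smul]

variable [DecidableEq ι]

theorem mem_openCone_addBasis (b : Module.Basis ι ℝ V) {J : Finset ι} {i j : ι} (hij : i ≠ j)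
    (hi : i ∈ J) (hj : j ∈ J) (x : V) :
    x ∈ openCone (addBasis b hij) J ↔ x ∈ openCone b J ∧ b.repr x i < b.repr x j := by
  constructor
  · rintro ⟨h1, h2⟩
    have h3 := h1 j hj
    have h4 := h1 i hi
    rw [repr_addBasis_self] at h3
    rw [repr_addBasis_of_ne _ _ _ hij] at h4
    refine ⟨⟨fun k hk => ?_, fun k hk => ?_⟩, by linarith⟩
    · by_cases hkj : k = j
      · subst hkj; linarith
      · rw [← repr_addBasis_of_ne b hij _ hkj]; exact h1 k hk
    · rw [← repr_addBasis_of_ne b hij _ (by rintro rfl; exact hk hj)]; exact h2 k hk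
  · rintro ⟨⟨h1, h2⟩, h3⟩
    refine ⟨fun k hk => ?_, fun k hk => ?_⟩
    · by_cases hkj : k = j
      · subst hkj; rw [repr_addBasis_self]; linarith
      · rw [repr_addBasis_of_ne b hij _ hkj]; exact h1 k hk
    · rw [repr_addBasis_of_ne b hij _ (by rintro rfl; exact hk hj)]; exact h2 k hk

theorem mem_openCone_addBasis_erase (b : Module.Basis ι ℝ V) {J : Finset ι} {i j : ι}
    (hij : i ≠ j) (hi : i ∈ J) (hj : j ∈ J) (x : V) :
    x ∈ openCone (addBasis b hij) (J.erase j) ↔ x ∈ openCone b J ∧ b.repr x i = b.repr x j := by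
  constructor
  · rintro ⟨h1, h2⟩
    have h3 := h2 j (Finset.notMem_erase _ _)
    have h4 := h1 i (Finset.mem_erase.2 ⟨hij, hi⟩)
    rw [repr_addBasis_self] at h3
    rw [repr_addBasis_of_ne _ _ _ hij] at h4
    refine ⟨⟨fun k hk => ?_, fun k hk => ?_⟩, by linarith⟩
    · by_cases hkj : k = j
      · subst hkj; linarith
      · rw [← repr_addBasis_of_ne b hij _ hkj]; exact h1 k (Finset.mem_erase.2 ⟨hkj, hk⟩)
    · rw [← repr_addBasis_of_ne b hij _ (by rintro rfl; exact hk hj)]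
      exact h2 k fun h => hk (Finset.mem_of_mem_erase h)
  · rintro ⟨⟨h1, h2⟩, h3⟩
    refine ⟨fun k hk => ?_, fun k hk => ?_⟩
    · rw [repr_addBasis_of_ne b hij _ (Finset.ne_of_mem_erase hk)]
      exact h1 k (Finset.mem_of_mem_erase hk)
    · by_cases hkj : k = j
      · subst hkj; rw [repr_addBasis_self]; linarith
      · rw [repr_addBasis_of_ne b hij _ hkj]
        exact h2 k fun h => hk (Finset.mem_erase.2 ⟨hkj, h⟩)

/-- Stellar subdivision of an open simplicial cone in the interior of one of its faces of dimension
two. -/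
theorem openCone_eq_union (b : Module.Basis ι ℝ V) {J : Finset ι} {i j : ι} (hij : i ≠ j)
    (hi : i ∈ J) (hj : j ∈ J) :
    openCone b J = openCone (addBasis b hij) J ∪
      (openCone (addBasis b hij.symm) J ∪ openCone (addBasis b hij) (J.erase j)) := by
  ext x
  simp only [Set.mem_union, mem_openCone_addBasis b hij hi hj,
    mem_openCone_addBasis b hij.symm hj hi, mem_openCone_addBasis_erase b hij hi hj]
  rcases lt_trichotomy (b.repr x i) (b.repr x j) with h | h | h
  · simp [h, h.not_gt, h.ne]
  · simp [h]
  · simp [h, h.not_gt, h.ne']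

/-- The intersection of an open simplicial cone with a rational half-space: the cone is subdivided
until no two of its edges are strictly on different sides of the boundary hyperplane. -/
theorem isSimplicialUnion_openCone_inter [Fintype ι] {Λ : Submodule ℤ V} (f : StrongDual ℝ V)
    (hf : ∀ x ∈ Λ, ∃ n : ℤ, f x = n) (N : ℕ) (b : Module.Basis ι ℝ V) (J : Finset ι)
    (hb : ∀ j, b j ∈ Λ) (hN : (J.filter fun j => f (b j) ≠ 0).card ≤ N) :
    IsSimplicialUnion Λ ι (openCone b J ∩ {x | 0 ≤ f x}) := by
  induction N generalizing b J with
  | zero =>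
    have h0 : ∀ j ∈ J, f (b j) = 0 := by
      simpa [Finset.filter_eq_empty_iff] using hN
    rw [Set.inter_eq_left.2]
    · exact .openCone b J hb
    · intro x hx
      rw [Set.mem_ofPred_eq, eq_sum_repr_of_mem_openCone b hx, map_sum]
      exact (Finset.sum_eq_zero fun j hj => by rw [map_smul, h0 j hj, smul_zero]).ge
  | succ N ih =>
    by_cases hpos : ∀ j ∈ J, 0 ≤ f (b j)
    · rw [Set.inter_eq_left.2]
      · exact .openCone b J hb
      · intro x hx
        rw [Set.mem_ofPred_eq, eq_sum_repr_of_mem_openCone b hx, map_sum]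
        refine Finset.sum_nonneg fun j hj => ?_
        rw [map_smul]
        exact mul_nonneg (hx.1 j hj).le (hpos j hj)
    push Not at hpos
    obtain ⟨j, hj, hfj⟩ := hpos
    by_cases hneg : ∀ i ∈ J, f (b i) ≤ 0
    · convert IsSimplicialUnion.empty
      refine Set.eq_empty_of_forall_notMem fun x ⟨hx, hx'⟩ => ?_
      rw [Set.mem_ofPred_eq, eq_sum_repr_of_mem_openCone b hx, map_sum] at hx'
      refine absurd hx' (not_le.2 (Finset.sum_neg' (fun i hi => ?_) ⟨j, hj, ?_⟩))
      · rw [map_smul]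
        exact mul_nonpos_of_nonneg_of_nonpos (hx.1 i hi).le (hneg i hi)
      · rw [map_smul]
        exact mul_neg_of_pos_of_neg (hx.1 j hj) hfj
    push Not at hneg
    obtain ⟨i, hi, hfi⟩ := hneg
    have hij : i ≠ j := by rintro rfl; linarith
    obtain ⟨p, hp⟩ := hf _ (hb i)
    obtain ⟨q, hq⟩ := hf _ (hb j)
    have hp0 : (0 : ℝ) < p := hp ▸ hfi
    have hq0 : (0 : ℝ) < -q := by rw [hq] at hfj; linarith
    -- rescale the edges `i` and `j` so that `f` takes opposite values on them
    let w : ι → ℝˣ := fun k =>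
      if k = i then Units.mk0 (-q) hq0.ne' else if k = j then Units.mk0 (p : ℝ) hp0.ne' else 1
    have hw : ∀ k, 0 < (w k : ℝ) := by
      intro k
      simp only [w]
      split_ifs <;> simp [hp0, hq0]
    let b' := b.unitsSMul w
    have hbi : b' i = (-q : ℝ) • b i := by
      rw [Module.Basis.unitsSMul_apply]
      simp [w, Units.smul_def]
    have hbj : b' j = (p : ℝ) • b j := by
      rw [Module.Basis.unitsSMul_apply]
      simp [w, Units.smul_def, hij.symm]
    have hbk : ∀ k, k ≠ i → k ≠ j → b' k = b k := fun k h1 h2 => by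
      rw [Module.Basis.unitsSMul_apply]
      simp [w, h1, h2]
    have hb' : ∀ k, b' k ∈ Λ := by
      intro k
      by_cases h1 : k = i
      · subst h1
        rw [hbi, ← Int.cast_neg, Int.cast_smul_eq_zsmul]
        exact Λ.smul_mem _ (hb k)
      by_cases h2 : k = j
      · subst h2
        rw [hbj, Int.cast_smul_eq_zsmul]
        exact Λ.smul_mem _ (hb k)
      rw [hbk k h1 h2]
      exact hb k
    have hsum : f (b' i + b' j) = 0 := by
      rw [map_add, hbi, hbj, map_smul, map_smul, hp, hq]
      simp only [smul_eq_mul]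
      ring
    have hsupp : ∀ k, f (b' k) ≠ 0 → f (b k) ≠ 0 := by
      intro k hk h0
      by_cases h1 : k = i
      · subst h1; linarith
      by_cases h2 : k = j
      · subst h2; linarith
      exact hk (by rw [hbk k h1 h2, h0])
    have hadd : ∀ {i' j'} (h : i' ≠ j') k, addBasis b' h k ∈ Λ := by
      intro i' j' h k
      by_cases hk : k = i'
      · subst hk; rw [addBasis_apply_self]; exact Λ.add_mem (hb' _) (hb' _)
      · rw [addBasis_apply_of_ne _ _ hk]; exact hb' k
    -- each of the pieces has fewer edges outside the hyperplane
    have hcard : ∀ {i' j'} (h : i' ≠ j') (K : Finset ι), i' ∈ J → f (b i') ≠ 0 →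
        f (b' i' + b' j') = 0 → K ⊆ J →
        (K.filter fun k => f (addBasis b' h k) ≠ 0).card ≤ N := by
      intro i' j' h K hi' hfi' h0 hK
      refine Nat.lt_succ_iff.1 (lt_of_lt_of_le (Finset.card_lt_card ?_) hN)
      refine (Finset.ssubset_iff_of_subset fun k hk => ?_).2 ⟨i', ?_, ?_⟩
      · obtain ⟨h1, h2⟩ := Finset.mem_filter.1 hk
        refine Finset.mem_filter.2 ⟨hK h1, ?_⟩
        by_cases hki : k = i'
        · rwa [hki]
        · rw [addBasis_apply_of_ne _ _ hki] at h2
          exact hsupp k h2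
      · exact Finset.mem_filter.2 ⟨hi', hfi'⟩
      · intro hmem
        refine (Finset.mem_filter.1 hmem).2 ?_
        rw [addBasis_apply_self, h0]
    have hA := ih (addBasis b' hij) J (hadd hij)
      (hcard hij J hi hfi.ne' hsum subset_rfl)
    have hB := ih (addBasis b' hij.symm) J (hadd hij.symm)
      (hcard hij.symm J hj hfj.ne (by rw [add_comm, hsum]) subset_rfl)
    have hT := ih (addBasis b' hij) (J.erase j) (hadd hij)
      (hcard hij _ hi hfi.ne' hsum (Finset.erase_subset _ _))
    rw [← openCone_unitsSMul b J w hw, openCone_eq_union b' hij hi hj,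
      Set.union_inter_distrib_right,
      Set.union_inter_distrib_right]
    have hd1 : Disjoint (openCone (addBasis b' hij.symm) J)
        (openCone (addBasis b' hij) (J.erase j)) := by
      refine Set.disjoint_left.2 fun x hx hx' => ?_
      rw [mem_openCone_addBasis b' hij.symm hj hi] at hx
      rw [mem_openCone_addBasis_erase b' hij hi hj] at hx'
      exact hx.2.ne' hx'.2
    have hd2 : Disjoint (openCone (addBasis b' hij) J) (openCone (addBasis b' hij.symm) J ∪
        openCone (addBasis b' hij) (J.erase j)) := by
      refine Set.disjoint_left.2 fun x hx hx' => ?_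
      rw [Set.mem_union, mem_openCone_addBasis b' hij.symm hj hi,
        mem_openCone_addBasis_erase b' hij hi hj] at hx'
      rw [mem_openCone_addBasis b' hij hi hj] at hx
      rcases hx' with hx' | hx'
      · exact hx.2.not_gt hx'.2
      · exact hx.2.ne hx'.2
    refine .union ?_ hA (.union ?_ hB hT)
    · rw [← Set.union_inter_distrib_right]
      exact hd2.mono Set.inter_subset_left Set.inter_subset_left
    · exact hd1.mono Set.inter_subset_left Set.inter_subset_left

theorem IsSimplicialUnion.inter_halfSpace [Fintype ι] {Λ : Submodule ℤ V} {P : Set V}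
    (hP : IsSimplicialUnion Λ ι P) (f : StrongDual ℝ V) (hf : ∀ x ∈ Λ, ∃ n : ℤ, f x = n) :
    IsSimplicialUnion Λ ι (P ∩ {x | 0 ≤ f x}) := by
  induction hP with
  | empty => simpa using IsSimplicialUnion.empty
  | openCone b J hb => exact isSimplicialUnion_openCone_inter f hf _ b J hb le_rfl
  | union hPQ _ _ ihP ihQ =>
    rw [Set.union_inter_distrib_right]
    exact .union (hPQ.mono Set.inter_subset_left Set.inter_subset_left) ihP ihQ

/-- The whole space is the disjoint union of the open faces of the orthants of a lattice basis. -/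
theorem isSimplicialUnion_univ [Fintype ι] {Λ : Submodule ℤ V} (b : Module.Basis ι ℝ V)
    (hb : ∀ j, b j ∈ Λ) : IsSimplicialUnion Λ ι (Set.univ : Set V) := by
  let w : (ι → SignType) → ι → ℝˣ := fun s j => if s j = -1 then -1 else 1
  let P : (ι → SignType) → Set V := fun s =>
    openCone (b.unitsSMul (w s)) (Finset.univ.filter fun j => s j ≠ 0)
  have hP : ∀ s x, x ∈ P s ↔ ∀ j, SignType.sign (b.repr x j) = s j := by
    intro s x
    simp only [P, openCone, Set.mem_ofPred_eq, Module.Basis.repr_unitsSMul, Finset.mem_filter,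
      Finset.mem_univ, true_and, ← forall_and]
    refine forall_congr' fun j => ?_
    rcases h : s j with _ | _ | _ <;> simp [w, h, sign_eq_zero_iff]
    exacts [sign_eq_neg_one_iff.symm, sign_eq_one_iff.symm]
  have huniv : ⋃ s ∈ (Finset.univ : Finset (ι → SignType)), P s = Set.univ := by
    refine Set.eq_univ_of_forall fun x => ?_
    simp only [Finset.mem_univ, Set.iUnion_true, Set.mem_iUnion, hP]
    exact ⟨_, fun j => rfl⟩
  rw [← huniv]
  refine IsSimplicialUnion.biUnion _ (fun s s' hne => Set.disjoint_left.2 fun x hx hx' => ?_)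
    fun s _ => .openCone _ _ fun j => ?_
  · exact hne (funext fun j => ((hP s x).1 hx j).symm.trans ((hP s' x).1 hx' j))
  · rw [Module.Basis.unitsSMul_apply]
    simp only [w]
    split_ifs
    · simpa [Units.smul_def] using hb j
    · simpa using hb j

theorem IsRationalCone.isSimplicialUnion [Fintype ι] {Λ : Submodule ℤ V} {c : Set V}
    (hc : IsRationalCone Λ c) (b : Module.Basis ι ℝ V) (hb : ∀ j, b j ∈ Λ) :
    IsSimplicialUnion Λ ι c := by
  obtain ⟨F, hF, rfl⟩ := hc
  classical
  induction F using Finset.induction_on with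
  | empty => simpa using isSimplicialUnion_univ b hb
  | insert f F hfF ih =>
    convert (ih fun g hg => hF g (Finset.mem_insert_of_mem hg)).inter_halfSpace f
      (hF f (Finset.mem_insert_self _ _)) using 1
    ext x
    simp [and_comm]

end

/-! ### Lattice points of shifted cones -/

section

variable {V : Type u} [NormedAddCommGroup V] [NormedSpace ℝ V] {ι : Type u}

/-- A family of lattice points of the shifts of a simplicial cone: the cone is spanned by the basis
vectors with index in `face`, and the points are congruent to `vertex` modulo the basis vectors. -/
structure Cell (V : Type u) [NormedAddCommGroup V] [NormedSpace ℝ V] (ι : Type u) where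
  /-- The basis whose members span the cone. -/
  basis : Module.Basis ι ℝ V
  /-- The indices of the basis vectors that span the cone. -/
  face : Finset ι
  /-- The residue class of the points modulo the lattice spanned by the basis. -/
  vertex : V

namespace Cell

variable (D : Cell V ι)

/-- Along the edge `j`, the offset from `a` of the first point of the residue class. -/
def offset (a : V) (j : D.face) : ℝ := 1 - Int.fract (D.basis.repr (a - D.vertex) j)

/-- The affine span of the cone with vertex `a` meets the residue class. -/
def Meets (a : V) : Prop := ∀ j ∉ D.face, Int.fract (D.basis.repr (a - D.vertex) j) = 0

/-- The point `a + ∑ x_j b_j`. -/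
def affine (a : V) (x : D.face → ℝ) : V := a + ∑ j, x j • D.basis j

/-- The points of the residue class in the cone with vertex `a`. -/
def point (a : V) (k : D.face → ℕ) : V := D.affine a fun j => D.offset a j + k j

theorem offset_mem (a : V) (j : D.face) : D.offset a j ∈ Set.Ioc (0 : ℝ) 1 := by
  have h1 := Int.fract_lt_one (D.basis.repr (a - D.vertex) j)
  have h2 := Int.fract_nonneg (D.basis.repr (a - D.vertex) j)
  constructor <;> simp only [offset] <;> linarith

theorem repr_affine_sub (a : V) (x : D.face → ℝ) (i : ι) [DecidableEq ι] :
    D.basis.repr (D.affine a x - a) i = if h : i ∈ D.face then x ⟨i, h⟩ else 0 := by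
  simp only [affine, add_sub_cancel_left, map_sum, map_smul, Module.Basis.repr_self,
    Finsupp.coe_finsetSum, Finset.sum_apply, Finsupp.smul_single, smul_eq_mul, mul_one]
  split_ifs with h
  · rw [Finset.sum_eq_single ⟨i, h⟩]
    · simp
    · intro j _ hj
      exact Finsupp.single_eq_of_ne fun h' => hj (Subtype.ext h'.symm)
    · simp
  · exact Finset.sum_eq_zero fun j _ => Finsupp.single_eq_of_ne fun h' => h (h' ▸ j.2)

theorem affine_sub_mem_openCone (a : V) {x : D.face → ℝ} (hx : ∀ j, 0 < x j) :
    D.affine a x - a ∈ openCone D.basis D.face := by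
  classical
  refine ⟨fun j hj => ?_, fun j hj => ?_⟩ <;> rw [repr_affine_sub]
  · rw [dif_pos hj]; exact hx _
  · rw [dif_neg hj]

theorem point_sub_mem_openCone (a : V) (k : D.face → ℕ) :
    D.point a k - a ∈ openCone D.basis D.face :=
  D.affine_sub_mem_openCone a fun j => add_pos_of_pos_of_nonneg (D.offset_mem a j).1
    (Nat.cast_nonneg _)

theorem point_injective (a : V) : Function.Injective (D.point a) := by
  classical
  intro k k' h
  funext j
  have := congrArg (fun x => D.basis.repr (x - a) j) h
  simp only [point, repr_affine_sub, dif_pos j.2] at this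
  simpa using this

/-- The points of a cell are congruent to its vertex. -/
theorem exists_repr_point_sub_vertex {a : V} (ha : D.Meets a) (k : D.face → ℕ) (i : ι) :
    ∃ n : ℤ, D.basis.repr (D.point a k - D.vertex) i = n := by
  classical
  have h : D.point a k - D.vertex = (D.point a k - a) + (a - D.vertex) := by abel
  rw [h, map_add, Finsupp.add_apply, point, repr_affine_sub]
  by_cases hi : i ∈ D.face
  · refine ⟨1 + k ⟨i, hi⟩ + ⌊D.basis.repr (a - D.vertex) i⌋, ?_⟩
    rw [dif_pos hi, offset, Int.fract]
    push_cast
    ring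
  · refine ⟨⌊D.basis.repr (a - D.vertex) i⌋, ?_⟩
    rw [dif_neg hi, zero_add, ← sub_eq_zero]
    exact ha i hi

theorem point_mem [Fintype ι] {Λ : Submodule ℤ V} (hb : ∀ j, D.basis j ∈ Λ)
    (hu : D.vertex ∈ Λ) {a : V} (ha : D.Meets a) (k : D.face → ℕ) : D.point a k ∈ Λ := by
  choose n hn using D.exists_repr_point_sub_vertex ha k
  have h : D.point a k = D.vertex + ∑ i, n i • D.basis i := by
    rw [← sub_eq_iff_eq_add', ← D.basis.sum_repr (D.point a k - D.vertex)]
    exact Finset.sum_congr rfl fun i _ => by rw [hn i, Int.cast_smul_eq_zsmul]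
  rw [h]
  exact Λ.add_mem hu (Λ.sum_mem fun i _ => Λ.smul_mem _ (hb i))

/-- Every lattice point in an open simplicial cone with vertex `a` is in the family given by its
residue class. -/
theorem exists_point_eq {a x : V} (hx : x - a ∈ openCone D.basis D.face)
    (hu : ∀ i, ∃ n : ℤ, D.basis.repr (x - D.vertex) i = n) :
    D.Meets a ∧ ∃ k, D.point a k = x := by
  classical
  have h : ∀ i, D.basis.repr (a - D.vertex) i =
      D.basis.repr (x - D.vertex) i - D.basis.repr (x - a) i := by
    intro i
    rw [← Finsupp.sub_apply, ← map_sub]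
    congr 2
    abel
  choose n hn using hu
  refine ⟨fun i hi => ?_, fun j => (⌈D.basis.repr (x - a) j⌉ - 1).toNat, ?_⟩
  · rw [h, hn, hx.2 i hi, sub_zero, Int.fract_intCast]
  · rw [← sub_left_inj (a := a)]
    refine D.basis.ext_elem fun i => ?_
    rw [point, repr_affine_sub]
    split_ifs with hi
    · have h1 : 0 < ⌈D.basis.repr (x - a) i⌉ := Int.ceil_pos.2 (hx.1 i hi)
      have h2 : (((⌈D.basis.repr (x - a) i⌉ - 1).toNat : ℕ) : ℝ) =
          (⌈D.basis.repr (x - a) i⌉ : ℝ) - 1 := by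
        have : (((⌈D.basis.repr (x - a) i⌉ - 1).toNat : ℕ) : ℤ) =
          ⌈D.basis.repr (x - a) i⌉ - 1 := Int.toNat_of_nonneg (by omega)
        exact_mod_cast this
      simp only [offset]
      rw [h2, h, hn, Int.fract, sub_eq_add_neg (n i : ℝ), Int.floor_intCast_add, Int.floor_neg]
      push_cast
      ring
    · rw [hx.2 i hi]

end Cell

variable [Fintype ι]

/-- A finite family of cells which, for all `a`, decomposes the lattice points of `a + c`. -/
structure CellDecomposition (Λ : Submodule ℤ V) (c : Set V) {β : Type u} (D : β → Cell V ι) :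
    Prop where
  basis_mem : ∀ i j, (D i).basis j ∈ Λ
  vertex_mem : ∀ i, (D i).vertex ∈ Λ
  openCone_subset : ∀ i, openCone (D i).basis (D i).face ⊆ c
  existsUnique : ∀ a, ∀ x ∈ Λ, x - a ∈ c →
    ∃! i, (D i).Meets a ∧ ∃ k, (D i).point a k = x

theorem finite_vertices [FiniteDimensional ℝ V] (Λ : Submodule ℤ V) [DiscreteTopology Λ]
    (b : Module.Basis ι ℝ V) :
    {u | u ∈ Λ ∧ u ∈ ZSpan.fundamentalDomain b}.Finite := by
  have h := Metric.finite_isBounded_inter_isClosed (K := ZSpan.fundamentalDomain b)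
    (s := (Λ : Set V)) (DiscreteTopology.isDiscrete) (ZSpan.fundamentalDomain_isBounded b)
    (AddSubgroup.isClosed_of_discrete (H := Λ.toAddSubgroup))
  refine h.subset fun u hu => ⟨hu.2, hu.1⟩

/-- The residue classes modulo the lattice of a basis are represented by the lattice points in its
fundamental domain. -/
theorem IsSimplicialUnion.exists_cellDecomposition [FiniteDimensional ℝ V] {Λ : Submodule ℤ V}
    [DiscreteTopology Λ] {P : Set V} (hP : IsSimplicialUnion Λ ι P) :
    ∃ (β : Type u) (_ : Fintype β) (D : β → Cell V ι), CellDecomposition Λ P D := by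
  induction hP with
  | empty => exact ⟨PEmpty, inferInstance, fun i => i.elim, ⟨fun i => i.elim, fun i => i.elim,
      fun i => i.elim, fun _ _ _ h => h.elim⟩⟩
  | openCone b J hb =>
    have := (finite_vertices Λ b).fintype
    refine ⟨{u | u ∈ Λ ∧ u ∈ ZSpan.fundamentalDomain b}, this, fun u => ⟨b, J, u⟩,
      ⟨fun _ => hb, fun u => u.2.1, fun _ => subset_rfl, fun a x hx hxa => ?_⟩⟩
    have hspan : Submodule.span ℤ (Set.range b) ≤ Λ := by
      rw [Submodule.span_le]; rintro _ ⟨j, rfl⟩; exact hb j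
    have hfr : ZSpan.fract b x ∈ Λ := by
      rw [ZSpan.fract]
      exact Λ.sub_mem hx (hspan (ZSpan.floor b x).2)
    refine ⟨⟨ZSpan.fract b x, hfr, ZSpan.fract_mem_fundamentalDomain b x⟩, ?_, ?_⟩
    · refine Cell.exists_point_eq _ hxa fun i => ⟨⌊b.repr x i⌋, ?_⟩
      rw [map_sub, Finsupp.sub_apply, ZSpan.repr_fract_apply]
      simp
    · rintro ⟨u, hu, hu'⟩ ⟨hm, k, rfl⟩
      refine Subtype.ext (b.ext_elem fun i => ?_)
      obtain ⟨n, hn⟩ := Cell.exists_repr_point_sub_vertex (⟨b, J, u⟩ : Cell V ι) hm k i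
      have h2 := (ZSpan.mem_fundamentalDomain b).1 hu' i
      simp only [map_sub, Finsupp.sub_apply] at hn
      rw [ZSpan.repr_fract_apply, sub_eq_iff_eq_add.1 hn, Int.fract_intCast_add,
        Int.fract_eq_self.2 h2]
  | @union P Q hPQ _ _ ihP ihQ =>
    obtain ⟨β, _, D, hD⟩ := ihP
    obtain ⟨γ, _, E, hE⟩ := ihQ
    refine ⟨β ⊕ γ, inferInstance, Sum.elim D E, ⟨?_, ?_, ?_, fun a x hx hxa => ?_⟩⟩
    · rintro (i | i)
      exacts [hD.basis_mem i, hE.basis_mem i]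
    · rintro (i | i)
      exacts [hD.vertex_mem i, hE.vertex_mem i]
    · rintro (i | i)
      exacts [(hD.openCone_subset i).trans Set.subset_union_left,
        (hE.openCone_subset i).trans Set.subset_union_right]
    · rcases hxa with hxa | hxa
      · obtain ⟨i, hi, huniq⟩ := hD.existsUnique a x hx hxa
        refine ⟨.inl i, hi, ?_⟩
        rintro (j | j) hj
        · rw [huniq j hj]
        · obtain ⟨_, k, rfl⟩ := hj
          exact (Set.disjoint_left.1 hPQ hxa
            (hE.openCone_subset j (Cell.point_sub_mem_openCone _ a k))).elim
      · obtain ⟨i, hi, huniq⟩ := hE.existsUnique a x hx hxa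
        refine ⟨.inr i, hi, ?_⟩
        rintro (j | j) hj
        · obtain ⟨_, k, rfl⟩ := hj
          exact (Set.disjoint_left.1 hPQ
            (hD.openCone_subset j (Cell.point_sub_mem_openCone _ a k)) hxa).elim
        · rw [huniq j hj]

theorem IsRationalCone.exists_cellDecomposition [FiniteDimensional ℝ V] {Λ : Submodule ℤ V}
    [DiscreteTopology Λ] [IsZLattice ℝ Λ] {c : Set V} (hc : IsRationalCone Λ c) :
    ∃ (ι : Type u) (_ : Fintype ι) (β : Type u) (_ : Fintype β) (D : β → Cell V ι),
      CellDecomposition Λ c D := by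
  have : Module.Finite ℤ Λ := ZLattice.module_finite ℝ Λ
  have : Module.Free ℤ Λ := ZLattice.module_free ℝ Λ
  let b := (Module.Free.chooseBasis ℤ Λ).ofZLatticeBasis ℝ Λ
  have hb : ∀ j, b j ∈ Λ := fun j => by
    rw [Module.Basis.ofZLatticeBasis_apply]
    exact Subtype.coe_prop _
  classical
  exact ⟨_, inferInstance, (hc.isSimplicialUnion b hb).exists_cellDecomposition⟩

namespace CellDecomposition

variable {Λ : Submodule ℤ V} {c : Set V} {β : Type u} {D : β → Cell V ι}

/-- The lattice points of `a + c` and the points of the cells. -/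
def equiv (hD : CellDecomposition Λ c D) (a : V) :
    (Σ i : {i // (D i).Meets a}, (D i).face → ℕ) ≃ {x : Λ // (x : V) ∈ a +ᵥ c} :=
  Equiv.ofBijective (fun p => ⟨⟨(D p.1).point a p.2,
      (D p.1).point_mem (hD.basis_mem _) (hD.vertex_mem _) p.1.2 p.2⟩, by
        rw [Set.mem_vadd_set_iff_neg_vadd_mem, vadd_eq_add, neg_add_eq_sub]
        exact hD.openCone_subset _ ((D p.1).point_sub_mem_openCone a p.2)⟩) (by
    constructor
    · rintro ⟨⟨i, hi⟩, k⟩ ⟨⟨i', hi'⟩, k'⟩ h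
      have h : (D i).point a k = (D i').point a k' :=
        congrArg (fun x : {x : Λ // (x : V) ∈ a +ᵥ c} => (x : V)) h
      have hx := (D i).point_mem (hD.basis_mem _) (hD.vertex_mem _) hi k
      have hxa := hD.openCone_subset _ ((D i).point_sub_mem_openCone a k)
      obtain rfl : i = i' := (hD.existsUnique a _ hx hxa).unique ⟨hi, k, rfl⟩ ⟨hi', k', h.symm⟩
      rw [(D i).point_injective a h]
    · rintro ⟨⟨x, hx⟩, hxa⟩
      rw [Set.mem_vadd_set_iff_neg_vadd_mem, vadd_eq_add, neg_add_eq_sub] at hxa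
      obtain ⟨i, ⟨hi, k, hk⟩, -⟩ := hD.existsUnique a x hx hxa
      exact ⟨⟨⟨i, hi⟩, k⟩, Subtype.ext (Subtype.ext hk)⟩)

variable [Fintype β]

theorem summable_iff (hD : CellDecomposition Λ c D) (a : V) (f : V → ℂ) :
    (Summable fun x : {x : Λ // (x : V) ∈ a +ᵥ c} => f x) ↔
      ∀ i, (D i).Meets a → Summable fun k => f ((D i).point a k) := by
  rw [← (hD.equiv a).summable_iff, ← summable_norm_iff, summable_sigma_of_nonneg
    fun _ => norm_nonneg _]
  have : Finite {i // (D i).Meets a} := inferInstance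
  rw [and_iff_left (Summable.of_finite), Subtype.forall]
  exact forall₂_congr fun i hi => summable_norm_iff

open Classical in
theorem tsum_eq (hD : CellDecomposition Λ c D) (a : V) {f : V → ℂ}
    (hf : Summable fun x : {x : Λ // (x : V) ∈ a +ᵥ c} => f x) :
    ∑' x : {x : Λ // (x : V) ∈ a +ᵥ c}, f x =
      ∑ i, if (D i).Meets a then ∑' k, f ((D i).point a k) else 0 := by
  have h1 := (hD.equiv a).tsum_eq fun x : {x : Λ // (x : V) ∈ a +ᵥ c} => f x
  have h2 := Summable.tsum_sigma ((hD.equiv a).summable_iff.2 hf)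
  rw [← h1]
  refine h2.trans ?_
  rw [tsum_fintype, ← Finset.sum_filter]
  exact (Finset.sum_subtype (Finset.univ.filter fun i => (D i).Meets a) (by simp)
    fun i => ∑' k, f ((D i).point a k)).symm

end CellDecomposition

end

/-! ### The generating function and its homogeneous components -/

section

theorem summable_and_tsum_fin_prod (d : ℕ) (f : Fin d → ℕ → ℂ)
    (hf : ∀ j, Summable fun n => ‖f j n‖) :
    (Summable fun k : Fin d → ℕ => ‖∏ j, f j (k j)‖) ∧
      ∑' k : Fin d → ℕ, ∏ j, f j (k j) = ∏ j, ∑' n, f j n := by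
  induction d with
  | zero => exact ⟨Summable.of_finite, by simp⟩
  | succ d ih =>
    obtain ⟨h1, h2⟩ := ih (fun j => f j.succ) fun j => hf _
    have h3 : ∀ p : ℕ × (Fin d → ℕ), ∏ j, f j (Fin.consEquiv (fun _ => ℕ) p j) =
        f 0 p.1 * ∏ j : Fin d, f j.succ (p.2 j) := by
      intro p
      rw [Fin.prod_univ_succ]
      rfl
    constructor
    · rw [← (Fin.consEquiv fun _ => ℕ).summable_iff]
      simp only [Function.comp_def, h3]
      exact Summable.mul_norm (g := fun k : Fin d → ℕ => ∏ j : Fin d, f j.succ (k j)) (hf 0) h1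
    · rw [← (Fin.consEquiv fun _ => ℕ).tsum_eq]
      simp only [h3]
      have h4 : (∑' n, f 0 n) * ∑' k : Fin d → ℕ, ∏ j : Fin d, f j.succ (k j) =
          ∑' p : ℕ × (Fin d → ℕ), f 0 p.1 * ∏ j : Fin d, f j.succ (p.2 j) :=
        tsum_mul_tsum_of_summable_norm (hf 0) h1
      rw [Fin.prod_univ_succ, ← h2, h4]

theorem summable_and_tsum_pi_prod {σ : Type*} [Fintype σ] (f : σ → ℕ → ℂ)
    (hf : ∀ j, Summable fun n => ‖f j n‖) :
    (Summable fun k : σ → ℕ => ‖∏ j, f j (k j)‖) ∧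
      ∑' k : σ → ℕ, ∏ j, f j (k j) = ∏ j, ∑' n, f j n := by
  let e := Fintype.equivFin σ
  obtain ⟨h1, h2⟩ := summable_and_tsum_fin_prod _ (fun j => f (e.symm j)) fun j => hf _
  let E : (σ → ℕ) ≃ (Fin (Fintype.card σ) → ℕ) := e.arrowCongr (Equiv.refl ℕ)
  have h3 : ∀ k : σ → ℕ, ∏ j, f (e.symm j) (E k j) = ∏ j, f j (k j) := fun k =>
    e.symm.prod_comp fun j => f j (k j)
  rw [← E.summable_iff] at h1
  rw [← E.tsum_eq] at h2
  simp only [Function.comp_def, h3] at h1 h2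
  exact ⟨h1, h2.trans (e.symm.prod_comp fun j => ∑' n, f j n)⟩

theorem summable_and_tsum_pi_geometric {σ : Type u} [Fintype σ] (a w : σ → ℂ)
    (hw : ∀ j, ‖w j‖ < 1) : (Summable fun k : σ → ℕ => ∏ j, a j * w j ^ k j) ∧
      ∑' k : σ → ℕ, ∏ j, a j * w j ^ k j = ∏ j, a j / (1 - w j) := by
  have h := summable_and_tsum_pi_prod (fun j n => a j * w j ^ n) fun j => by
    simpa [norm_mul, norm_pow] using
      (summable_geometric_of_lt_one (norm_nonneg _) (hw j)).mul_left ‖a j‖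
  refine ⟨h.1.of_norm, h.2.trans (Finset.prod_congr rfl fun j _ => ?_)⟩
  rw [tsum_mul_left, tsum_geometric_of_norm_lt_one (hw j), div_eq_mul_inv]

variable {V : Type u} [NormedAddCommGroup V] [NormedSpace ℝ V] {ι : Type u}

namespace Cell

variable (D : Cell V ι)

theorem exp_point (a : V) (η : V →L[ℝ] ℂ) (k : D.face → ℕ) :
    Complex.exp (η (D.point a k)) = Complex.exp (η a) * ∏ j : D.face,
      Complex.exp (D.offset a j * η (D.basis j)) * Complex.exp (η (D.basis j)) ^ k j := by
  simp only [point, affine, map_add, map_sum, map_smul, Complex.exp_add, Complex.exp_sum]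
  congr 1
  refine Finset.prod_congr rfl fun j _ => ?_
  rw [← Complex.exp_nat_mul, ← Complex.exp_add, Complex.real_smul]
  congr 1
  push_cast
  ring

theorem norm_exp_lt_one_iff (z : ℂ) : ‖Complex.exp z‖ < 1 ↔ z.re < 0 := by
  rw [Complex.norm_exp, Real.exp_lt_one_iff]

/-- The series of a cell converges exactly where the real parts are negative on its edges. -/
theorem summable_exp_point_iff (a : V) (η : V →L[ℝ] ℂ) :
    (Summable fun k => Complex.exp (η (D.point a k))) ↔
      ∀ j ∈ D.face, (η (D.basis j)).re < 0 := by
  constructor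
  · intro h j hj
    classical
    -- the points of the cell along a single edge give a geometric series
    have hinj : Function.Injective fun n : ℕ => (Pi.single (⟨j, hj⟩ : D.face) n : D.face → ℕ) :=
      fun m n h => by simpa using congrFun h ⟨j, hj⟩
    have h1 := h.comp_injective hinj
    have h2 : ∀ n : ℕ, Complex.exp (η (D.point a (Pi.single (⟨j, hj⟩ : D.face) n))) =
        (Complex.exp (η a) * ∏ j : D.face, Complex.exp (D.offset a j * η (D.basis j))) *
          Complex.exp (η (D.basis j)) ^ n := by
      intro n
      rw [exp_point, Finset.prod_mul_distrib, mul_assoc]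
      congr 2
      rw [Finset.prod_eq_single (⟨j, hj⟩ : D.face)]
      · simp
      · intro i _ hi
        rw [Pi.single_eq_of_ne hi, pow_zero]
      · simp
    simp only [Function.comp_def, h2] at h1
    rw [summable_mul_left_iff (mul_ne_zero (Complex.exp_ne_zero _)
      (Finset.prod_ne_zero_iff.2 fun _ _ => Complex.exp_ne_zero _)),
      summable_geometric_iff_norm_lt_one, norm_exp_lt_one_iff] at h1
    exact h1
  · intro h
    simp only [exp_point]
    exact (summable_and_tsum_pi_geometric _ _
      fun j : D.face => (norm_exp_lt_one_iff _).2 (h j j.2)).1.mul_left _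

/-- The shifted generating function `∏_j e^{κ_j η_j} / (1 - e^{η_j})` of a cell. -/
def genFun (a : V) (η : V →L[ℝ] ℂ) : ℂ :=
  ∏ j : D.face, Complex.exp (D.offset a j * η (D.basis j)) / (1 - Complex.exp (η (D.basis j)))

theorem tsum_exp_point (a : V) {η : V →L[ℝ] ℂ} (h : ∀ j ∈ D.face, (η (D.basis j)).re < 0) :
    ∑' k, Complex.exp (η (D.point a k)) = Complex.exp (η a) * D.genFun a η := by
  simp only [exp_point]
  rw [tsum_mul_left, (summable_and_tsum_pi_geometric _ _
      fun j : D.face => (norm_exp_lt_one_iff _).2 (h j j.2)).2, genFun]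

end Cell

theorem analyticOnNhd_cexp_apply (z : ℂ) (v : V) :
    AnalyticOnNhd ℂ (fun η : V →L[ℝ] ℂ => Complex.exp (z * η v)) Set.univ := by
  let e : (V →L[ℝ] ℂ) →L[ℂ] ℂ := LinearMap.mkContinuous
    { toFun := fun η => η v, map_add' := fun _ _ => rfl, map_smul' := fun _ _ => rfl } ‖v‖
    fun η => by rw [mul_comm]; exact η.le_opNorm v
  intro η _
  exact (analyticAt_const.mul (e.analyticAt η)).cexp

namespace CellDecomposition

variable [Fintype ι] {Λ : Submodule ℤ V} {c : Set V} {β : Type u} {D : β → Cell V ι} [Fintype β]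

theorem mem_latticeSeriesDomain_iff (hD : CellDecomposition Λ c D) (a : V) (η : V →L[ℝ] ℂ) :
    η ∈ latticeSeriesDomain Λ (a +ᵥ c) ↔
      ∀ i, (D i).Meets a → ∀ j ∈ (D i).face, (η ((D i).basis j)).re < 0 := by
  simp only [← Cell.summable_exp_point_iff _ a]
  exact hD.summable_iff a fun x => Complex.exp (η x)

open Classical in
theorem latticeSeries_eq (hD : CellDecomposition Λ c D) (a : V) {η : V →L[ℝ] ℂ}
    (hη : η ∈ latticeSeriesDomain Λ (a +ᵥ c)) :
    latticeSeries Λ (a +ᵥ c) η =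
      Complex.exp (η a) * ∑ i, if (D i).Meets a then (D i).genFun a η else 0 := by
  rw [latticeSeries, hD.tsum_eq a (f := fun x => Complex.exp (η x)) hη, Finset.mul_sum]
  refine Finset.sum_congr rfl fun i _ => ?_
  split_ifs with h
  · exact (D i).tsum_exp_point a ((hD.mem_latticeSeriesDomain_iff a η).1 hη i h)
  · rw [mul_zero]

open Classical in
theorem isContinuationValue (hD : CellDecomposition Λ c D) (a : V) {η : V →L[ℝ] ℂ}
    (hη : ∀ i, ∀ j ∈ (D i).face, Complex.exp (η ((D i).basis j)) ≠ 1) :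
    IsContinuationValue Λ (a +ᵥ c) η
      (Complex.exp (η a) * ∑ i, if (D i).Meets a then (D i).genFun a η else 0) := by
  let r : β → (V →L[ℝ] ℂ) → ℂ := fun i η => ∏ j : (D i).face, (1 - Complex.exp (η ((D i).basis j)))
  let p : β → (V →L[ℝ] ℂ) → ℂ := fun i η =>
    ∏ j : (D i).face, Complex.exp ((D i).offset a j * η ((D i).basis j))
  have hrp : ∀ i η, r i η ≠ 0 → (D i).genFun a η * ∏ i, r i η =
      p i η * ∏ i' ∈ Finset.univ.erase i, r i' η := by
    intro i η h
    rw [Cell.genFun, Finset.prod_div_distrib, ← Finset.mul_prod_erase _ _ (Finset.mem_univ i),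
      ← mul_assoc, div_mul_cancel₀ _ h]
  have hr0 : ∀ i η, (∀ j ∈ (D i).face, Complex.exp (η ((D i).basis j)) ≠ 1) → r i η ≠ 0 :=
    fun i η h => Finset.prod_ne_zero_iff.2 fun j _ => sub_ne_zero.2 (h j j.2).symm
  let g : (V →L[ℝ] ℂ) → ℂ := fun η => Complex.exp (η a) *
    ∑ i, if (D i).Meets a then p i η * ∏ i' ∈ Finset.univ.erase i, r i' η else 0
  have hg : ∀ η, (∀ i, (D i).Meets a → r i η ≠ 0) → (∏ i, r i η) *
      (Complex.exp (η a) * ∑ i, if (D i).Meets a then (D i).genFun a η else 0) = g η := by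
    intro η h
    rw [mul_left_comm, Finset.mul_sum]
    refine congrArg _ (Finset.sum_congr rfl fun i _ => ?_)
    split_ifs with hi
    · rw [mul_comm, hrp i η (h i hi)]
    · rw [mul_zero]
  have hexp : ∀ v : V, AnalyticOnNhd ℂ (fun η : V →L[ℝ] ℂ => Complex.exp (η v)) Set.univ := by
    intro v
    simpa using analyticOnNhd_cexp_apply 1 v
  have hra : ∀ i, AnalyticOnNhd ℂ (r i) Set.univ := fun i =>
    Finset.analyticOnNhd_fun_prod _ fun j _ => analyticOnNhd_const.sub (hexp _)
  have hpa : ∀ i, AnalyticOnNhd ℂ (p i) Set.univ := fun i =>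
    Finset.analyticOnNhd_fun_prod _ fun j _ => analyticOnNhd_cexp_apply _ _
  refine ⟨g, fun η => ∏ i, r i η, ?_, Finset.analyticOnNhd_fun_prod _ fun i _ => hra i,
    fun η hη => ?_, Finset.prod_ne_zero_iff.2 fun i _ => hr0 i η (hη i), ?_⟩
  · refine (hexp a).mul (Finset.analyticOnNhd_fun_sum _ fun i _ => ?_)
    split_ifs
    · exact (hpa i).mul (Finset.analyticOnNhd_fun_prod _ fun i _ => hra i)
    · exact analyticOnNhd_const
  · rw [hD.latticeSeries_eq a hη]
    refine hg η fun i hi => hr0 i η fun j hj h1 => ?_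
    have := (hD.mem_latticeSeriesDomain_iff a η).1 hη i hi j hj
    rw [← Cell.norm_exp_lt_one_iff, h1, norm_one] at this
    exact lt_irrefl _ this
  · rw [← hg η fun i _ => hr0 i η (hη i),
      mul_div_cancel_left₀ _ (Finset.prod_ne_zero_iff.2 fun i _ => hr0 i η (hη i))]

/-- The values of the meromorphic continuation are unique, because the domain of convergence has
interior points. -/
theorem isContinuationValue_unique (hD : CellDecomposition Λ c D) {η₀ : V →L[ℝ] ℂ}
    (hη₀ : ∀ i, ∀ j ∈ (D i).face, (η₀ ((D i).basis j)).re < 0) (a : V) {η : V →L[ℝ] ℂ} {w w' : ℂ}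
    (h : IsContinuationValue Λ (a +ᵥ c) η w) (h' : IsContinuationValue Λ (a +ᵥ c) η w') :
    w = w' := by
  obtain ⟨g, q, hg, hq, hgq, hq0, rfl⟩ := h
  obtain ⟨g', q', hg', hq', hgq', hq0', rfl⟩ := h'
  have hU : ∀ᶠ η in 𝓝 η₀, η ∈ latticeSeriesDomain Λ (a +ᵥ c) := by
    have : ∀ᶠ η in 𝓝 η₀, ∀ i, ∀ j : (D i).face, (η ((D i).basis j)).re < 0 := by
      refine eventually_all.2 fun i => eventually_all.2 fun j => ?_
      have hc : Continuous fun η : V →L[ℝ] ℂ => (η ((D i).basis j)).re := by fun_prop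
      exact hc.continuousAt.eventually_lt continuousAt_const (hη₀ i j j.2)
    filter_upwards [this] with η h
    exact (hD.mem_latticeSeriesDomain_iff a η).2 fun i _ j hj => h i ⟨j, hj⟩
  have heq : (fun η => q η * g' η) = fun η => q' η * g η := by
    refine (hq.mul hg').eq_of_eventuallyEq (hq'.mul hg) (z₀ := η₀) ?_
    filter_upwards [hU] with η h
    change q η * g' η = q' η * g η
    rw [← hgq η h, ← hgq' η h]
    ring
  rw [div_eq_div_iff hq0 hq0']
  linear_combination -congrFun heq η

open Classical in
theorem S_eq (hD : CellDecomposition Λ c D) {η₀ : V →L[ℝ] ℂ}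
    (hη₀ : ∀ i, ∀ j ∈ (D i).face, (η₀ ((D i).basis j)).re < 0) (a : V) {η : V →L[ℝ] ℂ}
    (hη : ∀ i, ∀ j ∈ (D i).face, Complex.exp (η ((D i).basis j)) ≠ 1) :
    S Λ (a +ᵥ c) η = Complex.exp (η a) * ∑ i, if (D i).Meets a then (D i).genFun a η else 0 := by
  have h := hD.isContinuationValue a hη
  have hex : ∃ w, IsContinuationValue Λ (a +ᵥ c) η w := ⟨_, h⟩
  rw [S, dif_pos hex]
  exact hD.isContinuationValue_unique hη₀ a hex.choose_spec h

/-- Where the real parts are negative on all edges, the continuation is given by the series. -/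
theorem S_eq_latticeSeries (hD : CellDecomposition Λ c D) (a : V) {η : V →L[ℝ] ℂ}
    (hη : ∀ i, ∀ j ∈ (D i).face, (η ((D i).basis j)).re < 0) :
    η ∈ latticeSeriesDomain Λ (a +ᵥ c) ∧ S Λ (a +ᵥ c) η = latticeSeries Λ (a +ᵥ c) η := by
  have h1 := (hD.mem_latticeSeriesDomain_iff a η).2 fun i _ j hj => hη i j hj
  refine ⟨h1, ?_⟩
  rw [hD.latticeSeries_eq a h1, hD.S_eq hη a fun i j hj h => ?_]
  have := hη i j hj
  rw [← Cell.norm_exp_lt_one_iff, h, norm_one] at this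
  exact lt_irrefl _ this

end CellDecomposition

/-- The homogeneous component of degree `m` of the shifted generating function of a cell. -/
def Cell.genComponent (D : Cell V ι) (a : V) (m : ℤ) (ζ : V →L[ℝ] ℂ) : ℂ :=
  if 0 ≤ m + D.face.card then
    (∏ j : D.face, -(ζ (D.basis j))⁻¹) *
      MvPolynomial.eval (fun j : D.face => ζ (D.basis j))
        (PowerSeries.coeff (m + D.face.card).toNat
          (homSeries fun j => bernoulliSeries (D.offset a j)))
  else 0

theorem HasExpansion.eventually_hasSum_zpow {f : ℂ → ℂ} {p : PowerSeries ℂ} (h : HasExpansion f p)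
    (d : ℕ) (A : ℂ) : ∀ᶠ z in 𝓝[≠] (0 : ℂ), HasSum (fun n : ℤ =>
      (if 0 ≤ n + d then A * PowerSeries.coeff (n + d).toNat p else 0) * z ^ n)
        (A * (z ^ d)⁻¹ * f z) := by
  filter_upwards [eventually_nhdsWithin_of_eventually_nhds h, self_mem_nhdsWithin] with z hz hz0
  have hinj : Function.Injective fun n : ℕ => (n : ℤ) - d := fun m n h => by simpa using h
  refine (hinj.hasSum_iff fun n hn => ?_).1 ?_
  · rw [if_neg, zero_mul]
    intro hle
    exact hn ⟨(n + d).toNat, by simp only; omega⟩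
  · refine (hz.2.mul_left (A * (z ^ d)⁻¹)).congr_fun fun n => ?_
    simp only [Function.comp, sub_add_cancel, Nat.cast_nonneg, if_true, Int.toNat_natCast]
    rw [zpow_sub₀ hz0, zpow_natCast, zpow_natCast]
    ring

theorem Cell.eventually_hasSum_genFun (D : Cell V ι) (a : V) {ζ : V →L[ℝ] ℂ}
    (hζ : ∀ j ∈ D.face, ζ (D.basis j) ≠ 0) : ∀ᶠ z in 𝓝[≠] (0 : ℂ),
      HasSum (fun n : ℤ => D.genComponent a n ζ * z ^ n) (D.genFun a (z • ζ)) := by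
  choose F hF hF' using fun j : D.face => exists_hasExpansion_bernoulliSeries (D.offset a j)
  have h1 := (HasExpansion.prod Finset.univ fun j _ => (hF j).comp_mul (ζ (D.basis j)))
  rw [← map_eval_homSeries] at h1
  have h2 : ∀ᶠ z in 𝓝[≠] (0 : ℂ), ∀ j : D.face, ζ (D.basis j) * z ≠ 0 →
      F j (ζ (D.basis j) * z) = ζ (D.basis j) * z *
        Complex.exp (D.offset a j * (ζ (D.basis j) * z)) /
          (Complex.exp (ζ (D.basis j) * z) - 1) := by
    refine eventually_all.2 fun j => eventually_nhdsWithin_of_eventually_nhds ?_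
    have h : Tendsto (fun z : ℂ => ζ (D.basis j) * z) (𝓝 0) (𝓝 0) := by
      simpa using (continuous_const_mul (ζ (D.basis j))).tendsto (0 : ℂ)
    exact h.eventually (hF' j)
  filter_upwards [h1.eventually_hasSum_zpow D.face.card (∏ j : D.face, -(ζ (D.basis j))⁻¹), h2,
    self_mem_nhdsWithin] with z hz hz2 hz0
  have hval : D.genFun a (z • ζ) = (∏ j : D.face, -(ζ (D.basis j))⁻¹) * (z ^ D.face.card)⁻¹ *
      ∏ j : D.face, F j (ζ (D.basis j) * z) := by
    rw [← inv_pow, ← Fintype.card_coe, ← Finset.card_univ, ← Finset.prod_const,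
      ← Finset.prod_mul_distrib, ← Finset.prod_mul_distrib, genFun]
    refine Finset.prod_congr rfl fun j _ => ?_
    have hj := hζ j j.2
    have hz0 : z ≠ 0 := hz0
    rw [hz2 j (mul_ne_zero hj hz0)]
    simp only [_root_.smul_apply, smul_eq_mul, mul_comm z]
    rw [← neg_sub (Complex.exp (ζ (D.basis j) * z)) 1, div_neg]
    field_simp
  rw [hval]
  refine hz.congr_fun fun n => ?_
  simp only [genComponent, PowerSeries.coeff_map]

namespace CellDecomposition

variable [Fintype ι] {Λ : Submodule ℤ V} {c : Set V} {β : Type u} {D : β → Cell V ι} [Fintype β]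

open Classical in
theorem homComponent_M_eq (hD : CellDecomposition Λ c D) {η₀ : V →L[ℝ] ℂ}
    (hη₀ : ∀ i, ∀ j ∈ (D i).face, (η₀ ((D i).basis j)).re < 0) (a : V) (m : ℤ) {ζ : V →L[ℝ] ℂ}
    (hζ : ∀ i, ∀ j ∈ (D i).face, ζ ((D i).basis j) ≠ 0) :
    homComponent (M Λ a c) m ζ = ∑ i, if (D i).Meets a then (D i).genComponent a m ζ else 0 := by
  refine laurentCoeff_eq (a := fun m => ∑ i, if (D i).Meets a then (D i).genComponent a m ζ else 0)
    ⟨⟨-∑ i, ((D i).face.card : ℤ), fun n hn => Finset.sum_eq_zero fun i _ => ?_⟩, ?_⟩ m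
  · have : ((D i).face.card : ℤ) ≤ ∑ i, ((D i).face.card : ℤ) :=
      Finset.single_le_sum (f := fun i => ((D i).face.card : ℤ)) (fun _ _ => by positivity)
        (Finset.mem_univ i)
    have hneg : ¬ 0 ≤ n + ((D i).face.card : ℤ) := by omega
    simp only [Cell.genComponent, if_neg hneg, ite_self]
  have h1 : ∀ᶠ z in 𝓝[≠] (0 : ℂ), ∀ i, ∀ j : (D i).face,
      Complex.exp ((z • ζ) ((D i).basis j)) ≠ 1 := by
    refine eventually_all.2 fun i => eventually_all.2 fun j => ?_
    have hd : HasDerivAt (fun z : ℂ => Complex.exp ((z • ζ) ((D i).basis j)))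
        (ζ ((D i).basis j)) 0 := by
      have := ((hasDerivAt_id (0 : ℂ)).mul_const (ζ ((D i).basis j))).cexp
      simpa using this
    exact hd.eventually_ne (hζ i j j.2)
  have h2 : ∀ᶠ z in 𝓝[≠] (0 : ℂ), ∀ i, HasSum
      (fun n : ℤ => (D i).genComponent a n ζ * z ^ n) ((D i).genFun a (z • ζ)) :=
    eventually_all.2 fun i => (D i).eventually_hasSum_genFun a (hζ i)
  filter_upwards [h1, h2] with z hz1 hz2
  rw [M, hD.S_eq hη₀ a fun i j hj => hz1 i ⟨j, hj⟩, ← mul_assoc, ← Complex.exp_add,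
    neg_add_cancel, Complex.exp_zero, one_mul]
  simp only [Finset.sum_mul]
  refine hasSum_sum fun i _ => ?_
  split_ifs
  · exact hz2 i
  · simp

end CellDecomposition

end

/-! ### The Fourier transform of test densities -/

section

variable {V : Type u} [NormedAddCommGroup V] [NormedSpace ℝ V]

/-- The Fourier transform of test densities is a topological isomorphism: up to a scalar and linear
changes of coordinates it is that of a Euclidean space. -/
theorem exists_fourierDensity_inverse [FiniteDimensional ℝ V] (ν : Measure (StrongDual ℝ V))
    [ν.IsAddHaarMeasure] :
    ∃ Ψ : 𝓢(V, ℂ) →L[ℂ] 𝓢(StrongDual ℝ V, ℂ),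
      (∀ ψ, Ψ (fourierDensity ν ψ) = ψ) ∧ ∀ h, fourierDensity ν (Ψ h) = h := by
  let W := EuclideanSpace ℝ (Fin (Module.finrank ℝ V))
  let e : V ≃L[ℝ] W := toEuclidean
  let a : W ≃L[ℝ] StrongDual ℝ V :=
    (InnerProductSpace.toDual ℝ W).toContinuousLinearEquiv.trans
      (e.symm.arrowCongr (ContinuousLinearEquiv.refl ℝ ℝ))
  have ha : ∀ (y : W) (x : V), a y x = inner ℝ y (e x) := fun y x => by
    simp [a]
  let μ : Measure (StrongDual ℝ V) := (volume : Measure W).map a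
  have : μ.IsAddHaarMeasure := a.isAddHaarMeasure_map volume
  let r : NNReal := Measure.addHaarScalarFactor ν μ
  have hν : ν = r • μ := Measure.isAddLeftInvariant_eq_smul ν μ
  have hr : (r : ℂ) ≠ 0 := by
    intro h
    have h0 : r = 0 := by exact_mod_cast h
    have hν0 : ν = 0 := by rw [hν, h0, zero_smul]
    have := isOpen_univ.measure_pos ν Set.univ_nonempty
    simp [hν0] at this
  let b : V ≃L[ℝ] W := e.trans (ContinuousLinearEquiv.smulLeft
    (Units.mk0 (2 * Real.pi)⁻¹ (by positivity)))
  have hbx : ∀ x, b x = (2 * Real.pi)⁻¹ • e x := fun x => rfl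
  have hFD : ∀ ψ, fourierDensity ν ψ = (r : ℂ) • SchwartzMap.compCLMOfContinuousLinearEquiv ℂ b
      (FourierTransform.fourierCLE ℂ 𝓢(W, ℂ)
        (SchwartzMap.compCLMOfContinuousLinearEquiv ℂ a ψ)) := by
    intro ψ
    ext x
    have hF : ∀ (φ : 𝓢(W, ℂ)) (w : W), FourierTransform.fourierCLE ℂ 𝓢(W, ℂ) φ w =
        ∫ y, Complex.exp (↑(-2 * Real.pi * inner ℝ y w) * Complex.I) • φ y := fun φ w =>
      Real.fourier_eq' (φ : W → ℂ) w
    have hmap : (∫ ξ, Complex.exp (-Complex.I * (ξ x : ℝ)) * ψ ξ ∂μ) =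
        ∫ y, Complex.exp (-Complex.I * (a y x : ℝ)) * ψ (a y) :=
      a.toHomeomorph.measurableEmbedding.integral_map _
    rw [fourierDensity_apply, hν, integral_smul_nnreal_measure, hmap]
    simp only [_root_.smul_apply, SchwartzMap.compCLMOfContinuousLinearEquiv_apply, Function.comp,
      hF]
    rw [NNReal.smul_def, Complex.real_smul, smul_eq_mul]
    congr 1
    refine integral_congr_ae (Eventually.of_forall fun y => ?_)
    simp only [smul_eq_mul, hbx, ha, inner_smul_right]
    congr 2
    push_cast
    have : (Real.pi : ℂ) ≠ 0 := by exact_mod_cast Real.pi_ne_zero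
    field_simp
  refine ⟨(r : ℂ)⁻¹ • ((SchwartzMap.compCLMOfContinuousLinearEquiv ℂ a.symm) ∘L
    ((FourierTransform.fourierCLE ℂ 𝓢(W, ℂ)).symm : 𝓢(W, ℂ) →L[ℂ] 𝓢(W, ℂ)) ∘L
      (SchwartzMap.compCLMOfContinuousLinearEquiv ℂ b.symm)), fun ψ => ?_, fun h => ?_⟩
  · have h1 : SchwartzMap.compCLMOfContinuousLinearEquiv ℂ b.symm (fourierDensity ν ψ) =
        (r : ℂ) • FourierTransform.fourierCLE ℂ 𝓢(W, ℂ)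
          (SchwartzMap.compCLMOfContinuousLinearEquiv ℂ a ψ) := by
      rw [hFD]
      ext w
      simp
    simp only [_root_.smul_apply, ContinuousLinearMap.comp_apply, ContinuousLinearEquiv.coe_coe, h1,
      map_smul, ContinuousLinearEquiv.symm_apply_apply]
    rw [smul_smul, inv_mul_cancel₀ hr, one_smul]
    ext ξ
    simp
  · rw [hFD]
    simp only [_root_.smul_apply, ContinuousLinearMap.comp_apply, ContinuousLinearEquiv.coe_coe,
      map_smul]
    have h1 : ∀ φ : 𝓢(W, ℂ), SchwartzMap.compCLMOfContinuousLinearEquiv ℂ a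
        (SchwartzMap.compCLMOfContinuousLinearEquiv ℂ a.symm φ) = φ := by
      intro φ
      ext w
      simp
    rw [h1, ContinuousLinearEquiv.apply_symm_apply, smul_smul, mul_inv_cancel₀ hr, one_smul]
    ext x
    simp

theorem integrable_exp_mul [FiniteDimensional ℝ V] (ν : Measure (StrongDual ℝ V))
    [ν.IsAddHaarMeasure] (ψ : 𝓢(StrongDual ℝ V, ℂ)) (x : V) :
    Integrable (fun ξ : StrongDual ℝ V => Complex.exp (-Complex.I * (ξ x : ℝ)) * ψ ξ) ν := by
  refine ψ.integrable.bdd_mul (c := 1) (by fun_prop) (Eventually.of_forall fun ξ => ?_)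
  rw [Complex.norm_exp]
  simp

/-- Multiplication by the character `ξ ↦ e^{-i⟨ξ, s⟩}` corresponds to a translation. -/
theorem fourierDensity_smulLeftCLM_exp [FiniteDimensional ℝ V] (ν : Measure (StrongDual ℝ V))
    [ν.IsAddHaarMeasure] (ψ : 𝓢(StrongDual ℝ V, ℂ)) (s x : V) :
    fourierDensity ν (SchwartzMap.smulLeftCLM ℂ
      (fun ξ : StrongDual ℝ V => Complex.exp (-Complex.I * (ξ s : ℝ))) ψ) x =
        fourierDensity ν ψ (s + x) := by
  rw [fourierDensity_apply, fourierDensity_apply]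
  congr 1
  funext ξ
  rw [SchwartzMap.smulLeftCLM_apply_apply (hasTemperateGrowth_exp s), smul_eq_mul, ← mul_assoc,
    ← Complex.exp_add, map_add]
  congr 2
  push_cast
  ring

variable {σ : Type*}

theorem hasTemperateGrowth_eval (v : σ → V) (P : MvPolynomial σ ℂ) :
    Function.HasTemperateGrowth fun ξ : StrongDual ℝ V =>
      MvPolynomial.eval (fun j => -Complex.I * (ξ (v j) : ℝ)) P := by
  have hlin : ∀ w : V, Function.HasTemperateGrowth
      fun ξ : StrongDual ℝ V => -Complex.I * (ξ w : ℝ) := by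
    intro w
    let L : StrongDual ℝ V →L[ℝ] ℂ :=
      (-Complex.I) • (Complex.ofRealCLM ∘L ContinuousLinearMap.apply ℝ ℝ w)
    exact L.hasTemperateGrowth
  induction P using MvPolynomial.induction_on with
  | C a => simp
  | add p q hp hq =>
    simp only [map_add]
    exact hp.add hq
  | mul_X p j hp =>
    simp only [map_mul, MvPolynomial.eval_X]
    exact hp.mul (hlin (v j))

/-- Multiplication of test functions by the function `ξ ↦ P(-i⟨ξ, v_j⟩)`, for a polynomial `P` in
variables indexed like the vectors `v_j`. -/
def polyMul (v : σ → V) (P : MvPolynomial σ ℂ) :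
    𝓢(StrongDual ℝ V, ℂ) →L[ℂ] 𝓢(StrongDual ℝ V, ℂ) :=
  SchwartzMap.smulLeftCLM ℂ fun ξ : StrongDual ℝ V =>
    MvPolynomial.eval (fun j => -Complex.I * (ξ (v j) : ℝ)) P

theorem polyMul_apply (v : σ → V) (P : MvPolynomial σ ℂ) (ψ : 𝓢(StrongDual ℝ V, ℂ))
    (ξ : StrongDual ℝ V) :
    polyMul v P ψ ξ = MvPolynomial.eval (fun j => -Complex.I * (ξ (v j) : ℝ)) P * ψ ξ :=
  SchwartzMap.smulLeftCLM_apply_apply (hasTemperateGrowth_eval v P) ψ ξ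

theorem polyMul_one (v : σ → V) (ψ : 𝓢(StrongDual ℝ V, ℂ)) : polyMul v 1 ψ = ψ := by
  ext ξ
  simp [polyMul_apply]

theorem polyMul_add (v : σ → V) (P Q : MvPolynomial σ ℂ) (ψ : 𝓢(StrongDual ℝ V, ℂ)) :
    polyMul v (P + Q) ψ = polyMul v P ψ + polyMul v Q ψ := by
  ext ξ
  simp [polyMul_apply, add_mul]

theorem polyMul_smul (v : σ → V) (a : ℂ) (P : MvPolynomial σ ℂ) (ψ : 𝓢(StrongDual ℝ V, ℂ)) :
    polyMul v (a • P) ψ = a • polyMul v P ψ := by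
  ext ξ
  simp [polyMul_apply, mul_assoc]

theorem polyMul_mul (v : σ → V) (P Q : MvPolynomial σ ℂ) (ψ : 𝓢(StrongDual ℝ V, ℂ)) :
    polyMul v (P * Q) ψ = polyMul v P (polyMul v Q ψ) := by
  ext ξ
  simp [polyMul_apply, mul_assoc]

/-- The Fourier transform of a test density, multiplied by polynomials, in the coordinates
`x ↦ a + ∑ x_j v_j`: the polynomial variables act as the partial derivatives. -/
theorem hasDerivAt_fourierDensity_polyMul [Fintype σ] [FiniteDimensional ℝ V]
    (ν : Measure (StrongDual ℝ V)) [ν.IsAddHaarMeasure] (ψ : 𝓢(StrongDual ℝ V, ℂ)) (v : σ → V)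
    (w : σ → ℝ) (x : V) (θ : ℝ) :
    HasDerivAt (fun θ : ℝ => fourierDensity ν ψ (x + θ • ∑ j, w j • v j))
      (fourierDensity ν (polyMul v (∑ j, MvPolynomial.C (w j : ℂ) * MvPolynomial.X j) ψ)
        (x + θ • ∑ j, w j • v j)) θ := by
  let y := ∑ j, w j • v j
  let φ := polyMul v (∑ j, MvPolynomial.C (w j : ℂ) * MvPolynomial.X j) ψ
  have hφ : ∀ ξ, φ ξ = -Complex.I * (ξ y : ℝ) * ψ ξ := by
    intro ξ
    simp only [φ, polyMul_apply, y, map_sum, map_mul, MvPolynomial.eval_C, MvPolynomial.eval_X,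
      map_smul, smul_eq_mul, Complex.ofReal_sum, Complex.ofReal_mul, Finset.mul_sum]
    congr 1
    exact Finset.sum_congr rfl fun j _ => by ring
  simp only [fourierDensity_apply]
  refine (hasDerivAt_integral_of_dominated_loc_of_deriv_le
    (F := fun (θ : ℝ) (ξ : StrongDual ℝ V) => Complex.exp (-Complex.I * (ξ (x + θ • y) : ℝ)) * ψ ξ)
    (F' := fun (θ : ℝ) (ξ : StrongDual ℝ V) => Complex.exp (-Complex.I * (ξ (x + θ • y) : ℝ)) * φ ξ)
    (bound := fun ξ => ‖φ ξ‖) (Filter.univ_mem) (Eventually.of_forall fun θ => ?_)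
    (integrable_exp_mul ν ψ _) ?_ (Eventually.of_forall fun ξ θ _ => ?_) φ.integrable.norm
    (Eventually.of_forall fun ξ θ _ => ?_)).2
  · exact (integrable_exp_mul ν ψ _).aestronglyMeasurable
  · exact (integrable_exp_mul ν φ _).aestronglyMeasurable
  · rw [norm_mul, Complex.norm_exp]
    simp
  · have h1 : HasDerivAt (fun θ : ℝ => ((ξ (x + θ • y) : ℝ) : ℂ)) ((ξ y : ℝ) : ℂ) θ := by
      simp only [map_add, map_smul, smul_eq_mul]
      refine HasDerivAt.ofReal_comp (f := fun θ => ξ x + θ * ξ y) ?_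
      simpa using ((hasDerivAt_id θ).mul_const (ξ y)).const_add (ξ x)
    have h2 := ((h1.const_mul (-Complex.I)).cexp.mul_const (ψ ξ))
    exact h2.congr_deriv (by rw [hφ]; ring)

/-! ### Cells and Schwartz functions -/

theorem exists_norm_le_weight [Fintype σ] (f : 𝓢(σ → ℝ, ℂ)) :
    ∃ C, ∀ x, ‖f x‖ ≤ C * weight x := by
  refine ⟨2 ^ (Fintype.card σ + 1) * (Finset.Iic (Fintype.card σ + 1, 0)).sup
    (schwartzSeminormFamily ℂ (σ → ℝ) ℂ) f, fun x => ?_⟩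
  have := SchwartzMap.one_add_le_sup_seminorm_apply (𝕜 := ℂ) (m := (Fintype.card σ + 1, 0))
    (k := Fintype.card σ + 1) (n := 0) le_rfl le_rfl f x
  rw [norm_iteratedFDeriv_zero] at this
  rw [weight, ← div_eq_mul_inv, le_div_iff₀ (by positivity), mul_comm]
  exact this

namespace Cell

variable {ι : Type u} (D : Cell V ι)

/-- The affine parametrization of the span of a cell is proper. -/
theorem exists_antilipschitz_affine (a : V) : ∃ K, AntilipschitzWith K (D.affine a) := by
  let L : (D.face → ℝ) →ₗ[ℝ] V := Fintype.linearCombination ℝ fun j : D.face => D.basis j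
  have hL : LinearMap.ker L = ⊥ := LinearMap.ker_eq_bot.2 <|
    LinearIndependent.fintypeLinearCombination_injective
      (D.basis.linearIndependent.comp _ Subtype.val_injective)
  obtain ⟨K, -, hK⟩ := L.exists_antilipschitzWith hL
  refine ⟨K, fun x y => (hK x y).trans_eq ?_⟩
  simp only [affine, edist_add_left]
  rfl

theorem hasTemperateGrowth_affine (a : V) : (D.affine a).HasTemperateGrowth := by
  let L : (D.face → ℝ) →ₗ[ℝ] V := Fintype.linearCombination ℝ fun j : D.face => D.basis j
  exact (Function.HasTemperateGrowth.const a).add L.toContinuousLinearMap.hasTemperateGrowth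

/-- The restriction of Schwartz functions to the affine span of a cell, in coordinates. -/
def restrict (a : V) : 𝓢(V, ℂ) →L[ℂ] 𝓢(D.face → ℝ, ℂ) :=
  SchwartzMap.compCLMOfAntilipschitz ℂ (D.hasTemperateGrowth_affine a)
    (D.exists_antilipschitz_affine a).choose_spec

/-- The jet family of the restriction of the Fourier transform of a test density to the affine span
of a cell. -/
def jetFamily [FiniteDimensional ℝ V] (ν : Measure (StrongDual ℝ V)) [ν.IsAddHaarMeasure] (a : V)
    (ψ : 𝓢(StrongDual ℝ V, ℂ)) : JetFamily D.face where
  toFun :=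
    { toFun := fun P => D.restrict a
        (fourierDensity ν (polyMul (fun j : D.face => D.basis j) P ψ))
      map_add' := fun P Q => by
        rw [polyMul_add, map_add, map_add]
        rfl
      map_smul' := fun z P => by
        rw [polyMul_smul, map_smul, map_smul]
        rfl }
  continuous P := SchwartzMap.continuous _
  bound P := exists_norm_le_weight
    (D.restrict a (fourierDensity ν (polyMul (fun j : D.face => D.basis j) P ψ)))
  hasDerivAt P x w θ := by
    have h := hasDerivAt_fourierDensity_polyMul ν (polyMul (fun j : D.face => D.basis j) P ψ)
      (fun j : D.face => D.basis j) w (D.affine a x) θ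
    have haff : ∀ θ : ℝ, D.affine a x + θ • ∑ j, w j • D.basis j = D.affine a (x + θ • w) := by
      intro θ
      simp only [affine, Pi.add_apply, Pi.smul_apply, add_smul, Finset.sum_add_distrib,
        Finset.smul_sum, smul_smul, smul_eq_mul, add_assoc]
    simp only [haff] at h
    rw [← polyMul_mul] at h
    exact h

end Cell

instance hasTemperateGrowth_restrict_orthant [Fintype σ] :
    ((volume : Measure (σ → ℝ)).restrict (orthant σ)).HasTemperateGrowth := by
  obtain ⟨n, hn⟩ := Measure.HasTemperateGrowth.exists_integrable (μ := (volume : Measure (σ → ℝ)))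
  exact ⟨n, hn.integrableOn⟩

/-- The tempered distribution `h ↦ ∫ h(∑ x_j b_j) dx`, the integral extending over `x_j > 0`. -/
def Cell.integral {ι : Type u} (D : Cell V ι) : 𝓢(V, ℂ) →L[ℂ] ℂ :=
  (SchwartzMap.integralCLM ℂ (volume.restrict (orthant D.face))) ∘L D.restrict 0

theorem Cell.integral_apply {ι : Type u} (D : Cell V ι) (h : 𝓢(V, ℂ)) :
    D.integral h = ∫ x in orthant D.face, h (D.affine 0 x) := rfl

end

/-! ### Boundary values of homogeneous components -/

section

theorem integrableOn_orthant_exp {σ : Type*} [Fintype σ] {z : σ → ℂ} (hz : ∀ j, (z j).re < 0) :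
    IntegrableOn (fun x : σ → ℝ => ∏ j, Complex.exp (z j * x j)) (orthant σ) := by
  rw [IntegrableOn, orthant, volume_pi, Measure.restrict_pi_pi]
  exact Integrable.fintype_prod (f := fun (j : σ) (x : ℝ) => Complex.exp (z j * x))
    fun j => integrableOn_exp_mul_complex_Ioi (hz j) 0

theorem integral_orthant_exp {σ : Type*} [Fintype σ] {z : σ → ℂ} (hz : ∀ j, (z j).re < 0) :
    ∫ x in orthant σ, ∏ j, Complex.exp (z j * x j) = ∏ j, -(z j)⁻¹ := by
  rw [orthant, volume_pi, Measure.restrict_pi_pi,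
    integral_fintype_prod_eq_prod fun (j : σ) (x : ℝ) => Complex.exp (z j * x)]
  refine Finset.prod_congr rfl fun j _ => ?_
  rw [integral_exp_mul_complex_Ioi (hz j)]
  simp [neg_div]

variable {V : Type u} [NormedAddCommGroup V] [NormedSpace ℝ V]

/-- The point `-i(ξ + iε lam)` of the complexified dual space. -/
def shiftedPoint (lam ξ : StrongDual ℝ V) (ε : ℝ) : V →L[ℝ] ℂ :=
  -Complex.I • (toComplex ξ + (Complex.I * ε) • toComplex lam)

theorem shiftedPoint_apply (lam ξ : StrongDual ℝ V) (ε : ℝ) (v : V) :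
    shiftedPoint lam ξ ε v = -Complex.I * (ξ v : ℝ) + ε * lam v := by
  have h : shiftedPoint lam ξ ε v =
      -Complex.I * ((ξ v : ℝ) + Complex.I * ε * (lam v : ℝ)) := rfl
  rw [h]
  linear_combination (-ε * lam v : ℂ) * Complex.I_mul_I

theorem shiftedPoint_apply_re (lam ξ : StrongDual ℝ V) (ε : ℝ) (v : V) :
    (shiftedPoint lam ξ ε v).re = ε * lam v := by
  simp [shiftedPoint_apply]

theorem norm_exp_shiftedPoint_apply (lam ξ : StrongDual ℝ V) (ε : ℝ) (v : V) :
    ‖Complex.exp (shiftedPoint lam ξ ε v)‖ = Real.exp (ε * lam v) := by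
  rw [Complex.norm_exp, shiftedPoint_apply_re]

theorem continuous_shiftedPoint_apply (lam : StrongDual ℝ V) (ε : ℝ) (v : V) :
    Continuous fun ξ => shiftedPoint lam ξ ε v := by
  simp only [shiftedPoint_apply]
  fun_prop

namespace Cell

variable {ι : Type u} (D : Cell V ι)

theorem prod_exp_shiftedPoint (lam ξ : StrongDual ℝ V) (ε : ℝ) (x : D.face → ℝ) :
    ∏ j : D.face, Complex.exp (shiftedPoint lam ξ ε (D.basis j) * x j) =
      Complex.exp (ε * lam (D.affine 0 x)) *
        Complex.exp (-Complex.I * (ξ (D.affine 0 x) : ℝ)) := by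
  rw [← Complex.exp_sum, ← Complex.exp_add]
  congr 1
  simp only [shiftedPoint_apply, affine, zero_add, map_sum, map_smul, smul_eq_mul,
    Complex.ofReal_sum, Complex.ofReal_mul, Finset.mul_sum, ← Finset.sum_add_distrib]
  exact Finset.sum_congr rfl fun j _ => by ring

theorem continuous_affine (a : V) : Continuous (D.affine a) := by
  unfold affine
  fun_prop

variable [FiniteDimensional ℝ V] (ν : Measure (StrongDual ℝ V)) [ν.IsAddHaarMeasure]

/-- Fubini's theorem for `∏_j -1 / z_j = ∫ e^{∑ x_j z_j} dx`, integrated against a test density. -/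
theorem integrable_and_integral_prod_inv {lam : StrongDual ℝ V}
    (hlam : ∀ j ∈ D.face, lam (D.basis j) < 0) {ε : ℝ} (hε : 0 < ε) (ψ : 𝓢(StrongDual ℝ V, ℂ)) :
    Integrable (fun ξ => (∏ j : D.face, -(shiftedPoint lam ξ ε (D.basis j))⁻¹) * ψ ξ) ν ∧
    ∫ ξ, (∏ j : D.face, -(shiftedPoint lam ξ ε (D.basis j))⁻¹) * ψ ξ ∂ν =
      ∫ x in orthant D.face, Complex.exp (ε * lam (D.affine 0 x)) *
        fourierDensity ν ψ (D.affine 0 x) := by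
  have hre : ∀ ξ, ∀ j : D.face, (shiftedPoint lam ξ ε (D.basis j)).re < 0 := fun ξ j => by
    rw [shiftedPoint_apply_re]
    exact mul_neg_of_pos_of_neg hε (hlam j j.2)
  let G : StrongDual ℝ V → (D.face → ℝ) → ℂ := fun ξ x => Complex.exp (ε * lam (D.affine 0 x)) *
    (Complex.exp (-Complex.I * (ξ (D.affine 0 x) : ℝ)) * ψ ξ)
  have hG1 : ∀ ξ, ∫ x in orthant D.face, G ξ x =
      (∏ j : D.face, -(shiftedPoint lam ξ ε (D.basis j))⁻¹) * ψ ξ := by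
    intro ξ
    simp only [G, ← mul_assoc, ← prod_exp_shiftedPoint]
    rw [integral_mul_const, integral_orthant_exp (hre ξ)]
  have hG2 : ∀ x, ∫ ξ, G ξ x ∂ν =
      Complex.exp (ε * lam (D.affine 0 x)) * fourierDensity ν ψ (D.affine 0 x) := by
    intro x
    rw [fourierDensity_apply]
    exact integral_const_mul _ _
  have hcont : Continuous (Function.uncurry G) := by
    have h1 : Continuous fun p : StrongDual ℝ V × (D.face → ℝ) => p.1 (D.affine 0 p.2) :=
      continuous_fst.clm_apply ((D.continuous_affine 0).comp continuous_snd)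
    have h2 := D.continuous_affine 0
    have h3 : Continuous ψ := ψ.continuous
    unfold G Function.uncurry
    fun_prop
  have hint : Integrable (Function.uncurry G) (ν.prod (volume.restrict (orthant D.face))) := by
    have h := (ψ.integrable (μ := ν)).mul_prod (integrableOn_orthant_exp (hre 0))
    have : ProperSpace (StrongDual ℝ V) := FiniteDimensional.proper ℝ _
    refine h.mono hcont.aestronglyMeasurable (Eventually.of_forall fun p => le_of_eq ?_)
    simp only [Function.uncurry, G, prod_exp_shiftedPoint, norm_mul]
    simp [Complex.norm_exp, mul_comm]
  have h1 := hint.integral_prod_left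
  have h2 := integral_integral_swap hint
  simp only [Function.uncurry] at h1
  simp only [hG1] at h1 h2
  simp only [hG2] at h2
  exact ⟨h1, h2⟩

theorem tendsto_integral_prod_inv {lam : StrongDual ℝ V}
    (hlam : ∀ j ∈ D.face, lam (D.basis j) < 0) (ψ : 𝓢(StrongDual ℝ V, ℂ)) :
    Tendsto (fun ε : ℝ =>
        ∫ ξ, (∏ j : D.face, -(shiftedPoint lam ξ ε (D.basis j))⁻¹) * ψ ξ ∂ν)
      (𝓝[>] 0) (𝓝 (D.integral (fourierDensity ν ψ))) := by
  have h : Tendsto (fun ε : ℝ => ∫ x in orthant D.face, Complex.exp (ε * lam (D.affine 0 x)) *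
      fourierDensity ν ψ (D.affine 0 x)) (𝓝[>] 0) (𝓝 (D.integral (fourierDensity ν ψ))) := by
    rw [integral_apply]
    refine tendsto_integral_filter_of_dominated_convergence
      (fun x => ‖fourierDensity ν ψ (D.affine 0 x)‖) (Eventually.of_forall fun ε => ?_) ?_ ?_ ?_
    · have h2 := D.continuous_affine 0
      have h3 : Continuous (fourierDensity ν ψ) := (fourierDensity ν ψ).continuous
      exact (by fun_prop : Continuous _).aestronglyMeasurable
    · filter_upwards [self_mem_nhdsWithin] with ε hε
      refine (ae_restrict_iff' (MeasurableSet.univ_pi fun _ => measurableSet_Ioi)).2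
        (Eventually.of_forall fun x hx => ?_)
      rw [norm_mul]
      refine mul_le_of_le_one_left (norm_nonneg _) ?_
      rw [← Complex.ofReal_mul, Complex.norm_exp, Complex.ofReal_re, Real.exp_le_one_iff]
      refine mul_nonpos_of_nonneg_of_nonpos (le_of_lt hε) ?_
      simp only [affine, zero_add, map_sum, map_smul, smul_eq_mul]
      exact Finset.sum_nonpos fun j _ =>
        mul_nonpos_of_nonneg_of_nonpos (le_of_lt (hx j trivial)) (hlam j j.2).le
    · exact ((D.restrict 0 (fourierDensity ν ψ)).integrable).norm
    · refine Eventually.of_forall fun x => tendsto_nhdsWithin_of_tendsto_nhds ?_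
      have hc : Continuous fun ε : ℝ => Complex.exp (ε * lam (D.affine 0 x)) *
          fourierDensity ν ψ (D.affine 0 x) := by fun_prop
      simpa using hc.tendsto 0
  refine h.congr' ?_
  filter_upwards [self_mem_nhdsWithin] with ε hε
  exact (D.integrable_and_integral_prod_inv ν hlam hε ψ).2.symm

/-- Under the integral against test functions, multiplication by a polynomial in the variables
`-i⟨ξ + iε lam, b_j⟩` tends to multiplication by the same polynomial in the `-i⟨ξ, b_j⟩`. -/
theorem tendsto_integral_prod_inv_mul_eval {lam : StrongDual ℝ V}
    (hlam : ∀ j ∈ D.face, lam (D.basis j) < 0) (P : MvPolynomial D.face ℂ)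
    (ψ : 𝓢(StrongDual ℝ V, ℂ)) :
    (∀ ε : ℝ, 0 < ε → Integrable (fun ξ => (∏ j : D.face, -(shiftedPoint lam ξ ε (D.basis j))⁻¹) *
      MvPolynomial.eval (fun j : D.face => shiftedPoint lam ξ ε (D.basis j)) P * ψ ξ) ν) ∧
    Tendsto (fun ε : ℝ => ∫ ξ, (∏ j : D.face, -(shiftedPoint lam ξ ε (D.basis j))⁻¹) *
        MvPolynomial.eval (fun j : D.face => shiftedPoint lam ξ ε (D.basis j)) P * ψ ξ ∂ν)
      (𝓝[>] 0)
      (𝓝 (D.integral (fourierDensity ν (polyMul (fun j : D.face => D.basis j) P ψ)))) := by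
  induction P using MvPolynomial.induction_on generalizing ψ with
  | C a =>
    have h1 := fun ε (hε : 0 < ε) => (D.integrable_and_integral_prod_inv ν hlam hε (a • ψ)).1
    have h2 := D.tendsto_integral_prod_inv ν hlam (a • ψ)
    have h3 : polyMul (fun j : D.face => D.basis j) (MvPolynomial.C a) ψ = a • ψ := by
      ext ξ
      simp [polyMul_apply]
    simp only [MvPolynomial.eval_C, mul_assoc, h3]
    exact ⟨h1, h2⟩
  | add P Q hP hQ =>
    obtain ⟨h1, h2⟩ := hP ψ
    obtain ⟨h3, h4⟩ := hQ ψ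
    simp only [map_add, mul_add, add_mul, polyMul_add]
    refine ⟨fun ε hε => (h1 ε hε).add (h3 ε hε), (h2.add h4).congr' ?_⟩
    filter_upwards [self_mem_nhdsWithin] with ε hε
    exact (integral_add (h1 ε hε) (h3 ε hε)).symm
  | mul_X P j hP =>
    obtain ⟨h1, h2⟩ := hP ψ
    obtain ⟨h3, h4⟩ := hP (polyMul (fun j : D.face => D.basis j) (MvPolynomial.X j) ψ)
    have key : ∀ ε : ℝ, (fun ξ => (∏ j : D.face, -(shiftedPoint lam ξ ε (D.basis j))⁻¹) *
        MvPolynomial.eval (fun j : D.face => shiftedPoint lam ξ ε (D.basis j))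
          (P * MvPolynomial.X j) * ψ ξ) =
        fun ξ => (ε * lam (D.basis j)) * ((∏ j : D.face, -(shiftedPoint lam ξ ε (D.basis j))⁻¹) *
          MvPolynomial.eval (fun j : D.face => shiftedPoint lam ξ ε (D.basis j)) P * ψ ξ) +
          (∏ j : D.face, -(shiftedPoint lam ξ ε (D.basis j))⁻¹) *
          MvPolynomial.eval (fun j : D.face => shiftedPoint lam ξ ε (D.basis j)) P *
            polyMul (fun j : D.face => D.basis j) (MvPolynomial.X j) ψ ξ := by
      intro ε
      funext ξ
      have hj := shiftedPoint_apply lam ξ ε (D.basis j)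
      rw [polyMul_apply, MvPolynomial.eval_X, map_mul, MvPolynomial.eval_X]
      linear_combination (∏ j : D.face, -(shiftedPoint lam ξ ε (D.basis j))⁻¹) *
        MvPolynomial.eval (fun j : D.face => shiftedPoint lam ξ ε (D.basis j)) P * ψ ξ * hj
    simp only [key, polyMul_mul]
    refine ⟨fun ε hε => ((h1 ε hε).const_mul _).add (h3 ε hε), ?_⟩
    have hε : Tendsto (fun ε : ℝ => (ε * lam (D.basis j) : ℂ)) (𝓝[>] 0) (𝓝 0) := by
      have hc : Continuous fun ε : ℝ => (ε * lam (D.basis j) : ℂ) := by fun_prop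
      exact tendsto_nhdsWithin_of_tendsto_nhds (by simpa using hc.tendsto 0)
    have hlim := (hε.mul h2).add h4
    rw [zero_mul, zero_add] at hlim
    refine hlim.congr' ?_
    filter_upwards [self_mem_nhdsWithin] with ε hε
    rw [integral_add ((h1 ε hε).const_mul _) (h3 ε hε), integral_const_mul]

/-- The boundary value of the homogeneous component of degree `m` of the shifted generating function
of a cell, as a function of the test density. -/
def boundaryComponent (a : V) (m : ℤ) : 𝓢(StrongDual ℝ V, ℂ) →L[ℂ] ℂ :=
  if 0 ≤ m + D.face.card then
    D.integral ∘L fourierDensity ν ∘L polyMul (fun j : D.face => D.basis j)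
      (PowerSeries.coeff (m + D.face.card).toNat
        (homSeries fun j => bernoulliSeries (D.offset a j)))
  else 0

theorem tendsto_integral_genComponent {lam : StrongDual ℝ V}
    (hlam : ∀ j ∈ D.face, lam (D.basis j) < 0) (a : V) (m : ℤ) (ψ : 𝓢(StrongDual ℝ V, ℂ)) :
    (∀ ε : ℝ, 0 < ε →
      Integrable (fun ξ => D.genComponent a m (shiftedPoint lam ξ ε) * ψ ξ) ν) ∧
    Tendsto (fun ε : ℝ => ∫ ξ, D.genComponent a m (shiftedPoint lam ξ ε) * ψ ξ ∂ν)
      (𝓝[>] 0) (𝓝 (D.boundaryComponent ν a m ψ)) := by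
  simp only [genComponent, boundaryComponent]
  split_ifs
  · exact D.tendsto_integral_prod_inv_mul_eval ν hlam _ ψ
  · simp

end Cell

end

/-! ### Boundary values of generating functions -/

section

variable {V : Type u} [NormedAddCommGroup V] [NormedSpace ℝ V] {ι : Type u}

namespace CellDecomposition

variable {Λ : Submodule ℤ V} {c : Set V} {β : Type u} {D : β → Cell V ι}

theorem basis_mem_cone (hD : CellDecomposition Λ c D) (hc : IsRationalCone Λ c) (i : β) {j : ι}
    (hj : j ∈ (D i).face) : (D i).basis j ∈ c := by
  classical
  obtain ⟨F, -, rfl⟩ := hc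
  intro f hf
  have h : ∀ ε : ℝ, 0 < ε → 0 ≤ f ((D i).affine 0
      fun k => (if k = ⟨j, hj⟩ then 1 else 0) + ε) := by
    intro ε hε
    have h1 := hD.openCone_subset i ((D i).affine_sub_mem_openCone 0
      (x := fun k => (if k = ⟨j, hj⟩ then 1 else 0) + ε) fun k => by split_ifs <;> positivity)
    rw [sub_zero] at h1
    exact h1 f hf
  have hcont : Continuous fun ε : ℝ => f ((D i).affine 0
      fun k => (if k = ⟨j, hj⟩ then 1 else 0) + ε) := by
    have := (D i).continuous_affine 0
    fun_prop
  have h2 := ge_of_tendsto (tendsto_nhdsWithin_of_tendsto_nhds (s := Set.Ioi 0) (hcont.tendsto 0))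
    (eventually_nhdsWithin_of_forall h)
  simpa [Cell.affine] using h2

theorem lam_basis_neg (hD : CellDecomposition Λ c D) (hc : IsRationalCone Λ c)
    {lam : StrongDual ℝ V} (hlam : ∀ x ∈ c, x ≠ 0 → lam x < 0) (i : β) {j : ι}
    (hj : j ∈ (D i).face) : lam ((D i).basis j) < 0 :=
  hlam _ (hD.basis_mem_cone hc i hj) ((D i).basis.ne_zero j)

/-- Hence the differences `ℓ - |J|` of natural numbers are not truncated. -/
theorem card_face_le_coneDim [FiniteDimensional ℝ V] (hD : CellDecomposition Λ c D)
    (hc : IsRationalCone Λ c) (i : β) : (D i).face.card ≤ coneDim c := by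
  have h : LinearIndependent ℝ fun j : (D i).face =>
      (⟨(D i).basis j, Submodule.subset_span (hD.basis_mem_cone hc i j.2)⟩ :
        Submodule.span ℝ c) := by
    rw [← LinearMap.linearIndependent_iff (Submodule.span ℝ c).subtype (Submodule.ker_subtype _)]
    exact (D i).basis.linearIndependent.comp _ Subtype.val_injective
  simpa [coneDim] using h.fintype_card_le_finrank

theorem shiftedPoint_basis_re_neg (hD : CellDecomposition Λ c D) (hc : IsRationalCone Λ c)
    {lam : StrongDual ℝ V} (hlam : ∀ x ∈ c, x ≠ 0 → lam x < 0) (ξ : StrongDual ℝ V) {ε : ℝ}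
    (hε : 0 < ε) (i : β) {j : ι} (hj : j ∈ (D i).face) :
    (shiftedPoint lam ξ ε ((D i).basis j)).re < 0 := by
  rw [shiftedPoint_apply_re]
  exact mul_neg_of_pos_of_neg hε (hD.lam_basis_neg hc hlam i hj)

variable [FiniteDimensional ℝ V] (ν : Measure (StrongDual ℝ V)) [ν.IsAddHaarMeasure]

variable (D) in
open Classical in
/-- The boundary value of the homogeneous component of degree `m` of the shifted generating function
`M(a, c)`, as a generalized function. -/
def boundaryComponent [Fintype β] (a : V) (m : ℤ) : 𝓢'(StrongDual ℝ V, ℂ) :=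
  ContinuousLinearMap.toPointwiseConvergenceCLM _ _ _ _
    (∑ i, if (D i).Meets a then (D i).boundaryComponent ν a m else 0)

variable (D) in
open Classical in
theorem boundaryComponent_apply [Fintype β] (a : V) (m : ℤ) (ψ : 𝓢(StrongDual ℝ V, ℂ)) :
    boundaryComponent D ν a m ψ =
      ∑ i, if (D i).Meets a then (D i).boundaryComponent ν a m ψ else 0 := by
  have h : boundaryComponent D ν a m ψ =
    (∑ i, if (D i).Meets a then (D i).boundaryComponent ν a m else 0) ψ := rfl
  rw [h, _root_.sum_apply]
  refine Finset.sum_congr rfl fun i _ => ?_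
  split_ifs <;> rfl

theorem isBoundaryValue_homComponent [Fintype ι] [Fintype β] (hD : CellDecomposition Λ c D)
    (hc : IsRationalCone Λ c) {lam : StrongDual ℝ V} (hlam : ∀ x ∈ c, x ≠ 0 → lam x < 0) (a : V)
    (m : ℤ) : IsBoundaryValue ν lam (fun ζ => homComponent (M Λ a c) m (-Complex.I • ζ))
      (boundaryComponent D ν a m) := by
  classical
  intro ψ
  have hint : ∀ ε : ℝ, 0 < ε → ∀ i, Integrable (fun ξ => if (D i).Meets a then
      (D i).genComponent a m (shiftedPoint lam ξ ε) * ψ ξ else 0) ν := by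
    intro ε hε i
    split_ifs
    · exact ((D i).tendsto_integral_genComponent ν
        (fun j hj => hD.lam_basis_neg hc hlam i hj) a m ψ).1 ε hε
    · exact integrable_zero _ _ _
  have heq : ∀ ε : ℝ, 0 < ε → (fun ξ => homComponent (M Λ a c) m
      (-Complex.I • (toComplex ξ + (Complex.I * ε) • toComplex lam)) * ψ ξ) =
        fun ξ => ∑ i, if (D i).Meets a then
          (D i).genComponent a m (shiftedPoint lam ξ ε) * ψ ξ else 0 := by
    intro ε hε
    funext ξ
    have hre := fun i j (hj : j ∈ (D i).face) =>
      hD.shiftedPoint_basis_re_neg hc hlam ξ hε i hj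
    have h := hD.homComponent_M_eq hre a m (ζ := shiftedPoint lam ξ ε) fun i j hj h0 => by
      have := hre i j hj
      rw [h0] at this
      exact lt_irrefl _ this
    rw [shiftedPoint] at h
    rw [h, Finset.sum_mul]
    refine Finset.sum_congr rfl fun i _ => ?_
    split_ifs
    · rfl
    · rw [zero_mul]
  constructor
  · filter_upwards [self_mem_nhdsWithin] with ε hε
    rw [heq ε hε]
    exact integrable_finsetSum _ fun i _ => hint ε hε i
  · rw [boundaryComponent_apply]
    have h : Tendsto (fun ε : ℝ => ∑ i, if (D i).Meets a then
        ∫ ξ, (D i).genComponent a m (shiftedPoint lam ξ ε) * ψ ξ ∂ν else 0) (𝓝[>] 0)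
        (𝓝 (∑ i, if (D i).Meets a then (D i).boundaryComponent ν a m ψ else 0)) := by
      refine tendsto_finsetSum _ fun i _ => ?_
      split_ifs
      · exact ((D i).tendsto_integral_genComponent ν
          (fun j hj => hD.lam_basis_neg hc hlam i hj) a m ψ).2
      · exact tendsto_const_nhds
    refine h.congr' ?_
    filter_upwards [self_mem_nhdsWithin] with ε hε
    rw [heq ε hε, integral_finsetSum _ fun i _ => hint ε hε i]
    refine Finset.sum_congr rfl fun i _ => ?_
    split_ifs
    · rfl
    · simp

end CellDecomposition

theorem div_smul_toComplex_apply (lam ξ : StrongDual ℝ V) (ε t : ℝ) (v : V) :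
    ((-Complex.I / t) • (toComplex ξ + (Complex.I * ε) • toComplex lam)) v =
      shiftedPoint lam ξ ε (t⁻¹ • v) := by
  have h : ∀ z : ℂ, (z • (toComplex ξ + (Complex.I * ε) • toComplex lam)) v =
      z * ((ξ v : ℝ) + Complex.I * ε * (lam v : ℝ)) := fun z => rfl
  rw [h, shiftedPoint_apply, map_smul, map_smul]
  simp only [smul_eq_mul, Complex.ofReal_mul, Complex.ofReal_inv]
  linear_combination (-ε * lam v * (t : ℂ)⁻¹ : ℂ) * Complex.I_mul_I

namespace CellDecomposition

variable {Λ : Submodule ℤ V} {c : Set V} {β : Type u} {D : β → Cell V ι}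

theorem S_div_smul_eq [Fintype ι] [Fintype β] (hD : CellDecomposition Λ c D)
    (hc : IsRationalCone Λ c) {lam : StrongDual ℝ V} (hlam : ∀ x ∈ c, x ≠ 0 → lam x < 0) (a : V)
    (ξ : StrongDual ℝ V) {ε t : ℝ} (hε : 0 < ε) (ht : 0 < t) :
    (Summable fun x : {x : Λ // (x : V) ∈ a +ᵥ c} => Real.exp (ε * lam (t⁻¹ • (x : V)))) ∧
    S Λ (a +ᵥ c) ((-Complex.I / t) • (toComplex ξ + (Complex.I * ε) • toComplex lam)) =
      ∑' x : {x : Λ // (x : V) ∈ a +ᵥ c},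
        Complex.exp (shiftedPoint lam ξ ε (t⁻¹ • (x : V))) := by
  obtain ⟨h1, h2⟩ := hD.S_eq_latticeSeries a
    (η := (-Complex.I / t) • (toComplex ξ + (Complex.I * ε) • toComplex lam)) fun i j hj => by
      rw [div_smul_toComplex_apply, shiftedPoint_apply_re, map_smul]
      exact mul_neg_of_pos_of_neg hε
        (mul_neg_of_pos_of_neg (inv_pos.2 ht) (hD.lam_basis_neg hc hlam i hj))
  rw [latticeSeriesDomain, Set.mem_ofPred_eq] at h1
  rw [latticeSeries] at h2
  simp only [div_smul_toComplex_apply] at h1 h2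
  refine ⟨?_, h2⟩
  simpa only [norm_exp_shiftedPoint_apply] using h1.norm

end CellDecomposition

theorem expMul_apply (s : V) (G : 𝓢'(StrongDual ℝ V, ℂ)) (ψ : 𝓢(StrongDual ℝ V, ℂ)) :
    expMul s G ψ = G (SchwartzMap.smulLeftCLM ℂ
      (fun ξ : StrongDual ℝ V => Complex.exp (-Complex.I * (ξ s : ℝ))) ψ) := rfl

theorem smulLeftCLM_exp_apply (s : V) (ψ : 𝓢(StrongDual ℝ V, ℂ)) (ξ : StrongDual ℝ V) :
    SchwartzMap.smulLeftCLM ℂ (fun ξ : StrongDual ℝ V => Complex.exp (-Complex.I * (ξ s : ℝ))) ψ ξ =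
      Complex.exp (-Complex.I * (ξ s : ℝ)) * ψ ξ :=
  SchwartzMap.smulLeftCLM_apply_apply (hasTemperateGrowth_exp s) ψ ξ

theorem expMul_expMul_neg (s : V) (G : 𝓢'(StrongDual ℝ V, ℂ)) : expMul s (expMul (-s) G) = G := by
  ext ψ
  rw [expMul_apply, expMul_apply]
  congr 1
  ext ξ
  rw [smulLeftCLM_exp_apply, smulLeftCLM_exp_apply, ← mul_assoc, ← Complex.exp_add]
  simp

section

variable [FiniteDimensional ℝ V] (ν : Measure (StrongDual ℝ V)) [ν.IsAddHaarMeasure]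

theorem integral_exp_shiftedPoint_mul (lam : StrongDual ℝ V) (ε : ℝ) (v : V)
    (ψ : 𝓢(StrongDual ℝ V, ℂ)) :
    ∫ ξ, Complex.exp (shiftedPoint lam ξ ε v) * ψ ξ ∂ν =
      Complex.exp (ε * lam v) * fourierDensity ν ψ v := by
  rw [fourierDensity_apply, ← integral_const_mul]
  congr 1
  funext ξ
  rw [shiftedPoint_apply, Complex.exp_add]
  ring

/-- Summation and integration against a test density may be interchanged in the domain of absolute
convergence. -/
theorem integrable_and_integral_tsum_exp {X : Type*} [Countable X] (v : X → V)
    {lam : StrongDual ℝ V} {ε : ℝ} (hs : Summable fun x => Real.exp (ε * lam (v x)))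
    (ψ : 𝓢(StrongDual ℝ V, ℂ)) :
    Integrable (fun ξ => (∑' x, Complex.exp (shiftedPoint lam ξ ε (v x))) * ψ ξ) ν ∧
    ∫ ξ, (∑' x, Complex.exp (shiftedPoint lam ξ ε (v x))) * ψ ξ ∂ν =
      ∑' x, Complex.exp (ε * lam (v x)) * fourierDensity ν ψ (v x) := by
  have hcont : Continuous fun ξ => ∑' x, Complex.exp (shiftedPoint lam ξ ε (v x)) :=
    continuous_tsum (fun x => (continuous_shiftedPoint_apply lam ε (v x)).cexp) hs
      fun x ξ => (norm_exp_shiftedPoint_apply lam ξ ε (v x)).le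
  refine ⟨ψ.integrable.bdd_mul (c := ∑' x, Real.exp (ε * lam (v x))) hcont.aestronglyMeasurable
    (Eventually.of_forall fun ξ => tsum_of_norm_bounded hs.hasSum
      fun x => (norm_exp_shiftedPoint_apply lam ξ ε (v x)).le), ?_⟩
  have h := hasSum_integral_of_summable_integral_norm (μ := ν)
    (F := fun x ξ => Complex.exp (shiftedPoint lam ξ ε (v x)) * ψ ξ) (fun x => ?_) ?_
  · simp only [integral_exp_shiftedPoint_mul, tsum_mul_right] at h
    exact h.tsum_eq.symm
  · exact ψ.integrable.bdd_mul (c := Real.exp (ε * lam (v x)))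
      (continuous_shiftedPoint_apply lam ε (v x)).cexp.aestronglyMeasurable
      (Eventually.of_forall fun ξ => (norm_exp_shiftedPoint_apply lam ξ ε (v x)).le)
  · simp only [norm_mul, norm_exp_shiftedPoint_apply, integral_const_mul]
    exact hs.mul_right _

variable {Λ : Submodule ℤ V} {c : Set V} {β : Type u} {D : β → Cell V ι}

namespace CellDecomposition

theorem isBoundaryValue_S [Fintype ι] [Fintype β] [DiscreteTopology Λ]
    (hD : CellDecomposition Λ c D) (hc : IsRationalCone Λ c) {lam : StrongDual ℝ V}
    (hlam : ∀ x ∈ c, x ≠ 0 → lam x < 0) (a : V) {t : ℝ} (ht : 0 < t) :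
    IsBoundaryValue ν lam (fun ζ => S Λ (a +ᵥ c) ((-Complex.I / t) • ζ))
      (fourierDistribution ν (latticeSum Λ (a +ᵥ c) t)) := by
  intro ψ
  have : ProperSpace V := FiniteDimensional.proper ℝ V
  have : Countable Λ := TopologicalSpace.separableSpace_iff_countable.1 inferInstance
  have heq : ∀ ε : ℝ, 0 < ε → (fun ξ => S Λ (a +ᵥ c)
      ((-Complex.I / t) • (toComplex ξ + (Complex.I * ε) • toComplex lam)) * ψ ξ) = fun ξ =>
        (∑' x : {x : Λ // (x : V) ∈ a +ᵥ c},
          Complex.exp (shiftedPoint lam ξ ε (t⁻¹ • (x : V)))) * ψ ξ := fun ε hε =>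
    funext fun ξ => by rw [(hD.S_div_smul_eq hc hlam a ξ hε ht).2]
  have h := fun ε (hε : 0 < ε) => integrable_and_integral_tsum_exp ν _
    (hD.S_div_smul_eq hc hlam a 0 hε ht).1 ψ
  constructor
  · filter_upwards [self_mem_nhdsWithin] with ε hε
    rw [heq ε hε]
    exact (h ε hε).1
  have hsum := hasSum_latticeSum Λ (a +ᵥ c) ht (fourierDensity ν ψ)
  have hval : fourierDistribution ν (latticeSum Λ (a +ᵥ c) t) ψ =
      ∑' x : {x : Λ // (x : V) ∈ a +ᵥ c}, fourierDensity ν ψ (t⁻¹ • (x : V)) :=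
    hsum.tsum_eq.symm
  rw [hval]
  have hlim : Tendsto (fun ε : ℝ => ∑' x : {x : Λ // (x : V) ∈ a +ᵥ c},
      Complex.exp (ε * lam (t⁻¹ • (x : V))) * fourierDensity ν ψ (t⁻¹ • (x : V))) (𝓝[>] 0)
      (𝓝 (∑' x : {x : Λ // (x : V) ∈ a +ᵥ c}, fourierDensity ν ψ (t⁻¹ • (x : V)))) := by
    refine tendsto_tsum_of_dominated_convergence
      (hsum.summable.norm.mul_left (Real.exp |lam (t⁻¹ • a)|)) (fun x => ?_) ?_
    · have hcont : Continuous fun ε : ℝ => Complex.exp (ε * lam (t⁻¹ • (x : V))) *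
          fourierDensity ν ψ (t⁻¹ • (x : V)) := by fun_prop
      exact tendsto_nhdsWithin_of_tendsto_nhds (by simpa using hcont.tendsto 0)
    · filter_upwards [Ioc_mem_nhdsGT (zero_lt_one' ℝ)] with ε hε x
      rw [norm_mul]
      gcongr
      rw [← Complex.ofReal_mul, Complex.norm_exp, Complex.ofReal_re, Real.exp_le_exp]
      obtain ⟨y, hy, hxy⟩ := x.2
      have hy0 : lam y ≤ 0 := by
        by_cases h0 : y = 0
        · rw [h0, map_zero]
        · exact (hlam y hy h0).le
      have hx : lam (t⁻¹ • (x : V)) ≤ |lam (t⁻¹ • a)| := by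
        rw [← hxy]
        simp only [vadd_eq_add, smul_add, map_add]
        have h1 : lam (t⁻¹ • y) ≤ 0 := by
          rw [map_smul]
          exact mul_nonpos_of_nonneg_of_nonpos (by positivity) hy0
        linarith [le_abs_self (lam (t⁻¹ • a))]
      calc ε * lam (t⁻¹ • (x : V)) ≤ ε * |lam (t⁻¹ • a)| :=
            mul_le_mul_of_nonneg_left hx hε.1.le
        _ ≤ |lam (t⁻¹ • a)| := mul_le_of_le_one_left (abs_nonneg _) hε.2
  refine hlim.congr' ?_
  filter_upwards [self_mem_nhdsWithin] with ε hε
  rw [heq ε hε]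
  exact (h ε hε).2.symm

end CellDecomposition

end

/-- The boundary value of `M(ts, c)(-iξ/t) = e^{i⟨ξ, s⟩} S(ts + c)(-iξ/t)`. -/
theorem IsBoundaryValue.of_S [FiniteDimensional ℝ V] {Λ : Submodule ℤ V} {c : Set V}
    {ν : Measure (StrongDual ℝ V)} {lam : StrongDual ℝ V} {s : V} {t : ℝ} (ht : 0 < t)
    {G : 𝓢'(StrongDual ℝ V, ℂ)}
    (h : IsBoundaryValue ν lam (fun ζ => S Λ ((t • s) +ᵥ c) ((-Complex.I / t) • ζ)) G) :
    IsBoundaryValue ν lam (fun ζ => M Λ (t • s) c ((-Complex.I / t) • ζ)) (expMul (-s) G) := by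
  intro ψ
  obtain ⟨h1, h2⟩ := h (SchwartzMap.smulLeftCLM ℂ
    (fun ξ : StrongDual ℝ V => Complex.exp (-Complex.I * (ξ (-s) : ℝ))) ψ)
  have heq : ∀ ε : ℝ, (fun ξ => M Λ (t • s) c
      ((-Complex.I / t) • (toComplex ξ + (Complex.I * ε) • toComplex lam)) * ψ ξ) = fun ξ =>
        Complex.exp (-(ε * lam s)) * (S Λ ((t • s) +ᵥ c)
          ((-Complex.I / t) • (toComplex ξ + (Complex.I * ε) • toComplex lam)) *
          SchwartzMap.smulLeftCLM ℂ
            (fun ξ : StrongDual ℝ V => Complex.exp (-Complex.I * (ξ (-s) : ℝ))) ψ ξ) := by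
    intro ε
    funext ξ
    rw [M, div_smul_toComplex_apply, inv_smul_smul₀ ht.ne', shiftedPoint_apply,
      smulLeftCLM_exp_apply, neg_add, Complex.exp_add, map_neg]
    push_cast
    rw [mul_neg, neg_mul, neg_neg]
    ring
  simp only [heq]
  constructor
  · filter_upwards [h1] with ε hε
    exact hε.const_mul _
  · simp only [integral_const_mul]
    have hcont : Continuous fun ε : ℝ => Complex.exp (-(ε * lam s)) := by fun_prop
    have hlim : Tendsto (fun ε : ℝ => Complex.exp (-(ε * lam s))) (𝓝[>] 0) (𝓝 1) :=
      tendsto_nhdsWithin_of_tendsto_nhds (by simpa using hcont.tendsto 0)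
    have h3 := hlim.mul h2
    rw [one_mul] at h3
    exact h3

end

/-! ### Step-polynomials -/

section

theorem fract_mul_mem_stepPolynomials (γ : ℝ) :
    (fun t : ℝ => ((Int.fract (γ * t) : ℝ) : ℂ)) ∈ stepPolynomials :=
  Algebra.subset_adjoin ⟨γ, rfl⟩

theorem const_mem_stepPolynomials (z : ℂ) : (fun _ : ℝ => z) ∈ stepPolynomials :=
  stepPolynomials.algebraMap_mem z

theorem eval_mem_stepPolynomials {f : ℝ → ℂ} (hf : f ∈ stepPolynomials) (p : Polynomial ℂ) :
    (fun t => p.eval (f t)) ∈ stepPolynomials := by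
  have h := Polynomial.aeval_mem_adjoin_singleton ℂ (p := p) f
  have h2 : (fun t => p.eval (f t)) = Polynomial.aeval f p := by
    funext t
    rw [Polynomial.aeval_fn_apply, Polynomial.coe_aeval_eq_eval]
  rw [h2]
  exact Algebra.adjoin_le (Set.singleton_subset_iff.2 hf) h

/-- By Lagrange interpolation, any function of a step-polynomial with values in a finite set of
integers is a step-polynomial. -/
theorem comp_int_mem_stepPolynomials {F : ℝ → ℤ} (hF : (fun t => (F t : ℂ)) ∈ stepPolynomials)
    (s : Finset ℤ) (hs : ∀ t, F t ∈ s) (g : ℤ → ℂ) : (fun t => g (F t)) ∈ stepPolynomials := by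
  have h := eval_mem_stepPolynomials hF (Lagrange.interpolate s (fun n : ℤ => (n : ℂ)) g)
  convert h using 2 with t
  exact (Lagrange.eval_interpolate_at_node g (v := fun n : ℤ => (n : ℂ))
    (Int.cast_injective.injOn) (hs t)).symm

/-- Rational shifts are harmless: `⌊q {y}⌋ = q {y} - {q y}` has the values `0, …, q - 1`, and it
determines the integral part of `{y} + p / q`. -/
theorem fract_add_mem_stepPolynomials (γ : ℝ) (β : ℚ) :
    (fun t : ℝ => ((Int.fract (γ * t + β) : ℝ) : ℂ)) ∈ stepPolynomials := by
  let q : ℕ := β.den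
  have hq : (0 : ℝ) < q := by exact_mod_cast β.den_pos
  let F : ℝ → ℤ := fun t => ⌊(q : ℝ) * Int.fract (γ * t)⌋
  have hFfract : ∀ t, ((F t : ℤ) : ℝ) = q * Int.fract (γ * t) - Int.fract (q * γ * t) := by
    intro t
    have h1 : Int.fract (q * γ * t) = Int.fract ((q : ℝ) * Int.fract (γ * t)) := by
      rw [Int.fract_eq_fract]
      refine ⟨q * ⌊γ * t⌋, ?_⟩
      have := Int.floor_add_fract (γ * t)
      push_cast
      linear_combination -(q : ℝ) * this
    rw [h1]
    have := Int.floor_add_fract ((q : ℝ) * Int.fract (γ * t))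
    linear_combination this
  have hF : (fun t => (F t : ℂ)) ∈ stepPolynomials := by
    have h := stepPolynomials.sub_mem (stepPolynomials.mul_mem (const_mem_stepPolynomials q)
      (fract_mul_mem_stepPolynomials γ)) (fract_mul_mem_stepPolynomials (q * γ))
    convert h using 2 with t
    have := congrArg (fun r : ℝ => (r : ℂ)) (hFfract t)
    simpa using this
  have hmem : ∀ t, F t ∈ Finset.Ico (0 : ℤ) q := by
    intro t
    rw [Finset.mem_Ico]
    refine ⟨Int.floor_nonneg.2 (mul_nonneg hq.le (Int.fract_nonneg _)), Int.floor_lt.2 ?_⟩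
    have := mul_lt_mul_of_pos_left (Int.fract_lt_one (γ * t)) hq
    simpa using this
  have h := stepPolynomials.sub_mem (stepPolynomials.add_mem (fract_mul_mem_stepPolynomials γ)
    (const_mem_stepPolynomials β)) (comp_int_mem_stepPolynomials hF _ hmem
      fun n => (((n + β.num) / (q : ℤ) : ℤ) : ℂ))
  convert h using 2 with t
  have hβ : (β : ℝ) = β.num / q := by exact_mod_cast (Rat.num_div_den β).symm
  have hfloor : ⌊Int.fract (γ * t) + β⌋ = (F t + β.num) / (q : ℤ) := by
    have h1 : Int.fract (γ * t) + β = ((q : ℝ) * Int.fract (γ * t) + (β.num : ℤ)) / (q : ℕ) := by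
      rw [hβ]
      field_simp
    rw [h1, Int.floor_div_natCast, Int.floor_add_intCast]
  have h2 : Int.fract (γ * t + β) = Int.fract (Int.fract (γ * t) + β) := by
    rw [Int.fract_eq_fract]
    exact ⟨⌊γ * t⌋, by linear_combination -(Int.floor_add_fract (γ * t))⟩
  simp only [Pi.sub_apply, Pi.add_apply]
  rw [← hfloor, h2, Int.fract]
  push_cast
  ring

open Classical in
theorem indicator_fract_eq_zero_mem_stepPolynomials (γ : ℝ) (β : ℚ) :
    (fun t : ℝ => if Int.fract (γ * t + β) = 0 then (1 : ℂ) else 0) ∈ stepPolynomials := by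
  have h := stepPolynomials.sub_mem (stepPolynomials.sub_mem (const_mem_stepPolynomials 1)
    (fract_add_mem_stepPolynomials γ β)) (fract_add_mem_stepPolynomials (-γ) (-β))
  convert h using 2 with t
  have hneg : (-γ) * t + ((-β : ℚ) : ℝ) = -(γ * t + β) := by
    push_cast
    ring
  simp only [Pi.sub_apply, hneg]
  split_ifs with h0
  · rw [h0, Int.fract_neg_eq_zero.2 h0]
    simp
  · rw [Int.fract_neg h0]
    push_cast
    ring

theorem exists_norm_le_of_mem_stepPolynomials {f : ℝ → ℂ} (hf : f ∈ stepPolynomials) :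
    ∃ C, ∀ t, ‖f t‖ ≤ C := by
  induction hf using Algebra.adjoin_induction with
  | mem f hf =>
    obtain ⟨γ, rfl⟩ := hf
    refine ⟨1, fun t => ?_⟩
    rw [Complex.norm_real, Real.norm_of_nonneg (Int.fract_nonneg _)]
    exact (Int.fract_lt_one _).le
  | algebraMap z => exact ⟨‖z‖, fun t => le_rfl⟩
  | add f g _ _ hf hg =>
    obtain ⟨C, hC⟩ := hf
    obtain ⟨C', hC'⟩ := hg
    exact ⟨C + C', fun t => (norm_add_le _ _).trans (add_le_add (hC t) (hC' t))⟩
  | mul f g _ _ hf hg =>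
    obtain ⟨C, hC⟩ := hf
    obtain ⟨C', hC'⟩ := hg
    exact ⟨C * C', fun t => (norm_mul_le _ _).trans (mul_le_mul (hC t) (hC' t) (norm_nonneg _)
      ((norm_nonneg _).trans (hC t)))⟩

theorem isBigO_one_of_mem_stepPolynomials {f : ℝ → ℂ} (hf : f ∈ stepPolynomials) :
    f =O[atTop] fun _ : ℝ => (1 : ℝ) := by
  obtain ⟨C, hC⟩ := exists_norm_le_of_mem_stepPolynomials hf
  exact IsBigO.of_bound C (Eventually.of_forall fun t => by simpa using hC t)

/-! ### Asymptotic expansions -/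

namespace HasStepPolynomialExpansion

variable {φ φ' : ℝ → ℂ} {F : ℕ → ℝ → ℂ}

theorem congr (h : HasStepPolynomialExpansion φ F) (hφ : φ =ᶠ[atTop] φ') :
    HasStepPolynomialExpansion φ' F := by
  refine ⟨h.1, fun n => (h.2 n).congr' ?_ EventuallyEq.rfl⟩
  filter_upwards [hφ] with t ht
  rw [ht]

theorem mul_left (h : HasStepPolynomialExpansion φ F) {g : ℝ → ℂ} (hg : g ∈ stepPolynomials) :
    HasStepPolynomialExpansion (fun t => g t * φ t) fun k t => g t * F k t := by
  refine ⟨fun k => stepPolynomials.mul_mem hg (h.1 k), fun n => ?_⟩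
  refine ((isBigO_one_of_mem_stepPolynomials hg).mul (h.2 n)).congr (fun t => ?_) fun t => one_mul _
  rw [mul_sub, Finset.mul_sum]
  congr 1
  exact Finset.sum_congr rfl fun k _ => by ring

theorem sum {β : Type*} [Fintype β] {φ : β → ℝ → ℂ} {F : β → ℕ → ℝ → ℂ}
    (h : ∀ i, HasStepPolynomialExpansion (φ i) (F i)) :
    HasStepPolynomialExpansion (fun t => ∑ i, φ i t) fun k t => ∑ i, F i k t := by
  refine ⟨fun k => ?_, fun n => ?_⟩
  · have := stepPolynomials.sum_mem fun i (_ : i ∈ Finset.univ) => (h i).1 k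
    convert this using 1
    funext t
    rw [Finset.sum_apply]
  · refine (IsBigO.sum fun i (_ : i ∈ Finset.univ) => (h i).2 n).congr_left fun t => ?_
    rw [Finset.sum_apply, Finset.sum_sub_distrib]
    congr 1
    rw [Finset.sum_comm]
    exact Finset.sum_congr rfl fun k _ => (Finset.mul_sum _ _ _).symm

theorem isBigO_one (h : HasStepPolynomialExpansion φ F) : φ =O[atTop] fun _ : ℝ => (1 : ℝ) := by
  have h1 := h.2 0
  have h2 : (fun t : ℝ => (t ^ (0 + 1))⁻¹) =O[atTop] fun _ : ℝ => (1 : ℝ) := by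
    simp only [zero_add, pow_one]
    exact tendsto_inv_atTop_zero.isBigO_one ℝ
  refine ((h1.trans h2).add (isBigO_one_of_mem_stepPolynomials (h.1 0))).congr_left fun t => ?_
  simp

theorem inv_pow_mul (h : HasStepPolynomialExpansion φ F) (e : ℕ) :
    HasStepPolynomialExpansion (fun t => ((t : ℂ) ^ e)⁻¹ * φ t)
      fun k t => if e ≤ k then F (k - e) t else 0 := by
  have hinv : ∀ m : ℕ, (fun t : ℝ => ((t : ℂ) ^ m)⁻¹) =O[atTop] fun t : ℝ => (t ^ m)⁻¹ := fun m =>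
    IsBigO.of_bound 1 (Eventually.of_forall fun t => by simp)
  refine ⟨fun k => ?_, fun n => ?_⟩
  · by_cases hk : e ≤ k
    · simpa only [if_pos hk] using h.1 (k - e)
    · simpa only [if_neg hk] using const_mem_stepPolynomials 0
  · rcases lt_or_ge n e with hn | hn
    · have hsum : ∀ t : ℝ, ∑ k ∈ Finset.range (n + 1),
          ((t : ℂ) ^ k)⁻¹ * (if e ≤ k then F (k - e) t else 0) = 0 := fun t =>
        Finset.sum_eq_zero fun k hk => by
          rw [if_neg (by have := Finset.mem_range.1 hk; omega), mul_zero]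
      simp only [hsum, sub_zero]
      refine ((hinv e).mul h.isBigO_one).trans (IsBigO.of_bound 1 ?_)
      filter_upwards [eventually_ge_atTop (1 : ℝ)] with t ht
      have ht0 : 0 < t := by linarith
      rw [mul_one, one_mul, Real.norm_of_nonneg (by positivity),
        Real.norm_of_nonneg (by positivity)]
      exact inv_anti₀ (by positivity) (pow_le_pow_right₀ ht hn)
    · obtain ⟨r, rfl⟩ := Nat.exists_eq_add_of_le hn
      refine ((hinv e).mul (h.2 r)).congr (fun t => ?_) fun t => ?_
      · have hlow : ∑ k ∈ Finset.range e,
            ((t : ℂ) ^ k)⁻¹ * (if e ≤ k then F (k - e) t else 0) = 0 :=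
          Finset.sum_eq_zero fun k hk => by
            rw [if_neg (by have := Finset.mem_range.1 hk; omega), mul_zero]
        rw [add_assoc, Finset.sum_range_add _ e, hlow, zero_add, mul_sub, Finset.mul_sum]
        congr 1
        refine Finset.sum_congr rfl fun k _ => ?_
        simp only [if_pos (Nat.le_add_right e k), Nat.add_sub_cancel_left, pow_add, mul_inv]
        ring
      · rw [← mul_inv, ← pow_add, add_assoc]

end HasStepPolynomialExpansion

end

/-! ### The expansion of the Riemann sums -/

section

variable {V : Type u} [NormedAddCommGroup V] [NormedSpace ℝ V] {ι : Type u}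

/-- By the pigeonhole principle, some multiple of a lattice vector is congruent to another one
modulo any lattice basis, so its coordinates are rational. -/
theorem exists_rat_repr [Fintype ι] [FiniteDimensional ℝ V] {Λ : Submodule ℤ V} [DiscreteTopology Λ]
    {b : Module.Basis ι ℝ V} (hb : ∀ j, b j ∈ Λ) {u : V} (hu : u ∈ Λ) (j : ι) :
    ∃ r : ℚ, b.repr u j = r := by
  have hspan : Submodule.span ℤ (Set.range b) ≤ Λ := by
    rw [Submodule.span_le]
    rintro _ ⟨j, rfl⟩
    exact hb j
  have hmem : ∀ k : ℕ, ZSpan.fract b (k • u) ∈ {u | u ∈ Λ ∧ u ∈ ZSpan.fundamentalDomain b} :=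
    fun k => ⟨Λ.sub_mem (Λ.smul_of_tower_mem k hu) (hspan (ZSpan.floor b (k • u)).2),
      ZSpan.fract_mem_fundamentalDomain b _⟩
  obtain ⟨k, l, hkl, h⟩ :=
    Set.Finite.exists_lt_map_eq_of_forall_mem hmem (finite_vertices Λ b)
  have h1 := congrArg (fun x => b.repr x j) h
  simp only [ZSpan.repr_fract_apply, map_nsmul, Finsupp.smul_apply, nsmul_eq_mul] at h1
  obtain ⟨z, hz⟩ := Int.fract_eq_fract.1 h1
  have hne : (k : ℝ) - l ≠ 0 := sub_ne_zero.2 (by exact_mod_cast hkl.ne)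
  refine ⟨z / ((k : ℚ) - l), ?_⟩
  push_cast
  rw [eq_div_iff hne, ← hz]
  ring

namespace Cell

variable (D : Cell V ι)

theorem repr_smul_sub_vertex (s : V) {j : ι} {r : ℚ} (hr : D.basis.repr D.vertex j = r)
    (t : ℝ) : D.basis.repr (t • s - D.vertex) j = D.basis.repr s j * t + ((-r : ℚ) : ℝ) := by
  simp only [map_sub, map_smul, Finsupp.sub_apply, Finsupp.smul_apply, hr, smul_eq_mul]
  push_cast
  ring

theorem offset_smul_mem_stepPolynomials (hr : ∀ j, ∃ r : ℚ, D.basis.repr D.vertex j = r) (s : V)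
    (j : D.face) : (fun t : ℝ => (D.offset (t • s) j : ℂ)) ∈ stepPolynomials := by
  obtain ⟨r, hr⟩ := hr j
  have h := stepPolynomials.sub_mem (const_mem_stepPolynomials 1)
    (fract_add_mem_stepPolynomials (D.basis.repr s j) (-r))
  convert h using 2 with t
  simp only [offset, D.repr_smul_sub_vertex s hr, Pi.sub_apply, Complex.ofReal_sub,
    Complex.ofReal_one]

open Classical in
theorem indicator_meets_smul_mem_stepPolynomials [Fintype ι]
    (hr : ∀ j, ∃ r : ℚ, D.basis.repr D.vertex j = r) (s : V) :
    (fun t : ℝ => if D.Meets (t • s) then (1 : ℂ) else 0) ∈ stepPolynomials := by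
  choose r hr using hr
  have h := stepPolynomials.prod_mem (t := D.faceᶜ) fun j _ =>
    indicator_fract_eq_zero_mem_stepPolynomials (D.basis.repr s j) (-(r j))
  convert h using 1
  funext t
  rw [Finset.prod_apply, Finset.prod_boole]
  simp only [Meets, D.repr_smul_sub_vertex s (hr _), Finset.mem_compl]

theorem apply_coeff_homSeries_mem_stepPolynomials
    (hr : ∀ j, ∃ r : ℚ, D.basis.repr D.vertex j = r) (s : V)
    (L : MvPolynomial D.face ℂ →ₗ[ℂ] ℂ) (m : ℕ) :
    (fun t : ℝ => L (PowerSeries.coeff m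
      (homSeries fun j => bernoulliSeries (D.offset (t • s) j)))) ∈ stepPolynomials := by
  classical
  choose q hq using exists_coeff_bernoulliSeries
  have h := stepPolynomials.sum_mem
    fun l (_ : l ∈ Finset.finsuppAntidiag (Finset.univ : Finset D.face) m) =>
      stepPolynomials.mul_mem (stepPolynomials.prod_mem fun j (_ : j ∈ Finset.univ) =>
        eval_mem_stepPolynomials (D.offset_smul_mem_stepPolynomials hr s j) (q (l j)))
        (const_mem_stepPolynomials (L (∏ j, (MvPolynomial.X j) ^ l j)))
  convert h using 1
  funext t
  simp only [coeff_homSeries, map_sum, map_smul, smul_eq_mul, hq, Finset.sum_apply, Pi.mul_apply,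
    Finset.prod_apply]

theorem inv_smul_point {t : ℝ} (ht : t ≠ 0) (s : V) (k : D.face → ℕ) :
    t⁻¹ • D.point (t • s) k = D.affine s (boxPoint t⁻¹ (D.offset (t • s)) k) := by
  simp only [point, affine, boxPoint, smul_add, inv_smul_smul₀ ht, Finset.smul_sum, smul_smul]

theorem hasStepPolynomialExpansion_orthantSum
    (hr : ∀ j, ∃ r : ℚ, D.basis.repr D.vertex j = r) (s : V) (H : JetFamily D.face) :
    HasStepPolynomialExpansion (fun t : ℝ => H.orthantSum t⁻¹ (D.offset (t • s)) 1)
      fun m t => H.orthantIntegral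
        (PowerSeries.coeff m (homSeries fun j => bernoulliSeries (D.offset (t • s) j))) := by
  refine ⟨fun m => D.apply_coeff_homSeries_mem_stepPolynomials hr s _ m, fun n => ?_⟩
  obtain ⟨C, hC⟩ := H.exists_orthantSum_sub_bound n
  refine IsBigO.of_bound C ?_
  filter_upwards [eventually_ge_atTop (1 : ℝ)] with t ht
  have ht0 : 0 < t := by linarith
  have h := hC t⁻¹ (D.offset (t • s)) (inv_pos.2 ht0) (inv_le_one_of_one_le₀ ht)
    fun j => Set.Ioc_subset_Icc_self (D.offset_mem _ j)
  rw [Real.norm_of_nonneg (by positivity), ← inv_pow]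
  simpa only [Complex.ofReal_inv, inv_pow] using h

variable [FiniteDimensional ℝ V] (ν : Measure (StrongDual ℝ V)) [ν.IsAddHaarMeasure]

theorem jetFamily_orthantIntegral (s : V) (ψ : 𝓢(StrongDual ℝ V, ℂ)) (P : MvPolynomial D.face ℂ) :
    (D.jetFamily ν s ψ).orthantIntegral P =
      D.integral (fourierDensity ν (polyMul (fun j : D.face => D.basis j) P
        (SchwartzMap.smulLeftCLM ℂ
          (fun ξ : StrongDual ℝ V => Complex.exp (-Complex.I * (ξ s : ℝ))) ψ))) := by
  have hcomm : polyMul (fun j : D.face => D.basis j) P (SchwartzMap.smulLeftCLM ℂ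
      (fun ξ : StrongDual ℝ V => Complex.exp (-Complex.I * (ξ s : ℝ))) ψ) =
      SchwartzMap.smulLeftCLM ℂ (fun ξ : StrongDual ℝ V => Complex.exp (-Complex.I * (ξ s : ℝ)))
        (polyMul (fun j : D.face => D.basis j) P ψ) := by
    ext ξ
    rw [smulLeftCLM_exp_apply, polyMul_apply, polyMul_apply, smulLeftCLM_exp_apply]
    ring
  rw [hcomm, integral_apply]
  simp only [fourierDensity_smulLeftCLM_exp]
  have haff : ∀ x, s + D.affine 0 x = D.affine s x := fun x => by simp [affine]
  simp only [haff]
  rfl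

end Cell

namespace CellDecomposition

variable [FiniteDimensional ℝ V] (ν : Measure (StrongDual ℝ V)) [ν.IsAddHaarMeasure]
  {Λ : Submodule ℤ V} {c : Set V} {β : Type u} {D : β → Cell V ι} [Fintype β]

open Classical in
theorem expMul_boundaryComponent (hD : CellDecomposition Λ c D) (hc : IsRationalCone Λ c)
    (s : V) (k : ℕ) (a : V) (ψ : 𝓢(StrongDual ℝ V, ℂ)) :
    expMul s (boundaryComponent D ν a ((k : ℤ) - (coneDim c : ℤ))) ψ =
      ∑ i, (if (D i).Meets a then (1 : ℂ) else 0) *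
        (if coneDim c - (D i).face.card ≤ k then ((D i).jetFamily ν s ψ).orthantIntegral
          (PowerSeries.coeff (k - (coneDim c - (D i).face.card))
            (homSeries fun j => bernoulliSeries ((D i).offset a j))) else 0) := by
  rw [expMul_apply, boundaryComponent_apply]
  refine Finset.sum_congr rfl fun i _ => ?_
  have hle := hD.card_face_le_coneDim hc i
  rw [ite_mul, one_mul, zero_mul]
  congr 1
  by_cases hk : coneDim c - (D i).face.card ≤ k
  · have h0 : 0 ≤ (k : ℤ) - (coneDim c : ℤ) + (D i).face.card := by omega
    have hn : ((k : ℤ) - (coneDim c : ℤ) + (D i).face.card).toNat =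
        k - (coneDim c - (D i).face.card) := by omega
    rw [Cell.boundaryComponent, if_pos h0, if_pos hk, hn, Cell.jetFamily_orthantIntegral]
    rfl
  · have h0 : ¬ 0 ≤ (k : ℤ) - (coneDim c : ℤ) + (D i).face.card := by omega
    rw [Cell.boundaryComponent, if_neg h0, if_neg hk]
    rfl

variable [Fintype ι] [DiscreteTopology Λ]

open Classical in
/-- The contribution of a cell of dimension `|J|` to the Riemann sum is `t^{-(ℓ - |J|)}` times a
Riemann sum over an orthant, with mesh `1 / t`. -/
theorem fourierDistribution_riemannSum (hD : CellDecomposition Λ c D) (hc : IsRationalCone Λ c)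
    (s : V) {t : ℝ} (ht : 0 < t) (ψ : 𝓢(StrongDual ℝ V, ℂ)) :
    fourierDistribution ν (riemannSum Λ s c t) ψ =
      ∑ i, (if (D i).Meets (t • s) then (1 : ℂ) else 0) *
        (((t : ℂ) ^ (coneDim c - (D i).face.card))⁻¹ *
          ((D i).jetFamily ν s ψ).orthantSum t⁻¹ ((D i).offset (t • s)) 1) := by
  have ht0 : (t : ℂ) ≠ 0 := by exact_mod_cast ht.ne'
  have hsum := hasSum_latticeSum Λ ((t • s) +ᵥ c) ht (fourierDensity ν ψ)
  have hval : fourierDistribution ν (riemannSum Λ s c t) ψ =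
      ((t : ℂ) ^ coneDim c)⁻¹ * latticeSum Λ ((t • s) +ᵥ c) t (fourierDensity ν ψ) := rfl
  rw [hval, ← hsum.tsum_eq,
    hD.tsum_eq (t • s) (f := fun x => fourierDensity ν ψ (t⁻¹ • x)) hsum.summable, Finset.mul_sum]
  refine Finset.sum_congr rfl fun i _ => ?_
  split_ifs
  · simp only [(D i).inv_smul_point ht.ne']
    have hjet : ∀ x, ((D i).jetFamily ν s ψ).toFun 1 x =
        fourierDensity ν ψ ((D i).affine s x) := by
      intro x
      have h : ((D i).jetFamily ν s ψ).toFun 1 x = fourierDensity ν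
        (polyMul (fun j : (D i).face => (D i).basis j) 1 ψ) ((D i).affine s x) := rfl
      rw [h, polyMul_one]
    rw [JetFamily.orthantSum, one_mul, ← mul_assoc, Fintype.card_coe]
    simp only [hjet]
    congr 1
    conv_lhs => rw [← Nat.sub_add_cancel (hD.card_face_le_coneDim hc i)]
    rw [pow_add, mul_inv, Complex.ofReal_inv, inv_pow]
  · rw [mul_zero, zero_mul]

theorem hasStepPolynomialExpansion (hD : CellDecomposition Λ c D) (hc : IsRationalCone Λ c)
    (s : V) (ψ : 𝓢(StrongDual ℝ V, ℂ)) : HasStepPolynomialExpansion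
      (fun t => fourierDistribution ν (riemannSum Λ s c t) ψ)
      fun k t => expMul s (boundaryComponent D ν (t • s) ((k : ℤ) - (coneDim c : ℤ))) ψ := by
  classical
  have hr := fun i => exists_rat_repr (hD.basis_mem i) (hD.vertex_mem i)
  have h := HasStepPolynomialExpansion.sum fun i =>
    (((D i).hasStepPolynomialExpansion_orthantSum (hr i) s ((D i).jetFamily ν s ψ)).inv_pow_mul
      (coneDim c - (D i).face.card)).mul_left
      ((D i).indicator_meets_smul_mem_stepPolynomials (hr i) s)
  simp only [hD.expMul_boundaryComponent ν hc]
  refine h.congr ?_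
  filter_upwards [eventually_gt_atTop 0] with t ht
  exact (hD.fourierDistribution_riemannSum ν hc s ht ψ).symm

end CellDecomposition

end

end RiemannSumCone

end

open RiemannSumCone

theorem mainTheorem5 {V : Type*} [NormedAddCommGroup V] [NormedSpace ℝ V] [FiniteDimensional ℝ V]
    (Λ : Submodule ℤ V) [DiscreteTopology Λ] [IsZLattice ℝ Λ]
    (ν : Measure (StrongDual ℝ V)) [ν.IsAddHaarMeasure]
    (c : Set V) (hc : RiemannSumCone.IsRationalCone Λ c) (hpointed : RiemannSumCone.IsPointed c)
    (s : V) (lam : StrongDual ℝ V) (hlam : ∀ x ∈ c, x ≠ 0 → lam x < 0) :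
    ∃ (BS BM : ℝ → 𝓢'(StrongDual ℝ V, ℂ)) (B : ℕ → ℝ → 𝓢'(StrongDual ℝ V, ℂ))
      (A : ℕ → ℝ → 𝓢'(V, ℂ)),
      -- existence of the boundary values
      (∀ t : ℝ, 0 < t → RiemannSumCone.IsBoundaryValue ν lam
        (fun ζ => RiemannSumCone.S Λ ((t • s) +ᵥ c) ((-Complex.I / t) • ζ)) (BS t)) ∧
      (∀ t : ℝ, 0 < t → RiemannSumCone.IsBoundaryValue ν lam
        (fun ζ => RiemannSumCone.M Λ (t • s) c ((-Complex.I / t) • ζ)) (BM t)) ∧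
      (∀ (k : ℕ) (t : ℝ), RiemannSumCone.IsBoundaryValue ν lam
        (fun ζ => RiemannSumCone.homComponent (RiemannSumCone.M Λ (t • s) c)
          ((k : ℤ) - (RiemannSumCone.coneDim c : ℤ)) (-Complex.I • ζ)) (B k t)) ∧
      -- the Fourier transform of the Riemann sum
      (∀ t : ℝ, 0 < t →
        RiemannSumCone.fourierDistribution ν (RiemannSumCone.riemannSum Λ s c t) =
          ((t : ℂ) ^ RiemannSumCone.coneDim c)⁻¹ • BS t ∧
        ((t : ℂ) ^ RiemannSumCone.coneDim c)⁻¹ • BS t =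
          ((t : ℂ) ^ RiemannSumCone.coneDim c)⁻¹ • RiemannSumCone.expMul s (BM t)) ∧
      -- the asymptotic expansion of the Riemann sum
      (∀ h : 𝓢(V, ℂ), RiemannSumCone.HasStepPolynomialExpansion
        (fun t => RiemannSumCone.riemannSum Λ s c t h) (fun k t => A k t h)) ∧
      -- the Fourier transform of its coefficients, and the expansion of the Fourier transform
      (∀ (k : ℕ) (t : ℝ),
        RiemannSumCone.fourierDistribution ν (A k t) = RiemannSumCone.expMul s (B k t)) ∧
      (∀ ψ : 𝓢(StrongDual ℝ V, ℂ), RiemannSumCone.HasStepPolynomialExpansion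
        (fun t => RiemannSumCone.fourierDistribution ν (RiemannSumCone.riemannSum Λ s c t) ψ)
        (fun k t => RiemannSumCone.expMul s (B k t) ψ)) := by
  obtain ⟨ι, _, β, _, D, hD⟩ := hc.exists_cellDecomposition
  obtain ⟨Ψ, hΨ, hΨ'⟩ := exists_fourierDensity_inverse ν
  have hexp := hD.hasStepPolynomialExpansion ν hc s
  let B : ℕ → ℝ → 𝓢'(StrongDual ℝ V, ℂ) := fun k t =>
    CellDecomposition.boundaryComponent D ν (t • s) ((k : ℤ) - (coneDim c : ℤ))
  refine ⟨fun t => fourierDistribution ν (latticeSum Λ ((t • s) +ᵥ c) t),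
    fun t => expMul (-s) (fourierDistribution ν (latticeSum Λ ((t • s) +ᵥ c) t)), B,
    fun k t => PointwiseConvergenceCLM.precomp _ Ψ (expMul s (B k t)),
    fun t ht => hD.isBoundaryValue_S ν hc hlam _ ht,
    fun t ht => (hD.isBoundaryValue_S ν hc hlam _ ht).of_S ht,
    fun k t => hD.isBoundaryValue_homComponent ν hc hlam _ _,
    fun t ht => ⟨rfl, by rw [expMul_expMul_neg]⟩, fun h => ?_, fun k t => ?_, hexp⟩
  · -- every Schwartz function on `V` is the Fourier transform of a test density
    refine (hexp (Ψ h)).congr (Eventually.of_forall fun t => ?_)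
    exact congrArg (riemannSum Λ s c t) (hΨ' h)
  · ext ψ
    exact congrArg (expMul s (B k t)) (hΨ ψ)
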